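/- **Conventions.** Let $n$ qudits have dimensions $d_1,\dots,d_n$ with $d_i\le D$ for a constant $D$ (the case $d_i=2$ for all $i$ is the case of $n$ qubits), let $\mathcal H=\mathbb C^{d_1}\otimes\cdots\otimes\mathbb C^{d_n}$ with computational basis $\{|x\rangle\}$, $x=x_1\cdots x_n$, and norm $\|\cdot\|_2$. As usual, circuits come in families: they are indexed by instances which have a classical description of length $\mathrm{poly}(n)$ that algorithms receive, together with the list of dimensions, as input. Classical algorithms are programs with bit-cost running time; a randomized one receives in addition a string of polynomially many independent fair coin flips. A family of states $|\psi\rangle\in\mathcal H$ is *computationally tractable (CT)* if 1. a randomized classical algorithm samples from $p_x=|\langle x|\psi\rangle|^2$, up to error $2^{-m}$ in $\ell_1$-distance, in time $\mathrm{poly}(n,m)$, and 2. a deterministic classical algorithm computes, given $x$, the coefficient $\langle x|\psi\rangle$ up to error $2^{-m}$ in time $\mathrm{poly}(n,m)$. A unit vector $|\varphi\rangle\in\mathcal H$ is *$\eta$-approximately $t$-sparse* if there is a (not necessarily normalized) vector $v$ with at most $t$ nonzero amplitudes such that $\||\varphi\rangle-v\|_2\le\eta$. **Theorem.** Consider a family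 of unitary circuits $\mathcal C=U_2U_1$ with input states $|\psi_{\rm in}\rangle$ on such systems $\mathcal H$ (qubits, or qudits of bounded, possibly different, dimensions), such that - (a) the states $U_1|\psi_{\rm in}\rangle$ are CT; - (b') $U_2=u_1\otimes\cdots\otimes u_n$ is an arbitrary tensor product of unitaries $u_i$ on $\mathbb C^{d_i}$; - (c) the final state $|\psi_{\rm out}\rangle=U_2U_1|\psi_{\rm in}\rangle$ is promised to be $\sqrt\varepsilon$-approximately $t$-sparse, for some $0<\varepsilon\le 1/6$ and some $t$. Then there is a randomized classical algorithm which, given the description of the instance, the numbers $t$, $\lceil 1/\varepsilon\rceil$, $\lceil\log_2(1/\delta)\rceil$ with $0<\delta<1$, and the entries of the matrices $u_i$ to $\mathrm{poly}(n,t,1/\varepsilon,\log\frac1\delta)$ binary digits, runs in time $\mathrm{poly}(n,t,1/\varepsilon,\log\frac1\delta)$ and always outputs, by listing all its nonzero amplitudes (as complex rational numbers), an $s$-sparse normalized state $|\psi\rangle$ with $s=O(t/\varepsilon)$, such that with probability at least $1-\delta$ $$\||\psi\rangle-|\psi_{\rm out}\rangle\|_2=O(\sqrt\varepsilon).$$ The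 constants in $O(t/\varepsilon)$ and $O(\sqrt\varepsilon)$ are absolute; the polynomials depend only on the family of dimensions and CT states (and not on $U_2$, $t$, $\varepsilon$, $\delta$). -/

import Mathlib

/-! ### Machine model: while-programs on binary trees of integers, with logarithmic (bit) cost -/

/-- The data a program handles: binary trees whose leaves are integers. -/
inductive Datum : Type
  | int (z : ℤ) : Datum
  | pair (a b : Datum) : Datum

namespace Datum

/-- The number of bits (up to a constant factor) needed to write the datum down. -/
def size : Datum → ℕ
  | int z => 1 + Nat.size z.natAbs
  | pair a b => 1 + a.size + b.size

def fst : Datum → Datum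
  | int _ => int 0
  | pair a _ => a

def snd : Datum → Datum
  | int _ => int 0
  | pair _ b => b

def toInt : Datum → ℤ
  | int z => z
  | pair _ _ => 0

def isPair : Datum → Datum
  | int _ => int 0
  | pair _ _ => int 1

/-- Lists as nested pairs, ended by the integer `0`. -/
def ofList : List Datum → Datum
  | [] => int 0
  | a :: l => pair a (ofList l)

/-- The datum of a natural number. -/
def nat (k : ℕ) : Datum := int k

/-- The datum of a finite sequence. -/
def ofFn {n : ℕ} (f : Fin n → Datum) : Datum := ofList (List.ofFn f)

end Datum

/-- Elementary operations. The binary ones act on the two components of a pair. -/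
inductive Op : Type
  | id | fst | snd | isPair
  | lit (z : ℤ)
  | add | sub | mul | div | le

/-- Meaning of the elementary operations (`div` is division with rounding, `le` returns `1` or
`0`). -/
def Op.apply : Op → Datum → Datum
  | .id, v => v
  | .fst, v => v.fst
  | .snd, v => v.snd
  | .isPair, v => v.isPair
  | .lit z, _ => .int z
  | .add, v => .int (v.fst.toInt + v.snd.toInt)
  | .sub, v => .int (v.fst.toInt - v.snd.toInt)
  | .mul, v => .int (v.fst.toInt * v.snd.toInt)
  | .div, v => .int (v.fst.toInt / v.snd.toInt)
  | .le, v => .int (if v.fst.toInt ≤ v.snd.toInt then 1 else 0)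

/-- Programs. `comp g f` is `g` after `f`; `fork f g` runs both on the same input and pairs the
results; `ite c f g` branches on whether `c` returns a nonzero integer; `loop c f` is
"while `c` returns a nonzero integer, replace the current datum by the result of `f`". -/
inductive Prog : Type
  | op (o : Op) : Prog
  | comp (g f : Prog) : Prog
  | fork (f g : Prog) : Prog
  | ite (c f g : Prog) : Prog
  | loop (c f : Prog) : Prog

/-- `Runs p x y T`: on input `x` the program `p` halts with output `y` after `T` steps, where an
elementary operation is charged the sizes of its operand and of its result (logarithmic cost). -/
inductive Runs : Prog → Datum → Datum → ℕ → Prop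
  | op (o : Op) (x : Datum) : Runs (.op o) x (o.apply x) (1 + x.size + (o.apply x).size)
  | comp {f g : Prog} {x y z : Datum} {S T : ℕ} :
      Runs f x y S → Runs g y z T → Runs (.comp g f) x z (S + T + 1)
  | fork {f g : Prog} {x y z : Datum} {S T : ℕ} :
      Runs f x y S → Runs g x z T → Runs (.fork f g) x (.pair y z) (S + T + 1)
  | iteTrue {c f g : Prog} {x b y : Datum} {S T : ℕ} :
      Runs c x b S → b.toInt ≠ 0 → Runs f x y T → Runs (.ite c f g) x y (S + T + 1)
  | iteFalse {c f g : Prog} {x b y : Datum} {S T : ℕ} :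
      Runs c x b S → b.toInt = 0 → Runs g x y T → Runs (.ite c f g) x y (S + T + 1)
  | loopStop {c f : Prog} {x b : Datum} {S : ℕ} :
      Runs c x b S → b.toInt = 0 → Runs (.loop c f) x x (S + 1)
  | loopStep {c f : Prog} {x b y z : Datum} {S T U : ℕ} :
      Runs c x b S → b.toInt ≠ 0 → Runs f x y T → Runs (.loop c f) y z U →
      Runs (.loop c f) x z (S + T + U + 1)

/-- Polynomials in one size parameter, up to domination: `c (N + 1) ^ c`. -/
def polyBound (c N : ℕ) : ℕ := c * (N + 1) ^ c

/-- Probability of an event over `b` independent fair coin flips; the string of outcomes is read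
as a number below `2 ^ b`. A randomized algorithm is a program that receives such a string as a
part of its input. -/
noncomputable def coinProb (b : ℕ) (E : Fin (2 ^ b) → Prop) : ℝ :=
  (Nat.card {r : Fin (2 ^ b) // E r} : ℝ) / 2 ^ b

/-! ### Systems of qudits -/

/-- Labels `x = x₁ ⋯ xₙ` of the computational basis of `ℂ^{d₁} ⊗ ⋯ ⊗ ℂ^{dₙ}`. -/
abbrev BasisLabel {n : ℕ} (d : Fin n → ℕ) : Type := (i : Fin n) → Fin (d i)

/-- The space `ℂ^{d₁} ⊗ ⋯ ⊗ ℂ^{dₙ}`, in coordinates with respect to the computational basis. -/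
abbrev QuditSpace {n : ℕ} (d : Fin n → ℕ) : Type := EuclideanSpace ℂ (BasisLabel d)

/-- The matrix of `u₁ ⊗ ⋯ ⊗ uₙ` in the computational basis. -/
def tensorProductMatrix {n : ℕ} {d : Fin n → ℕ}
    (u : (i : Fin n) → Matrix (Fin (d i)) (Fin (d i)) ℂ) :
    Matrix (BasisLabel d) (BasisLabel d) ℂ :=
  Matrix.of fun x y => ∏ i, u i (x i) (y i)

/-- `φ` is within `η` (in `ℓ²`-norm) of a vector with at most `t` nonzero amplitudes. -/
def IsApproxSparse {n : ℕ} {d : Fin n → ℕ} (η : ℝ) (t : ℕ) (φ : QuditSpace d) : Prop :=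
  ∃ v : QuditSpace d, Nat.card {x : BasisLabel d // v x ≠ 0} ≤ t ∧ ‖φ - v‖ ≤ η

/-- The datum of a basis label. -/
def labelDatum {n : ℕ} {d : Fin n → ℕ} (x : BasisLabel d) : Datum :=
  .ofFn fun i => .nat (x i)

/-- The complex number `(z₁ + z₂ i) / 2 ^ m`. -/
noncomputable def dyadic (m : ℕ) (z : ℤ × ℤ) : ℂ := (z.1 + z.2 * Complex.I) / 2 ^ m

/-- The datum of a pair of integers. -/
def intPairDatum (z : ℤ × ℤ) : Datum := .pair (.int z.1) (.int z.2)

/-- The classical description of an instance that programs receive: a code for the instance, and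
the list of the local dimensions (hence also the number of qudits). -/
def instanceDatum {n : ℕ} (code : Datum) (d : Fin n → ℕ) : Datum :=
  .pair code (.ofFn fun i => .nat (d i))

/-- Computationally tractable families of states. The family is indexed by instances `w`; the
state of `w` lives on `n w` qudits of dimensions `d w i`.
*Sampling*: some randomized program samples from the distribution `x ↦ |⟨x|ψ⟩|²`, up to a total
variation distance `∑ |p - p'|` of `2 ^ (-m)`, in time polynomial in `n` and `m`.
*Query*: some deterministic program computes, on input `x`, the coefficient `⟨x|ψ⟩` up to an error
`2 ^ (-m)` in time polynomial in `n` and `m`. -/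
def IsCT {ι : Type} {n : ι → ℕ} (d : (w : ι) → Fin (n w) → ℕ) (code : ι → Datum)
    (ψ : (w : ι) → QuditSpace (d w)) : Prop :=
  (∃ (S : Prog) (b c : ℕ), ∀ (w : ι) (m : ℕ),
    ∃ X : Fin (2 ^ polyBound b (n w + m)) → BasisLabel (d w),
      (∀ r : Fin (2 ^ polyBound b (n w + m)), ∃ T ≤ polyBound c (n w + m),
        Runs S (.pair (instanceDatum (code w) (d w)) (.pair (.nat m) (.nat r)))
          (labelDatum (X r)) T) ∧
      ∑ x, |coinProb (polyBound b (n w + m)) (fun r => X r = x) - ‖ψ w x‖ ^ 2|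
        ≤ 1 / 2 ^ m) ∧
  (∃ (Q : Prog) (c : ℕ), ∀ (w : ι) (m : ℕ) (x : BasisLabel (d w)),
    ∃ z : ℤ × ℤ, ‖ψ w x - dyadic m z‖ ≤ 1 / 2 ^ m ∧
      ∃ T ≤ polyBound c (n w + m),
        Runs Q (.pair (instanceDatum (code w) (d w)) (.pair (.nat m) (labelDatum x)))
          (intPairDatum z) T)

/-! ### Explicit lists of amplitudes, and inputs of the simulation algorithm -/

/-- An entry of a list of amplitudes: a basis label `x` and integers `(z₁, z₂)`, `q`, which stand
for the amplitude `(z₁ + z₂ i) / q` at `x`. -/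
abbrev AmpEntry {n : ℕ} (d : Fin n → ℕ) : Type := BasisLabel d × (ℤ × ℤ) × ℤ

/-- The amplitude of an entry. -/
noncomputable def AmpEntry.amp {n : ℕ} {d : Fin n → ℕ} (e : AmpEntry d) : ℂ :=
  (e.2.1.1 + e.2.1.2 * Complex.I) / e.2.2

/-- The vector described by a list of amplitudes. -/
noncomputable def listVector {n : ℕ} {d : Fin n → ℕ} (L : List (AmpEntry d)) : QuditSpace d :=
  (L.map fun e => EuclideanSpace.single e.1 e.amp).sum

/-- `L` lists exactly the nonzero amplitudes, each one once, of a (normalized) state. -/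
def ListsState {n : ℕ} {d : Fin n → ℕ} (L : List (AmpEntry d)) : Prop :=
  (L.map Prod.fst).Nodup ∧ (∀ e ∈ L, e.amp ≠ 0) ∧ ‖listVector L‖ = 1

/-- The datum of a list of amplitudes. -/
def ampListDatum {n : ℕ} {d : Fin n → ℕ} (L : List (AmpEntry d)) : Datum :=
  .ofList (L.map fun e => .pair (labelDatum e.1) (.pair (intPairDatum e.2.1) (.int e.2.2)))

/-- The datum of a list of square matrices with entries given by pairs of integers. -/
def matricesDatum {n : ℕ} {d : Fin n → ℕ} (a : (i : Fin n) → Fin (d i) → Fin (d i) → ℤ × ℤ) :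
    Datum :=
  .ofFn fun i => .ofFn fun j => .ofFn fun k => intPairDatum (a i j k)

/-!
The output amplitudes are `φ y = ∑ x, ∏ j, u j (y j) (x j) * ψ x`, where `ψ = U₁ ψin`. The large ones
are found by a search through the prefixes of labels. The `marginal` probability of a prefix `y₁ ⋯ yᵢ`
of the output is at least the squared modulus of each amplitude that extends it, and the marginals of
the prefixes of a given length sum to `1`; hence at most `4 * K` prefixes have marginals `1 / (4 * K)`
or more, and if marginals can be estimated up to `1 / (4 * K)`, a breadth-first search that keeps the
prefixes with large estimates reaches all labels whose probability is at least `3 / (4 * K)`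
(`SimData.cands`, `SimData.Good.mem_support`). With `K = t * ⌈1/ε⌉`, the amplitudes that are missed
on the support of a `t`-sparse approximation contribute at most `3 / 4 * ε` to the squared error.

*Estimation.* Amplitudes and marginals have the form `∑ s, F s * G s` with `∑ ‖F‖ ^ 2 ≤ 1` and
`∑ ‖G‖ ^ 2 ≤ 1`; for marginals, the index `s` runs over pairs of labels. If `s` is sampled with
probability `‖F s‖ ^ 2`, and another `s` with probability `‖G s‖ ^ 2`, the sum of the two values of
the statistic `ratio f g = f * g / (‖f‖ ^ 2 + ‖g‖ ^ 2)` is an unbiased estimator. It is bounded and,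
unlike a quotient of amplitudes, stable under small errors of `f` and `g`
(`mul_norm_ratio_sub_le`). The samples are obtained by drawing `x` from the state `ψ` and then `x'`
letter by letter from rows of the unitary matrices (`SimData.samplePair`, `SimData.avg_samplePair`).
For marginals `G` is the conjugate of `F` with the two labels exchanged, and by the symmetry of the
statistic (`ratio_conj_re_symm`) one sample suffices. Empirical means concentrate exponentially
(`card_all_close_ge`). Since all labels are treated with the same samples, a union bound over the
exponentially many labels makes all estimates good at once (`SimData.Accurate.card_good_ge`), so the
adaptivity of the search does not matter.

*Normalization.* The output has to be a unit vector with rational amplitudes. The vector of estimates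
is replaced by a rational point of the unit sphere by means of a stereographic projection whose
distance from the vector is controlled by its deviation from norm one (`sum_stereo_sub_le`,
`norm_stereoList_sub_le`).

*Running time.* `Feas N x y` says that one program transforms the datum `x ω` into `y ω` for all
indices `ω`, in time polynomial in `N ω`. The index type is arbitrary, so the body of a loop is again
a statement of this kind, whose index type has the iteration as a further component. Closure of
`Feas` under composition, arithmetic, case distinction, loops, sums, and list comprehension yields a
program for the whole simulation (`SimData.Computable.output`) without writing it down.
-/

open scoped ComplexConjugate

/-! ### Polynomially bounded quantities -/

/-- The family of numbers `f` is bounded by a polynomial in the size parameter `N`. -/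
def PolyBdd {Ω : Type} (N f : Ω → ℕ) : Prop := ∃ c, ∀ ω, f ω ≤ polyBound c (N ω)

theorem polyBound_mono {c c' : ℕ} (h : c ≤ c') (N : ℕ) : polyBound c N ≤ polyBound c' N :=
  Nat.mul_le_mul h (Nat.pow_le_pow_right (Nat.succ_pos _) h)

theorem polyBound_add_le (c c' N : ℕ) :
    polyBound c N + polyBound c' N ≤ polyBound (c + c') N := by
  unfold polyBound
  have h1 : (N + 1) ^ c ≤ (N + 1) ^ (c + c') := Nat.pow_le_pow_right (by omega) (by omega)
  have h2 : (N + 1) ^ c' ≤ (N + 1) ^ (c + c') := Nat.pow_le_pow_right (by omega) (by omega)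
  nlinarith [Nat.mul_le_mul_left c h1, Nat.mul_le_mul_left c' h2]

theorem polyBound_mul_le (c c' N : ℕ) :
    polyBound c N * polyBound c' N ≤ polyBound (c * c' + (c + c')) N := by
  unfold polyBound
  calc c * (N + 1) ^ c * (c' * (N + 1) ^ c') = c * c' * (N + 1) ^ (c + c') := by ring
    _ ≤ _ := Nat.mul_le_mul (by omega) (Nat.pow_le_pow_right (by omega) (by omega))

theorem le_polyBound_const (k N : ℕ) : k ≤ polyBound k N :=
  Nat.le_mul_of_pos_right _ (by positivity)

namespace PolyBdd

variable {Ω : Type} {N f g : Ω → ℕ}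

theorem const (N : Ω → ℕ) (k : ℕ) : PolyBdd N fun _ => k := ⟨k, fun _ => le_polyBound_const _ _⟩

theorem self (N : Ω → ℕ) : PolyBdd N N := ⟨1, fun ω => by simp [polyBound]⟩

theorem mono (hg : PolyBdd N g) (h : ∀ ω, f ω ≤ g ω) : PolyBdd N f :=
  hg.imp fun _ hc ω => (h ω).trans (hc ω)

theorem add (hf : PolyBdd N f) (hg : PolyBdd N g) : PolyBdd N fun ω => f ω + g ω := by
  obtain ⟨c, hc⟩ := hf
  obtain ⟨c', hc'⟩ := hg
  exact ⟨c + c', fun ω => (Nat.add_le_add (hc ω) (hc' ω)).trans (polyBound_add_le _ _ _)⟩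

theorem mul (hf : PolyBdd N f) (hg : PolyBdd N g) : PolyBdd N fun ω => f ω * g ω := by
  obtain ⟨c, hc⟩ := hf
  obtain ⟨c', hc'⟩ := hg
  exact ⟨_, fun ω => (Nat.mul_le_mul (hc ω) (hc' ω)).trans (polyBound_mul_le _ _ _)⟩

theorem pow (hf : PolyBdd N f) (k : ℕ) : PolyBdd N fun ω => f ω ^ k := by
  induction k with
  | zero => simpa using const N 1
  | succ k ih => simpa only [pow_succ] using ih.mul hf

theorem polyBound (hf : PolyBdd N f) (c : ℕ) : PolyBdd N fun ω => polyBound c (f ω) :=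
  (const N c).mul ((hf.add (const N 1)).pow c)

theorem reindex {Ω' : Type} (hf : PolyBdd N f) (π : Ω' → Ω) :
    PolyBdd (fun q => N (π q)) fun q => f (π q) := hf.imp fun _ hc _ => hc _

end PolyBdd

/-! ### Sizes of data -/

theorem natSize_add_le (a b : ℕ) : Nat.size (a + b) ≤ Nat.size a + Nat.size b + 1 := by
  rw [Nat.size_le]
  have ha := Nat.lt_size_self a
  have hb := Nat.lt_size_self b
  have h1 : 2 ^ a.size ≤ 2 ^ (a.size + b.size) := Nat.pow_le_pow_right (by omega) (by omega)
  have h2 : 2 ^ b.size ≤ 2 ^ (a.size + b.size) := Nat.pow_le_pow_right (by omega) (by omega)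
  rw [pow_succ]
  omega

theorem natSize_mul_le (a b : ℕ) : Nat.size (a * b) ≤ Nat.size a + Nat.size b := by
  rw [Nat.size_le, pow_add]
  exact Nat.mul_lt_mul'' (Nat.lt_size_self a) (Nat.lt_size_self b)

theorem natSize_le_self (a : ℕ) : Nat.size a ≤ a := Nat.size_le.2 Nat.lt_two_pow_self

theorem Datum.one_le_size (x : Datum) : 1 ≤ x.size := by cases x <;> (simp [Datum.size]; try omega)

theorem Datum.size_fst_le (x : Datum) : x.fst.size ≤ x.size := by
  cases x <;> simp [Datum.size, Datum.fst]; omega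

theorem Datum.size_snd_le (x : Datum) : x.snd.size ≤ x.size := by
  cases x <;> simp [Datum.size, Datum.snd]

theorem Datum.size_toInt_le (x : Datum) : Nat.size x.toInt.natAbs ≤ x.size := by
  cases x <;> simp [Datum.size, Datum.toInt]

/-- Elementary operations enlarge a datum at most linearly. -/
theorem Op.size_apply_le (o : Op) : ∃ k, ∀ x : Datum, (o.apply x).size ≤ 2 * x.size + k := by
  have h1 := fun x : Datum => (Datum.size_toInt_le x.fst).trans x.size_fst_le
  have h2 := fun x : Datum => (Datum.size_toInt_le x.snd).trans x.size_snd_le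
  cases o with
  | id => exact ⟨0, fun x => by simp [Op.apply]; omega⟩
  | fst => exact ⟨0, fun x => by have := x.size_fst_le; simp only [Op.apply]; omega⟩
  | snd => exact ⟨0, fun x => by have := x.size_snd_le; simp only [Op.apply]; omega⟩
  | isPair => exact ⟨2, fun x => by cases x <;> simp [Op.apply, Datum.isPair, Datum.size]⟩
  | lit z => exact ⟨(Datum.int z).size, fun x => by simp only [Op.apply]; omega⟩
  | add =>
    refine ⟨2, fun x => ?_⟩
    have h := Nat.size_le_size (Int.natAbs_add_le x.fst.toInt x.snd.toInt)
    have h' := natSize_add_le x.fst.toInt.natAbs x.snd.toInt.natAbs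
    have := h1 x; have := h2 x
    simp only [Op.apply, Datum.size]; omega
  | sub =>
    refine ⟨2, fun x => ?_⟩
    have h := Nat.size_le_size (Int.natAbs_sub_le x.fst.toInt x.snd.toInt)
    have h' := natSize_add_le x.fst.toInt.natAbs x.snd.toInt.natAbs
    have := h1 x; have := h2 x
    simp only [Op.apply, Datum.size]; omega
  | mul =>
    refine ⟨2, fun x => ?_⟩
    have h' := natSize_mul_le x.fst.toInt.natAbs x.snd.toInt.natAbs
    have := h1 x; have := h2 x
    simp only [Op.apply, Datum.size, Int.natAbs_mul]; omega
  | div =>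
    refine ⟨2, fun x => ?_⟩
    have h := Nat.size_le_size (Int.natAbs_ediv_le_natAbs x.fst.toInt x.snd.toInt)
    have := h1 x; have := h2 x
    simp only [Op.apply, Datum.size]; omega
  | le =>
    refine ⟨2, fun x => ?_⟩
    simp only [Op.apply]
    split_ifs <;> simp [Datum.size]

/-- Every run reads its input and writes its output. -/
theorem Runs.size_lt {p : Prog} {x y : Datum} {T : ℕ} (h : Runs p x y T) :
    x.size < T ∧ y.size < T := by
  induction h with
  | op o x => have := x.one_le_size; have := (o.apply x).one_le_size; omega
  | fork => simp only [Datum.size]; omega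
  | _ => omega

/-! ### Families of data computable in polynomial time -/

/-- A single program transforms `x ω` into `y ω`, for all `ω`, in time polynomial in `N ω`. The
index type `Ω` is arbitrary; in this way inputs may be restricted to meaningful ones, and the
iterations of a loop are handled as further indices. -/
def Feas {Ω : Type} (N : Ω → ℕ) (x y : Ω → Datum) : Prop :=
  ∃ (p : Prog) (c : ℕ), ∀ ω, ∃ T ≤ polyBound c (N ω), Runs p (x ω) (y ω) T

/-- The datum `1` or `0` according to the truth of a proposition. -/
noncomputable def ind (p : Prop) : Datum := by classical exact .int (if p then 1 else 0)

theorem ind_true {p : Prop} (h : p) : ind p = .int 1 := by simp [ind, h]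

theorem ind_false {p : Prop} (h : ¬ p) : ind p = .int 0 := by simp [ind, h]

namespace Feas

variable {Ω : Type} {N : Ω → ℕ} {e x y z : Ω → Datum}

theorem bdd_left (h : Feas N x y) : PolyBdd N fun ω => (x ω).size := by
  obtain ⟨p, c, h⟩ := h
  refine ⟨c, fun ω => ?_⟩
  obtain ⟨T, hT, hr⟩ := h ω
  exact hr.size_lt.1.le.trans hT

theorem bdd (h : Feas N x y) : PolyBdd N fun ω => (y ω).size := by
  obtain ⟨p, c, h⟩ := h
  refine ⟨c, fun ω => ?_⟩
  obtain ⟨T, hT, hr⟩ := h ω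
  exact hr.size_lt.2.le.trans hT

theorem op (o : Op) (h : PolyBdd N fun ω => (x ω).size) : Feas N x fun ω => o.apply (x ω) := by
  obtain ⟨k, hk⟩ := o.size_apply_le
  obtain ⟨c, hc⟩ : PolyBdd N fun ω => 1 + (x ω).size + (o.apply (x ω)).size :=
    ((((PolyBdd.const N 1).add h)).add
      (((PolyBdd.const N 2).mul h).add (PolyBdd.const N k))).mono fun ω => by
        have := hk (x ω); omega
  exact ⟨.op o, c, fun ω => ⟨_, hc ω, Runs.op _ _⟩⟩

theorem id (h : PolyBdd N fun ω => (x ω).size) : Feas N x x := op .id h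

theorem comp (h : Feas N y z) (h' : Feas N x y) : Feas N x z := by
  obtain ⟨p, c, h⟩ := h
  obtain ⟨p', c', h'⟩ := h'
  refine ⟨.comp p p', c' + c + 1, fun ω => ?_⟩
  obtain ⟨T, hT, hr⟩ := h ω
  obtain ⟨T', hT', hr'⟩ := h' ω
  refine ⟨_, ?_, Runs.comp hr' hr⟩
  have := polyBound_add_le c' c (N ω)
  have := polyBound_add_le (c' + c) 1 (N ω)
  have := le_polyBound_const 1 (N ω)
  omega

theorem pair (h : Feas N x y) (h' : Feas N x z) : Feas N x fun ω => .pair (y ω) (z ω) := by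
  obtain ⟨p, c, h⟩ := h
  obtain ⟨p', c', h'⟩ := h'
  refine ⟨.fork p p', c + c' + 1, fun ω => ?_⟩
  obtain ⟨T, hT, hr⟩ := h ω
  obtain ⟨T', hT', hr'⟩ := h' ω
  refine ⟨_, ?_, Runs.fork hr hr'⟩
  have := polyBound_add_le c c' (N ω)
  have := polyBound_add_le (c + c') 1 (N ω)
  have := le_polyBound_const 1 (N ω)
  omega

theorem op' (o : Op) (h : Feas N e x) : Feas N e fun ω => o.apply (x ω) := (op o h.bdd).comp h

theorem fst (h : Feas N e fun ω => .pair (x ω) (y ω)) : Feas N e x := h.op' .fst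

theorem snd (h : Feas N e fun ω => .pair (x ω) (y ω)) : Feas N e y := h.op' .snd

theorem lit (h : Feas N e x) (k : ℤ) : Feas N e fun _ => .int k := h.op' (.lit k)

variable {a b : Ω → ℤ}

theorem add (ha : Feas N e fun ω => .int (a ω)) (hb : Feas N e fun ω => .int (b ω)) :
    Feas N e fun ω => .int (a ω + b ω) := (ha.pair hb).op' .add

theorem sub (ha : Feas N e fun ω => .int (a ω)) (hb : Feas N e fun ω => .int (b ω)) :
    Feas N e fun ω => .int (a ω - b ω) := (ha.pair hb).op' .sub

theorem mul (ha : Feas N e fun ω => .int (a ω)) (hb : Feas N e fun ω => .int (b ω)) :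
    Feas N e fun ω => .int (a ω * b ω) := (ha.pair hb).op' .mul

theorem div (ha : Feas N e fun ω => .int (a ω)) (hb : Feas N e fun ω => .int (b ω)) :
    Feas N e fun ω => .int (a ω / b ω) := (ha.pair hb).op' .div

theorem le (ha : Feas N e fun ω => .int (a ω)) (hb : Feas N e fun ω => .int (b ω)) :
    Feas N e fun ω => ind (a ω ≤ b ω) := by
  have := (ha.pair hb).op' .le
  convert this using 2 with ω
  by_cases h : a ω ≤ b ω <;> simp [ind, h, Op.apply, Datum.fst, Datum.snd, Datum.toInt]

theorem congr (h : Feas N e x) (h' : ∀ ω, x ω = y ω) : Feas N e y := by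
  rwa [← funext h']

theorem not {c : Ω → Prop} (hc : Feas N e fun ω => ind (c ω)) : Feas N e fun ω => ind (¬ c ω) := by
  classical
  have := (hc.lit 1).sub (b := fun ω => if c ω then 1 else 0) (hc.congr fun _ => by simp [ind])
  convert this using 2 with ω
  by_cases h : c ω <;> simp [ind, h]

theorem and {c d : Ω → Prop} (hc : Feas N e fun ω => ind (c ω)) (hd : Feas N e fun ω => ind (d ω)) :
    Feas N e fun ω => ind (c ω ∧ d ω) := by
  classical
  have := mul (a := fun ω => if c ω then 1 else 0) (b := fun ω => if d ω then 1 else 0)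
    (hc.congr fun _ => by simp [ind]) (hd.congr fun _ => by simp [ind])
  convert this using 2 with ω
  by_cases h : c ω <;> by_cases h' : d ω <;> simp [ind, h, h']

theorem eq (ha : Feas N e fun ω => .int (a ω)) (hb : Feas N e fun ω => .int (b ω)) :
    Feas N e fun ω => ind (a ω = b ω) :=
  ((ha.le hb).and (hb.le ha)).congr fun _ => congrArg ind (propext antisymm_iff)

theorem lt (ha : Feas N e fun ω => .int (a ω)) (hb : Feas N e fun ω => .int (b ω)) :
    Feas N e fun ω => ind (a ω < b ω) :=
  (hb.le ha).not.congr fun _ => congrArg ind (propext not_le)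

theorem reindex {Ω' : Type} (h : Feas N x y) (π : Ω' → Ω) :
    Feas (fun q => N (π q)) (fun q => x (π q)) fun q => y (π q) := by
  obtain ⟨p, c, h⟩ := h
  exact ⟨p, c, fun q => h _⟩

/-- What is computable from `e` is computable from any environment that determines `e`. -/
theorem lift {Ω' : Type} {e' : Ω' → Datum} (h : Feas N e y) (π : Ω' → Ω)
    (h' : Feas (fun q => N (π q)) e' fun q => e (π q)) :
    Feas (fun q => N (π q)) e' fun q => y (π q) := (h.reindex π).comp h'

theorem mono {N' : Ω → ℕ} (h : Feas N x y) (hN : PolyBdd N' N) : Feas N' x y := by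
  obtain ⟨p, c, h⟩ := h
  obtain ⟨c', hc'⟩ := hN.polyBound c
  refine ⟨p, c', fun ω => ?_⟩
  obtain ⟨T, hT, hr⟩ := h ω
  exact ⟨T, hT.trans (hc' ω), hr⟩

/-- Definition by cases; each branch has to be computable only where it is taken. -/
theorem cases {c : Ω → Prop} (hc : Feas N e fun ω => ind (c ω))
    (h : Feas (fun q : {ω // c ω} => N q) (fun q => e q) fun q => y q)
    (h' : Feas (fun q : {ω // ¬ c ω} => N q) (fun q => e q) fun q => y q) : Feas N e y := by
  obtain ⟨p₀, c₀, h₀⟩ := hc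
  obtain ⟨p₁, c₁, h₁⟩ := h
  obtain ⟨p₂, c₂, h₂⟩ := h'
  refine ⟨.ite p₀ p₁ p₂, c₀ + (c₁ + c₂) + 1, fun ω => ?_⟩
  have a1 := polyBound_add_le c₀ (c₁ + c₂) (N ω)
  have a2 := polyBound_add_le (c₀ + (c₁ + c₂)) 1 (N ω)
  have a3 := le_polyBound_const 1 (N ω)
  have a4 := polyBound_mono (show c₁ ≤ c₁ + c₂ by omega) (N ω)
  have a5 := polyBound_mono (show c₂ ≤ c₁ + c₂ by omega) (N ω)
  obtain ⟨S, hS, hr⟩ := h₀ ω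
  by_cases hω : c ω
  · obtain ⟨T, hT, hr'⟩ := h₁ ⟨ω, hω⟩
    dsimp only at hT
    exact ⟨_, by omega, Runs.iteTrue hr (by simp [ind, hω, Datum.toInt]) hr'⟩
  · obtain ⟨T, hT, hr'⟩ := h₂ ⟨ω, hω⟩
    dsimp only at hT
    exact ⟨_, by omega, Runs.iteFalse hr (by simp [ind, hω, Datum.toInt]) hr'⟩

theorem ite {c : Ω → Prop} [∀ ω, Decidable (c ω)] (hc : Feas N e fun ω => ind (c ω))
    (hx : Feas N e x) (hy : Feas N e y) : Feas N e fun ω => if c ω then x ω else y ω := by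
  refine cases hc ((hx.reindex Subtype.val).congr fun q => ?_)
    ((hy.reindex Subtype.val).congr fun q => ?_)
  · rw [if_pos q.2]
  · rw [if_neg q.2]

/-- A while loop whose states are `s ω 0, …, s ω (K ω)`, with `K` polynomially bounded. -/
theorem loop {K : Ω → ℕ} {s : Ω → ℕ → Datum} (hK : PolyBdd N K)
    (hc : Feas (fun q : (ω : Ω) × Fin (K ω + 1) => N q.1) (fun q => s q.1 q.2)
      fun q => ind ((q.2 : ℕ) < K q.1))
    (hs : Feas (fun q : (ω : Ω) × Fin (K ω) => N q.1) (fun q => s q.1 q.2)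
      fun q => s q.1 (q.2 + 1)) :
    Feas N (fun ω => s ω 0) fun ω => s ω (K ω) := by
  obtain ⟨p, c, hc⟩ := hc
  obtain ⟨p', c', hs⟩ := hs
  obtain ⟨k, hk⟩ : PolyBdd N fun ω => (K ω + 1) * (polyBound c (N ω) + polyBound c' (N ω) + 1) :=
    (hK.add (.const N 1)).mul ((((PolyBdd.self N).polyBound c).add
      ((PolyBdd.self N).polyBound c')).add (.const N 1))
  refine ⟨.loop p p', k, fun ω => ?_⟩
  have key : ∀ j ≤ K ω, ∃ T ≤ (j + 1) * (polyBound c (N ω) + polyBound c' (N ω) + 1),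
      Runs (.loop p p') (s ω (K ω - j)) (s ω (K ω)) T := by
    intro j hj
    induction j with
    | zero =>
      obtain ⟨T, hT, hr⟩ := hc ⟨ω, ⟨K ω, by omega⟩⟩
      dsimp only at hT hr
      exact ⟨_, by omega, Runs.loopStop hr (by simp [ind, Datum.toInt])⟩
    | succ j ih =>
      obtain ⟨U, hU, hrU⟩ := ih (by omega)
      obtain ⟨S, hS, hrS⟩ := hc ⟨ω, ⟨K ω - (j + 1), by omega⟩⟩
      obtain ⟨T, hT, hrT⟩ := hs ⟨ω, ⟨K ω - (j + 1), by omega⟩⟩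
      dsimp only at hS hrS hT hrT
      rw [show K ω - (j + 1) + 1 = K ω - j by omega] at hrT
      rw [ind_true (by omega)] at hrS
      refine ⟨_, ?_, Runs.loopStep hrS (by simp [Datum.toInt]) hrT hrU⟩
      nlinarith
  obtain ⟨T, hT, hr⟩ := key (K ω) le_rfl
  rw [Nat.sub_self] at hr
  exact ⟨T, hT.trans (hk ω), hr⟩

end Feas

namespace Feas

variable {Ω : Type} {N : Ω → ℕ} {e : Ω → Datum}

/-! ### Arithmetic of natural numbers -/

section Nat

variable {a b : Ω → ℕ}

theorem natAdd (ha : Feas N e fun ω => .nat (a ω)) (hb : Feas N e fun ω => .nat (b ω)) :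
    Feas N e fun ω => .nat (a ω + b ω) :=
  (ha.add hb).congr fun _ => by simp [Datum.nat]

theorem natMul (ha : Feas N e fun ω => .nat (a ω)) (hb : Feas N e fun ω => .nat (b ω)) :
    Feas N e fun ω => .nat (a ω * b ω) :=
  (ha.mul hb).congr fun _ => by simp [Datum.nat]

theorem natDiv (ha : Feas N e fun ω => .nat (a ω)) (hb : Feas N e fun ω => .nat (b ω)) :
    Feas N e fun ω => .nat (a ω / b ω) :=
  (ha.div hb).congr fun _ => by simp [Datum.nat]

theorem natMod (ha : Feas N e fun ω => .nat (a ω)) (hb : Feas N e fun ω => .nat (b ω)) :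
    Feas N e fun ω => .nat (a ω % b ω) :=
  (ha.sub (hb.mul (ha.div hb))).congr fun ω => by
    simp only [Datum.nat]; rw [Int.natCast_mod, Int.emod_def]

theorem natLit (h : Feas N e fun ω => .nat (a ω)) (k : ℕ) : Feas N e fun _ => .nat k := h.lit k

theorem natLe (ha : Feas N e fun ω => .nat (a ω)) (hb : Feas N e fun ω => .nat (b ω)) :
    Feas N e fun ω => ind (a ω ≤ b ω) :=
  (ha.le hb).congr fun _ => congrArg ind (propext Int.ofNat_le)

theorem natLt (ha : Feas N e fun ω => .nat (a ω)) (hb : Feas N e fun ω => .nat (b ω)) :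
    Feas N e fun ω => ind (a ω < b ω) :=
  (ha.lt hb).congr fun _ => congrArg ind (propext Int.ofNat_lt)

theorem natEq (ha : Feas N e fun ω => .nat (a ω)) (hb : Feas N e fun ω => .nat (b ω)) :
    Feas N e fun ω => ind (a ω = b ω) :=
  (ha.eq hb).congr fun _ => congrArg ind (propext Int.ofNat_inj)

theorem natSub (ha : Feas N e fun ω => .nat (a ω)) (hb : Feas N e fun ω => .nat (b ω)) :
    Feas N e fun ω => .nat (a ω - b ω) := by
  classical
  refine (ite (hb.natLe ha) (ha.sub hb) (ha.natLit 0)).congr fun ω => ?_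
  split_ifs with h
  · simp [Datum.nat, Nat.cast_sub h]
  · simp [Datum.nat, show a ω - b ω = 0 by omega]

theorem natMin (ha : Feas N e fun ω => .nat (a ω)) (hb : Feas N e fun ω => .nat (b ω)) :
    Feas N e fun ω => .nat (min (a ω) (b ω)) := by
  classical
  refine (ite (ha.natLe hb) ha hb).congr fun ω => ?_
  split_ifs with h <;> congr 1 <;> omega

theorem natConstPow (ha : Feas N e fun ω => .nat (a ω)) (k : ℕ) :
    Feas N e fun ω => .nat (a ω ^ k) := by
  induction k with
  | zero => exact (ha.natLit 1).congr fun _ => by simp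
  | succ k ih => exact (ih.natMul ha).congr fun _ => by simp [pow_succ]

theorem natPolyBound (ha : Feas N e fun ω => .nat (a ω)) (k : ℕ) :
    Feas N e fun ω => .nat (polyBound k (a ω)) :=
  (ha.natLit k).natMul ((ha.natAdd (ha.natLit 1)).natConstPow k)

end Nat

/-! ### Loops with a counter -/

section Loop

variable {K : Ω → ℕ}

theorem bdd_counter (hK : PolyBdd N K) :
    PolyBdd (fun q : (ω : Ω) × Fin (K ω + 1) => N q.1) fun q => (Datum.nat q.2).size :=
  ((PolyBdd.const _ 1).add (hK.reindex Sigma.fst)).mono fun q => by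
    have := natSize_le_self q.2
    have := q.2.2
    simp only [Datum.nat, Datum.size, Int.natAbs_natCast]
    omega

theorem bdd_loopIndex (hK : PolyBdd N K) :
    PolyBdd (fun q : (ω : Ω) × Fin (K ω) => N q.1) fun q => (Datum.nat q.2).size :=
  (bdd_counter hK).reindex (Ω' := (ω : Ω) × Fin (K ω)) fun q => ⟨q.1, q.2.castSucc⟩

theorem bdd_pair {x y : Ω → Datum} (hx : PolyBdd N fun ω => (x ω).size)
    (hy : PolyBdd N fun ω => (y ω).size) : PolyBdd N fun ω => (Datum.pair (x ω) (y ω)).size :=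
  ((PolyBdd.const N 1).add hx).add hy

/-- The environment of the body of a comprehension determines the outer environment. -/
theorem outer {K : Ω → ℕ} (he : PolyBdd N fun ω => (e ω).size) (hK : PolyBdd N K) :
    Feas (fun q : (ω : Ω) × Fin (K ω) => N q.1) (fun q => .pair (e q.1) (.nat q.2))
      fun q => e q.1 :=
  fst (id (bdd_pair (he.reindex Sigma.fst) (bdd_loopIndex hK)))

/-- The environment of the body of a comprehension determines the index. -/
theorem index {K : Ω → ℕ} (he : PolyBdd N fun ω => (e ω).size) (hK : PolyBdd N K) :
    Feas (fun q : (ω : Ω) × Fin (K ω) => N q.1) (fun q => .pair (e q.1) (.nat q.2))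
      fun q => .nat q.2 :=
  snd (id (bdd_pair (he.reindex Sigma.fst) (bdd_loopIndex hK)))

/-- A loop `for i < K` with states `s ω 0, …, s ω (K ω)`. -/
theorem iterate {s : Ω → ℕ → Datum} (hK : Feas N e fun ω => .nat (K ω)) (hKb : PolyBdd N K)
    (h0 : Feas N e fun ω => s ω 0)
    (hs : Feas (fun q : (ω : Ω) × Fin (K ω) => N q.1)
      (fun q => .pair (e q.1) (.pair (.nat q.2) (s q.1 q.2))) fun q => s q.1 (q.2 + 1)) :
    Feas N e fun ω => s ω (K ω) := by
  have hsb : PolyBdd (fun q : (ω : Ω) × Fin (K ω + 1) => N q.1) fun q => (s q.1 q.2).size := by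
    obtain ⟨c, hc⟩ := h0.bdd
    obtain ⟨c', hc'⟩ := hs.bdd
    refine ⟨c + c', fun ⟨ω, i, hi⟩ => le_trans ?_ (polyBound_add_le _ _ _)⟩
    rcases i with _ | i
    · have := hc ω
      dsimp only at this ⊢; omega
    · have := hc' ⟨ω, i, by omega⟩
      dsimp only at this ⊢; omega
  have hE : PolyBdd (fun q : (ω : Ω) × Fin (K ω + 1) => N q.1) fun q =>
      (Datum.pair (.nat (K q.1)) (.pair (e q.1) (.pair (.nat q.2) (s q.1 q.2)))).size :=
    bdd_pair (hK.bdd.reindex Sigma.fst)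
      (bdd_pair (hK.bdd_left.reindex Sigma.fst) (bdd_pair (bdd_counter hKb) hsb))
  have hI := Feas.id hE
  have hI' := hI.reindex (Ω' := (ω : Ω) × Fin (K ω)) fun q => ⟨q.1, q.2.castSucc⟩
  have hL : Feas N (fun ω => Datum.pair (.nat (K ω)) (.pair (e ω) (.pair (.nat 0) (s ω 0))))
      fun ω => Datum.pair (.nat (K ω)) (.pair (e ω) (.pair (.nat (K ω)) (s ω (K ω)))) := by
    refine Feas.loop (s := fun ω i => Datum.pair (.nat (K ω)) (.pair (e ω) (.pair (.nat i) (s ω i))))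
      hKb ?_ ?_
    · exact hI.snd.snd.fst.natLt hI.fst
    · exact hI'.fst.pair (hI'.snd.fst.pair
        ((hI'.snd.snd.fst.natAdd (hI'.fst.natLit 1)).pair (hs.comp hI'.snd)))
  exact (hL.comp (hK.pair ((Feas.id hK.bdd_left).pair ((hK.natLit 0).pair h0)))).snd.snd.snd

/-- A loop `for i < K` whose body depends on the state only through a pairing with an object
computed independently of the state. -/
theorem accumulate {s : Ω → ℕ → Datum} {x : (ω : Ω) → Fin (K ω) → Datum}
    (hK : Feas N e fun ω => .nat (K ω)) (hKb : PolyBdd N K) (h0 : Feas N e fun ω => s ω 0)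
    (hx : Feas (fun q : (ω : Ω) × Fin (K ω) => N q.1) (fun q => .pair (e q.1) (.nat q.2))
      fun q => x q.1 q.2)
    (hsb : PolyBdd (fun q : (ω : Ω) × Fin (K ω) => N q.1) fun q => (s q.1 q.2).size)
    (hs : Feas (fun q : (ω : Ω) × Fin (K ω) => N q.1)
      (fun q => .pair (x q.1 q.2) (s q.1 q.2)) fun q => s q.1 (q.2 + 1)) :
    Feas N e fun ω => s ω (K ω) := by
  have hI := Feas.id (bdd_pair (hK.bdd_left.reindex Sigma.fst) (bdd_pair (bdd_loopIndex hKb) hsb))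
  exact iterate hK hKb h0 (hs.comp ((hx.comp (hI.fst.pair hI.snd.fst)).pair hI.snd.snd))

theorem natPow {a : Ω → ℕ} (ha : Feas N e fun ω => .nat (a ω)) (hK : Feas N e fun ω => .nat (K ω))
    (hKb : PolyBdd N K) : Feas N e fun ω => .nat (a ω ^ K ω) := by
  have hsb : PolyBdd (fun q : (ω : Ω) × Fin (K ω) => N q.1)
      fun q => (Datum.nat (a q.1 ^ (q.2 : ℕ))).size := by
    refine ((PolyBdd.const _ 1).add (((hKb.mul ha.bdd).add (.const _ 1)).reindex Sigma.fst)).mono ?_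
    rintro ⟨ω, i, hi⟩
    simp only [Datum.nat, Datum.size, Int.natAbs_natCast]
    refine Nat.add_le_add_left (Nat.size_le.2 ?_) _
    have h1 := Nat.lt_size_self (a ω)
    calc a ω ^ i ≤ (2 ^ (a ω).size) ^ i := Nat.pow_le_pow_left h1.le _
      _ = 2 ^ ((a ω).size * i) := by rw [pow_mul]
      _ < _ := Nat.pow_lt_pow_right (by omega) ?_
    have : (a ω).size * i ≤ (1 + (a ω).size) * K ω := Nat.mul_le_mul (by omega) hi.le
    rw [mul_comm (K ω)]
    omega
  refine accumulate (s := fun ω i => .nat (a ω ^ i)) (x := fun ω _ => .nat (a ω)) hK hKb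
    ((ha.natLit 1).congr fun _ => by simp) (ha.lift Sigma.fst (outer ha.bdd_left hKb)) hsb ?_
  have hI := Feas.id (bdd_pair (ha.bdd.reindex Sigma.fst) hsb)
  exact (hI.snd.natMul hI.fst).congr fun q => by rw [pow_succ]

theorem sum {f : (ω : Ω) → Fin (K ω) → ℤ} (hK : Feas N e fun ω => .nat (K ω)) (hKb : PolyBdd N K)
    (hf : Feas (fun q : (ω : Ω) × Fin (K ω) => N q.1) (fun q => .pair (e q.1) (.nat q.2))
      fun q => .int (f q.1 q.2)) : Feas N e fun ω => .int (∑ i, f ω i) := by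
  obtain ⟨c, hc⟩ := hf.bdd
  let F : Ω → ℕ → ℤ := fun ω j => if h : j < K ω then f ω ⟨j, h⟩ else 0
  have hF : ∀ ω (j : Fin (K ω)), F ω j = f ω j := fun ω j => by simp [F]
  have hsb : PolyBdd (fun q : (ω : Ω) × Fin (K ω) => N q.1) fun q =>
      (Datum.int (∑ j ∈ Finset.range q.2, F q.1 j)).size := by
    refine ((PolyBdd.const _ 1).add
      ((hKb.add ((PolyBdd.self N).polyBound c)).reindex Sigma.fst)).mono ?_
    rintro ⟨ω, i, hi⟩
    simp only [Datum.size]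
    refine Nat.add_le_add_left (Nat.size_le.2 ?_) _
    have h1 : ∀ j ∈ Finset.range i, (F ω j).natAbs ≤ 2 ^ polyBound c (N ω) := fun j hj => by
      have hj' : j < K ω := (Finset.mem_range.1 hj).trans hi
      have := hc ⟨ω, j, hj'⟩
      dsimp only at this
      rw [show f ω ⟨j, hj'⟩ = F ω j from (hF ω ⟨j, hj'⟩).symm] at this
      simp only [Datum.size] at this
      exact (Nat.size_le.1 (show Nat.size (F ω j).natAbs ≤ _ by omega)).le
    calc _ ≤ ∑ j ∈ Finset.range i, (F ω j).natAbs := Int.natAbs_sum_le _ _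
      _ ≤ i * 2 ^ polyBound c (N ω) := by simpa using Finset.sum_le_card_nsmul _ _ _ h1
      _ < 2 ^ K ω * 2 ^ polyBound c (N ω) :=
        Nat.mul_lt_mul_of_pos_right (hi.trans Nat.lt_two_pow_self) (by positivity)
      _ = _ := by rw [pow_add]
  have hI := Feas.id (bdd_pair hf.bdd hsb)
  have := accumulate (s := fun ω i => .int (∑ j ∈ Finset.range i, F ω j))
    (x := fun ω i => .int (f ω i)) hK hKb ((hK.lit 0).congr fun _ => by simp) hf hsb
    ((hI.snd.add hI.fst).congr fun q => by rw [Finset.sum_range_succ, hF])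
  exact this.congr fun ω => by rw [Finset.sum_range]; simp only [hF]

end Loop

/-! ### Gaussian integers -/

end Feas

/-- The datum of a Gaussian integer. -/
def gaussDatum (z : GaussianInt) : Datum := intPairDatum (z.re, z.im)

/-- The sum of the absolute values of real and imaginary part. -/
def gaussAbs (z : GaussianInt) : ℕ := z.re.natAbs + z.im.natAbs

theorem gaussAbs_mul_le (z w : GaussianInt) : gaussAbs (z * w) ≤ gaussAbs z * gaussAbs w := by
  simp only [gaussAbs, Zsqrtd.re_mul, Zsqrtd.im_mul]
  have h1 := Int.natAbs_add_le (z.re * w.re) (-1 * z.im * w.im)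
  have h2 := Int.natAbs_add_le (z.re * w.im) (z.im * w.re)
  simp only [Int.natAbs_mul, Int.natAbs_neg, Int.natAbs_one, one_mul] at h1 h2
  nlinarith

theorem gaussAbs_lt (z : GaussianInt) : gaussAbs z < 2 ^ (gaussDatum z).size := by
  have h1 := Nat.lt_size_self z.re.natAbs
  have h2 := Nat.lt_size_self z.im.natAbs
  have : gaussAbs z < 2 ^ (z.re.natAbs.size + z.im.natAbs.size + 1) := by
    have h3 : 2 ^ z.re.natAbs.size ≤ 2 ^ (z.re.natAbs.size + z.im.natAbs.size) :=
      Nat.pow_le_pow_right (by omega) (by omega)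
    have h4 : 2 ^ z.im.natAbs.size ≤ 2 ^ (z.re.natAbs.size + z.im.natAbs.size) :=
      Nat.pow_le_pow_right (by omega) (by omega)
    rw [pow_succ, gaussAbs]
    omega
  refine this.trans_le (Nat.pow_le_pow_right (by omega) ?_)
  simp only [gaussDatum, intPairDatum, Datum.size]
  omega

theorem size_gaussDatum_le (z : GaussianInt) : (gaussDatum z).size ≤ 3 + 2 * (gaussAbs z).size := by
  have h1 := Nat.size_le_size (show z.re.natAbs ≤ gaussAbs z by simp [gaussAbs])
  have h2 := Nat.size_le_size (show z.im.natAbs ≤ gaussAbs z by simp [gaussAbs])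
  simp only [gaussDatum, intPairDatum, Datum.size]
  omega

namespace Feas

variable {Ω : Type} {N : Ω → ℕ} {e : Ω → Datum}

section Gauss

variable {z w : Ω → GaussianInt}

theorem gaussRe (hz : Feas N e fun ω => gaussDatum (z ω)) : Feas N e fun ω => .int (z ω).re := hz.fst

theorem gaussIm (hz : Feas N e fun ω => gaussDatum (z ω)) : Feas N e fun ω => .int (z ω).im := hz.snd

theorem gaussMul (hz : Feas N e fun ω => gaussDatum (z ω)) (hw : Feas N e fun ω => gaussDatum (w ω)) :
    Feas N e fun ω => gaussDatum (z ω * w ω) := by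
  refine (((hz.gaussRe.mul hw.gaussRe).sub (hz.gaussIm.mul hw.gaussIm)).pair
    ((hz.gaussRe.mul hw.gaussIm).add (hz.gaussIm.mul hw.gaussRe))).congr fun ω => ?_
  simp only [gaussDatum, intPairDatum, Zsqrtd.re_mul, Zsqrtd.im_mul]
  congr 2
  ring

theorem gaussStar (hz : Feas N e fun ω => gaussDatum (z ω)) :
    Feas N e fun ω => gaussDatum (star (z ω)) :=
  (hz.gaussRe.pair ((hz.lit 0).sub hz.gaussIm)).congr fun ω => by
    simp [gaussDatum, intPairDatum]

theorem gaussNorm (hz : Feas N e fun ω => gaussDatum (z ω)) :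
    Feas N e fun ω => .int (z ω).norm :=
  ((hz.gaussRe.mul hz.gaussRe).add (hz.gaussIm.mul hz.gaussIm)).congr fun ω => by
    simp [Zsqrtd.norm_def]

theorem gaussProd {K : Ω → ℕ} {f : (ω : Ω) → Fin (K ω) → GaussianInt}
    (hK : Feas N e fun ω => .nat (K ω)) (hKb : PolyBdd N K)
    (hf : Feas (fun q : (ω : Ω) × Fin (K ω) => N q.1) (fun q => .pair (e q.1) (.nat q.2))
      fun q => gaussDatum (f q.1 q.2)) : Feas N e fun ω => gaussDatum (∏ i, f ω i) := by
  obtain ⟨c, hc⟩ := hf.bdd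
  let F : Ω → ℕ → GaussianInt := fun ω j => if h : j < K ω then f ω ⟨j, h⟩ else 1
  have hF : ∀ ω (j : Fin (K ω)), F ω j = f ω j := fun ω j => by simp [F]
  have hsb : PolyBdd (fun q : (ω : Ω) × Fin (K ω) => N q.1) fun q =>
      (gaussDatum (∏ j ∈ Finset.range q.2, F q.1 j)).size := by
    refine ((PolyBdd.const _ 3).add ((PolyBdd.const _ 2).mul
      (((hKb.mul ((PolyBdd.self N).polyBound c)).add (.const _ 1)).reindex Sigma.fst))).mono ?_
    rintro ⟨ω, i, hi⟩
    refine (size_gaussDatum_le _).trans (Nat.add_le_add_left (Nat.mul_le_mul_left _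
      (Nat.size_le.2 ?_)) _)
    have h1 : ∀ j ≤ i, gaussAbs (∏ j ∈ Finset.range j, F ω j) ≤ (2 ^ polyBound c (N ω)) ^ j := by
      intro j hj
      induction j with
      | zero => simp [gaussAbs]
      | succ j ih =>
        rw [Finset.prod_range_succ, pow_succ]
        refine (gaussAbs_mul_le _ _).trans (Nat.mul_le_mul (ih (by omega)) ?_)
        have hj' : j < K ω := by omega
        have := hc ⟨ω, j, hj'⟩
        dsimp only at this
        rw [show f ω ⟨j, hj'⟩ = F ω j from (hF ω ⟨j, hj'⟩).symm] at this
        exact (gaussAbs_lt _).le.trans (Nat.pow_le_pow_right (by omega) this)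
    refine (h1 i le_rfl).trans_lt ?_
    rw [← pow_mul, mul_comm]
    have : i * polyBound c (N ω) ≤ K ω * polyBound c (N ω) := Nat.mul_le_mul_right _ hi.le
    exact Nat.pow_lt_pow_right (by omega) (by dsimp only; omega)
  have hI := Feas.id (bdd_pair hf.bdd hsb)
  have := accumulate (s := fun ω i => gaussDatum (∏ j ∈ Finset.range i, F ω j))
    (x := fun ω i => gaussDatum (f ω i)) hK hKb
    (((hK.lit 1).pair (hK.lit 0)).congr fun _ => by simp [gaussDatum, intPairDatum]) hf hsb
    ((hI.snd.gaussMul hI.fst).congr fun q => by rw [Finset.prod_range_succ, hF])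
  exact this.congr fun ω => by rw [Finset.prod_range]; simp only [hF]

end Gauss

end Feas

/-! ### Lists -/

theorem Datum.size_ofList (l : List Datum) :
    (Datum.ofList l).size = 1 + (l.map fun a => 1 + a.size).sum := by
  induction l with
  | nil => simp [Datum.ofList, Datum.size]
  | cons a l ih => simp [Datum.ofList, Datum.size, ih]; omega

theorem Datum.length_lt_size (l : List Datum) : l.length < (Datum.ofList l).size := by
  induction l with
  | nil => simp [Datum.ofList, Datum.size]
  | cons a l ih => simp [Datum.ofList, Datum.size]; omega

theorem Datum.size_ofList_drop_le (l : List Datum) (i : ℕ) :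
    (Datum.ofList (l.drop i)).size ≤ (Datum.ofList l).size := by
  rw [size_ofList, size_ofList]
  have := congrArg (fun l => (l.map fun a : Datum => 1 + a.size).sum) (List.take_append_drop i l)
  simp only [List.map_append, List.sum_append] at this
  omega

theorem Datum.size_ofList_append (l l' : List Datum) :
    (Datum.ofList (l ++ l')).size + 1 = (Datum.ofList l).size + (Datum.ofList l').size := by
  simp only [size_ofList, List.map_append, List.sum_append]
  omega

theorem Datum.size_ofList_reverse (l : List Datum) :
    (Datum.ofList l.reverse).size = (Datum.ofList l).size := by
  simp only [size_ofList, List.map_reverse, List.sum_reverse]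

theorem Datum.size_ofList_take_le (l : List Datum) (i : ℕ) :
    (Datum.ofList (l.take i)).size ≤ (Datum.ofList l).size := by
  have := size_ofList_append (l.take i) (l.drop i)
  rw [List.take_append_drop] at this
  have := (Datum.ofList (l.drop i)).one_le_size
  omega

namespace Feas

variable {Ω : Type} {N : Ω → ℕ} {e : Ω → Datum}

section Lists

variable {l l' : Ω → List Datum}

theorem bdd_length (h : PolyBdd N fun ω => (Datum.ofList (l ω)).size) :
    PolyBdd N fun ω => (l ω).length := h.mono fun _ => (Datum.length_lt_size _).le

theorem nil {x : Ω → Datum} (h : Feas N e x) : Feas N e fun _ => .ofList [] := h.lit 0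

theorem cons {x : Ω → Datum} (hx : Feas N e x) (h : Feas N e fun ω => .ofList (l ω)) :
    Feas N e fun ω => .ofList (x ω :: l ω) := hx.pair h

theorem length (h : Feas N e fun ω => .ofList (l ω)) : Feas N e fun ω => .nat (l ω).length := by
  have hb := bdd_length h.bdd
  have hE := bdd_pair (x := fun q : (ω : Ω) × Fin ((l ω).length + 1) => .ofList ((l q.1).drop q.2))
    ((h.bdd.reindex Sigma.fst).mono fun q => Datum.size_ofList_drop_le _ _) (bdd_counter hb)
  have hI := Feas.id hE
  have hI' := hI.reindex (Ω' := (ω : Ω) × Fin (l ω).length) fun q => ⟨q.1, q.2.castSucc⟩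
  have h1 : Feas (fun q : (ω : Ω) × Fin (l ω).length => N q.1)
      (fun q => Datum.pair (.ofList ((l q.1).drop q.2)) (.nat q.2))
      fun q => .ofList ((l q.1).drop (q.2 + 1)) := by
    refine (hI'.fst.op' .snd).congr fun q => ?_
    dsimp only
    rw [Fin.val_castSucc, List.drop_eq_getElem_cons q.2.2]
    rfl
  have := Feas.loop (s := fun ω i => Datum.pair (.ofList ((l ω).drop i)) (.nat i)) hb
    ((hI.fst.op' .isPair).congr fun q => ?_) (h1.pair (hI'.snd.natAdd (hI'.snd.natLit 1)))
  · exact (this.comp (h.pair (h.lit 0))).snd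
  · obtain ⟨ω, i, hi⟩ := q
    dsimp only
    by_cases h' : i < (l ω).length
    · rw [List.drop_eq_getElem_cons h', ind_true h']; rfl
    · rw [List.drop_eq_nil_of_le (by omega), ind_false h']; rfl

theorem get {j : Ω → ℕ} (h : Feas N e fun ω => .ofList (l ω)) (hj : Feas N e fun ω => .nat (j ω))
    (hl : ∀ ω, j ω < (l ω).length) : Feas N e fun ω => (l ω)[j ω]'(hl ω) := by
  have hb : PolyBdd N j := (bdd_length h.bdd).mono fun ω => (hl ω).le
  have := iterate (s := fun ω i => .ofList ((l ω).drop i)) hj hb h (by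
    have hI := Feas.id (bdd_pair (hj.bdd_left.reindex Sigma.fst) (bdd_pair (bdd_loopIndex hb)
      ((h.bdd.reindex (Ω' := (ω : Ω) × Fin (j ω)) Sigma.fst).mono
        fun q => Datum.size_ofList_drop_le (l q.1) q.2)))
    refine (hI.snd.snd.op' .snd).congr fun q => ?_
    rw [List.drop_eq_getElem_cons (q.2.2.trans (hl _))]
    rfl)
  refine (this.op' .fst).congr fun ω => ?_
  rw [List.drop_eq_getElem_cons (hl _)]
  rfl

/-- Reversal of the first list onto the second one. -/
theorem reverseAppend (h : Feas N e fun ω => .ofList (l ω)) (h' : Feas N e fun ω => .ofList (l' ω)) :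
    Feas N e fun ω => .ofList ((l ω).reverse ++ l' ω) := by
  have hb := bdd_length h.bdd
  have hsb : PolyBdd (fun q : (ω : Ω) × Fin (l ω).length => N q.1) fun q =>
      (Datum.ofList (((l q.1).take q.2).reverse ++ l' q.1)).size := by
    refine ((h.bdd.add h'.bdd).reindex Sigma.fst).mono fun q => ?_
    have h1 := Datum.size_ofList_append ((l q.1).take q.2).reverse (l' q.1)
    have h2 := Datum.size_ofList_take_le (l q.1) q.2
    rw [Datum.size_ofList_reverse] at h1
    omega
  have hx : Feas (fun q : (ω : Ω) × Fin (l ω).length => N q.1)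
      (fun q => .pair (e q.1) (.nat q.2)) fun q => (l q.1)[q.2] :=
    get (h.lift Sigma.fst (outer h.bdd_left hb)) (index h.bdd_left hb) fun q => q.2.2
  have hI := Feas.id (bdd_pair hx.bdd hsb)
  refine (accumulate (s := fun ω i => .ofList (((l ω).take i).reverse ++ l' ω))
    (x := fun ω i => (l ω)[i]) h.length hb (h'.congr fun ω => by simp) hx hsb
    ((hI.fst.cons hI.snd).congr fun q => ?_)).congr fun ω => ?_
  · rw [← List.take_concat_get' _ _ q.2.2, List.reverse_append]
    simp
  · simp

theorem reverse (h : Feas N e fun ω => .ofList (l ω)) :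
    Feas N e fun ω => .ofList (l ω).reverse :=
  (h.reverseAppend h.nil).congr fun _ => by rw [List.append_nil]

theorem append (h : Feas N e fun ω => .ofList (l ω)) (h' : Feas N e fun ω => .ofList (l' ω)) :
    Feas N e fun ω => .ofList (l ω ++ l' ω) :=
  (h.reverse.reverseAppend h').congr fun _ => by rw [List.reverse_reverse]

variable {K : Ω → ℕ}

/-- List comprehension: the lists `g ω 0, …, g ω (K ω - 1)` are concatenated. -/
theorem flatMap {g : (ω : Ω) → Fin (K ω) → List Datum}
    (hK : Feas N e fun ω => .nat (K ω)) (hKb : PolyBdd N K)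
    (hg : Feas (fun q : (ω : Ω) × Fin (K ω) => N q.1) (fun q => .pair (e q.1) (.nat q.2))
      fun q => .ofList (g q.1 q.2)) :
    Feas N e fun ω => .ofList ((List.finRange (K ω)).flatMap (g ω)) := by
  obtain ⟨c, hc⟩ := hg.bdd
  have hsb : PolyBdd (fun q : (ω : Ω) × Fin (K ω) => N q.1) fun q =>
      (Datum.ofList (((List.finRange (K q.1)).drop (K q.1 - q.2)).flatMap (g q.1))).size := by
    refine ((PolyBdd.const _ 1).add ((hKb.mul ((PolyBdd.self N).polyBound c)).reindex
      Sigma.fst)).mono ?_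
    rintro ⟨ω, i, hi⟩
    have h1 : ∀ L : List (Fin (K ω)), (Datum.ofList (L.flatMap (g ω))).size ≤
        1 + L.length * polyBound c (N ω) := by
      intro L
      induction L with
      | nil => simp [Datum.ofList, Datum.size]
      | cons a L ih =>
        rw [List.flatMap_cons, List.length_cons]
        have h2 := Datum.size_ofList_append (g ω a) (L.flatMap (g ω))
        have h3 := hc ⟨ω, a⟩
        dsimp only at h3
        rw [add_mul]
        omega
    refine (h1 _).trans (Nat.add_le_add_left (Nat.mul_le_mul_right _ ?_) _)
    simp
  have hx : Feas (fun q : (ω : Ω) × Fin (K ω) => N q.1) (fun q => .pair (e q.1) (.nat q.2))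
      fun q => .ofList (g q.1 q.2.rev) := by
    refine (hg.reindex fun q : (ω : Ω) × Fin (K ω) => ⟨q.1, q.2.rev⟩).comp
      ((outer hK.bdd_left hKb).pair ?_)
    have h1 := index hK.bdd_left hKb
    refine ((hK.lift Sigma.fst (outer hK.bdd_left hKb)).natSub (h1.natAdd (h1.natLit 1))).congr
      fun q => ?_
    rw [Fin.val_rev]
  have hI := Feas.id (bdd_pair hx.bdd hsb)
  refine (accumulate (s := fun ω i => .ofList (((List.finRange (K ω)).drop (K ω - i)).flatMap (g ω)))
    (x := fun ω i => .ofList (g ω i.rev)) hK hKb (hK.nil.congr fun ω => ?_) hx hsb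
    ((hI.fst.append hI.snd).congr fun q => ?_)).congr fun ω => ?_
  · rw [List.drop_eq_nil_of_le (by simp)]; rfl
  · obtain ⟨ω, i, hi⟩ := q
    dsimp only
    rw [List.drop_eq_getElem_cons (i := K ω - (i + 1)) (by simp; omega), List.flatMap_cons,
      show K ω - (i + 1) + 1 = K ω - i by omega]
    congr 3
    simp [Fin.ext_iff]
  · simp

theorem ofFn {g : (ω : Ω) → Fin (K ω) → Datum}
    (hK : Feas N e fun ω => .nat (K ω)) (hKb : PolyBdd N K)
    (hg : Feas (fun q : (ω : Ω) × Fin (K ω) => N q.1) (fun q => .pair (e q.1) (.nat q.2))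
      fun q => g q.1 q.2) : Feas N e fun ω => .ofFn (g ω) :=
  (flatMap (g := fun ω i => [g ω i]) hK hKb (hg.cons hg.nil)).congr fun ω => by
    rw [Datum.ofFn, List.ofFn_eq_map, List.flatMap_def]
    congr 1
    induction List.finRange (K ω) <;> simp_all

theorem getFn {g : (ω : Ω) → Fin (K ω) → Datum} {j : (ω : Ω) → Fin (K ω)}
    (h : Feas N e fun ω => .ofFn (g ω)) (hj : Feas N e fun ω => .nat (j ω)) :
    Feas N e fun ω => g ω (j ω) :=
  (h.get hj fun ω => by simp).congr fun ω => by simp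

theorem lengthFn {g : (ω : Ω) → Fin (K ω) → Datum} (h : Feas N e fun ω => .ofFn (g ω)) :
    Feas N e fun ω => .nat (K ω) := (Feas.length h).congr fun ω => by simp

end Lists

/-! ### Lists of encoded objects -/

section Encoded

variable {α : Ω → Type} {enc : (ω : Ω) → α ω → Datum} {L : (ω : Ω) → List (α ω)}

theorem lengthEnc (h : Feas N e fun ω => .ofList ((L ω).map (enc ω))) :
    Feas N e fun ω => .nat (L ω).length := h.length.congr fun ω => by rw [List.length_map]

theorem bdd_lengthEnc (h : Feas N e fun ω => .ofList ((L ω).map (enc ω))) :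
    PolyBdd N fun ω => (L ω).length := (bdd_length h.bdd).mono fun ω => by rw [List.length_map]

theorem getEnc {j : (ω : Ω) → Fin (L ω).length} (h : Feas N e fun ω => .ofList ((L ω).map (enc ω)))
    (hj : Feas N e fun ω => .nat (j ω)) : Feas N e fun ω => enc ω ((L ω).get (j ω)) :=
  (h.get hj fun ω => by simp).congr fun ω => by simp

/-- The element under consideration in a comprehension over a list. -/
theorem item (h : Feas N e fun ω => .ofList ((L ω).map (enc ω))) :
    Feas (fun q : (ω : Ω) × Fin (L ω).length => N q.1) (fun q => .pair (e q.1) (.nat q.2))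
      fun q => enc q.1 ((L q.1).get q.2) :=
  getEnc (α := fun q : (ω : Ω) × Fin (L ω).length => α q.1)
    (L := fun q : (ω : Ω) × Fin (L ω).length => L q.1)
    (enc := fun q : (ω : Ω) × Fin (L ω).length => enc q.1)
    (j := fun q => q.2) (h.lift Sigma.fst (outer h.bdd_left (bdd_lengthEnc h)))
    (index h.bdd_left (bdd_lengthEnc h))

theorem flatMapEnc {β : Ω → Type} {enc' : (ω : Ω) → β ω → Datum} {g : (ω : Ω) → α ω → List (β ω)}
    (h : Feas N e fun ω => .ofList ((L ω).map (enc ω)))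
    (hg : Feas (fun q : (ω : Ω) × Fin (L ω).length => N q.1) (fun q => .pair (e q.1) (.nat q.2))
      fun q => .ofList ((g q.1 ((L q.1).get q.2)).map (enc' q.1))) :
    Feas N e fun ω => .ofList (((L ω).flatMap (g ω)).map (enc' ω)) := by
  refine (flatMap (g := fun ω i => (g ω ((L ω).get i)).map (enc' ω)) h.lengthEnc
    h.bdd_lengthEnc hg).congr fun ω => ?_
  congr 1
  conv_rhs => rw [← List.map_get_finRange (L ω), List.flatMap_map, List.map_flatMap]

theorem filterEnc {c : (ω : Ω) → α ω → Prop} [∀ ω, DecidablePred (c ω)]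
    (h : Feas N e fun ω => .ofList ((L ω).map (enc ω)))
    (hc : Feas (fun q : (ω : Ω) × Fin (L ω).length => N q.1) (fun q => .pair (e q.1) (.nat q.2))
      fun q => ind (c q.1 ((L q.1).get q.2))) :
    Feas N e fun ω => .ofList (((L ω).filter (c ω)).map (enc ω)) := by
  refine (flatMapEnc (enc' := enc) (g := fun ω a => if c ω a then [a] else []) h
    ((hc.ite (h.item.cons h.item.nil) h.item.nil).congr fun q => ?_)).congr fun ω => ?_
  · split_ifs <;> rfl
  · congr 2
    induction L ω with
    | nil => rfl
    | cons a l ih => by_cases ha : c ω a <;> simp [ha, ih]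

theorem takeEnc {K : Ω → ℕ} (h : Feas N e fun ω => .ofList ((L ω).map (enc ω)))
    (hK : Feas N e fun ω => .nat (K ω)) :
    Feas N e fun ω => .ofList (((L ω).take (K ω)).map (enc ω)) := by
  have hm := hK.natMin h.lengthEnc
  have hb : PolyBdd N fun ω => min (K ω) (L ω).length := h.bdd_lengthEnc.mono fun ω => by omega
  refine (ofFn (g := fun ω (i : Fin (min (K ω) (L ω).length)) =>
    enc ω ((L ω).get ⟨i, i.2.trans_le (Nat.min_le_right _ _)⟩)) hm hb
    (getEnc (α := fun q : (ω : Ω) × Fin (min (K ω) (L ω).length) => α q.1)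
    (L := fun q : (ω : Ω) × Fin (min (K ω) (L ω).length) => L q.1)
    (enc := fun q : (ω : Ω) × Fin (min (K ω) (L ω).length) => enc q.1)
    (j := fun q => ⟨q.2, q.2.2.trans_le (Nat.min_le_right _ _)⟩)
    (h.lift Sigma.fst (outer h.bdd_left hb)) (index h.bdd_left hb))).congr fun ω => ?_
  rw [Datum.ofFn]
  congr 1
  refine List.ext_getElem (by simp) fun i h1 h2 => ?_
  simp

end Encoded

end Feas

/-! ### Decoding coin flips, and concentration of empirical means -/

/-- The outcomes of the coin flips used in one sample: a seed below `2 ^ bS`, and a number below `q`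
for each of the `n` qudits. -/
abbrev Seed (n q bS : ℕ) : Type := (Fin n → Fin q) × Fin (2 ^ bS)

/-- Numbers below `q ^ n * 2 ^ bS` correspond to seeds. -/
def seedEquiv (n q bS : ℕ) : Fin (q ^ n * 2 ^ bS) ≃ Seed n q bS :=
  finProdFinEquiv.symm.trans (finFunctionFinEquiv.symm.prodCongr (Equiv.refl _))

/-- The `J` seeds that are read off a number, of which only the residue modulo
`(q ^ n * 2 ^ bS) ^ J` matters. -/
def seeds (n q bS J : ℕ) (hq : 0 < q) (r : ℕ) (j : Fin J) : Seed n q bS :=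
  seedEquiv n q bS (finFunctionFinEquiv.symm
    (⟨r % (q ^ n * 2 ^ bS) ^ J, Nat.mod_lt _ (by positivity)⟩ : Fin ((q ^ n * 2 ^ bS) ^ J)) j)

/-- Fair coin flips yield independent uniform seeds. -/
theorem coinProb_seeds {n P bS J B : ℕ} (hB : J * (P * n + bS) ≤ B)
    (E : (Fin J → Seed n (2 ^ P) bS) → Prop) :
    coinProb B (fun r => E (seeds n (2 ^ P) bS J (by positivity) r)) =
      (Nat.card {ω : Fin J → Seed n (2 ^ P) bS // E ω} : ℝ) /
        Fintype.card (Fin J → Seed n (2 ^ P) bS) := by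
  set β := (2 ^ P) ^ n * 2 ^ bS with hβ
  have hβ' : β ^ J = 2 ^ (J * (P * n + bS)) := by
    rw [hβ, ← pow_mul, ← pow_add, ← pow_mul, mul_comm]
  have h2 : 2 ^ B = 2 ^ (B - J * (P * n + bS)) * β ^ J := by
    rw [hβ', ← pow_add]; congr 1; omega
  let e₁ : (Fin J → Fin β) ≃ (Fin J → Seed n (2 ^ P) bS) :=
    Equiv.piCongrRight fun _ => seedEquiv n (2 ^ P) bS
  let e : Fin (2 ^ B) ≃ Fin (2 ^ (B - J * (P * n + bS))) × (Fin J → Seed n (2 ^ P) bS) :=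
    (finCongr h2).trans (finProdFinEquiv.symm.trans
      ((Equiv.refl _).prodCongr (finFunctionFinEquiv.symm.trans e₁)))
  have he : ∀ r, (e r).2 = seeds n (2 ^ P) bS J (by positivity) r := fun r => rfl
  have hc : Nat.card {r : Fin (2 ^ B) // E (seeds n (2 ^ P) bS J (by positivity) r)} =
      2 ^ (B - J * (P * n + bS)) * Nat.card {ω : Fin J → Seed n (2 ^ P) bS // E ω} := by
    have h3 : {r : Fin (2 ^ B) // E (seeds n (2 ^ P) bS J (by positivity) r)} ≃
        Fin (2 ^ (B - J * (P * n + bS))) × {ω : Fin J → Seed n (2 ^ P) bS // E ω} :=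
      (e.subtypeEquiv (q := fun x => E x.2) fun r => by rw [he]).trans
        { toFun := fun x => (x.1.1, ⟨x.1.2, x.2⟩)
          invFun := fun x => ⟨(x.1, x.2.1), x.2.2⟩
          left_inv := fun _ => rfl
          right_inv := fun _ => rfl }
    rw [Nat.card_congr h3, Nat.card_prod, Nat.card_eq_fintype_card, Fintype.card_fin]
  have hd : Fintype.card (Fin J → Seed n (2 ^ P) bS) = β ^ J := by
    rw [← Fintype.card_congr e₁]; simp
  have h2' : (2 : ℝ) ^ B = (2 : ℝ) ^ (B - J * (P * n + bS)) * (β : ℝ) ^ J := by exact_mod_cast h2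
  have hβ0 : (β : ℝ) ≠ 0 := by rw [hβ]; positivity
  rw [coinProb, hc, hd, h2']
  push_cast
  field_simp

/-- The mean value of a function on a finite type. -/
noncomputable def avg {α : Type} [Fintype α] (g : α → ℝ) : ℝ := (∑ a, g a) / Fintype.card α

/-- One-sided concentration of the empirical mean (exponential Markov inequality, with
`exp x ≤ 1 + x + x ^ 2`). -/
theorem card_upper_deviation_le {α : Type} [Fintype α] [Nonempty α] {g : α → ℝ}
    (hg : ∀ a, |g a| ≤ 2) (J : ℕ) {η : ℝ} (hη : 0 < η) (hη' : η ≤ 1) :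
    (Nat.card {ω : Fin J → α // J * η ≤ ∑ j, (g (ω j) - avg g)} : ℝ) ≤
      Real.exp (-(J * η ^ 2 / 64)) * Fintype.card (Fin J → α) := by
  classical
  have hc : (0 : ℝ) < Fintype.card α := by exact_mod_cast Fintype.card_pos
  set X : α → ℝ := fun a => g a - avg g with hX
  have havg : |avg g| ≤ 2 := by
    rw [avg, abs_div, abs_of_pos hc, div_le_iff₀ hc]
    refine (Finset.abs_sum_le_sum_abs _ _).trans ?_
    have := Finset.sum_le_card_nsmul Finset.univ _ _ fun a _ => hg a
    simpa [mul_comm] using this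
  have hX4 : ∀ a, |X a| ≤ 4 := fun a => (abs_sub _ _).trans (by linarith [hg a])
  have hX0 : ∑ a, X a = 0 := by
    simp only [hX, Finset.sum_sub_distrib, Finset.sum_const, Finset.card_univ, nsmul_eq_mul, avg]
    field_simp
    ring
  set l := η / 32 with hl
  have hexp : ∑ a, Real.exp (l * X a) ≤ Fintype.card α * Real.exp (16 * l ^ 2) := by
    have h1 : ∀ a, Real.exp (l * X a) ≤ 1 + l * X a + 16 * l ^ 2 := fun a => by
      have h2 : |l * X a| ≤ 1 := by
        rw [abs_mul, abs_of_pos (by positivity)]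
        nlinarith [hX4 a, abs_nonneg (X a)]
      have h3 := (abs_le.1 (Real.abs_exp_sub_one_sub_id_le h2)).2
      have h4 : (X a) ^ 2 ≤ 16 := by
        rw [← sq_abs]; nlinarith [hX4 a, abs_nonneg (X a)]
      nlinarith [sq_nonneg l]
    calc _ ≤ ∑ a, (1 + l * X a + 16 * l ^ 2) := Finset.sum_le_sum fun a _ => h1 a
      _ = Fintype.card α * (1 + 16 * l ^ 2) := by
        rw [Finset.sum_add_distrib, Finset.sum_add_distrib, ← Finset.mul_sum, hX0]
        simp [mul_add]
      _ ≤ _ := by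
        gcongr
        linarith [Real.add_one_le_exp (16 * l ^ 2)]
  -- the exponential moment factorizes over independent samples
  have hmgf : ∑ ω : Fin J → α, Real.exp (l * ∑ j, X (ω j)) ≤
      (Fintype.card α * Real.exp (16 * l ^ 2)) ^ J := by
    have : ∑ ω : Fin J → α, Real.exp (l * ∑ j, X (ω j)) = (∑ a, Real.exp (l * X a)) ^ J := by
      rw [Fintype.sum_pow]
      simp only [Finset.mul_sum, Real.exp_sum]
    rw [this]
    exact pow_le_pow_left₀ (Finset.sum_nonneg fun a _ => (Real.exp_pos _).le) hexp J
  have hmark : (Nat.card {ω : Fin J → α // J * η ≤ ∑ j, X (ω j)} : ℝ) * Real.exp (l * (J * η)) ≤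
      ∑ ω : Fin J → α, Real.exp (l * ∑ j, X (ω j)) := by
    rw [Nat.card_eq_fintype_card, Fintype.card_subtype, ← nsmul_eq_mul]
    have h1 : ∀ ω ∈ Finset.univ.filter (fun ω : Fin J → α => J * η ≤ ∑ j, X (ω j)),
        Real.exp (l * (J * η)) ≤ Real.exp (l * ∑ j, X (ω j)) := fun ω hω =>
      Real.exp_le_exp.2 (mul_le_mul_of_nonneg_left (Finset.mem_filter.1 hω).2 (by positivity))
    exact (Finset.card_nsmul_le_sum _ _ _ h1).trans
      (Finset.sum_le_sum_of_subset_of_nonneg (Finset.filter_subset _ _)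
        fun ω _ _ => (Real.exp_pos _).le)
  have h5 := hmark.trans hmgf
  rw [← le_div_iff₀ (Real.exp_pos _)] at h5
  refine h5.trans (le_of_eq ?_)
  rw [mul_pow, ← Real.exp_nat_mul, mul_div_assoc, ← Real.exp_sub, Fintype.card_pi_const,
    mul_comm, Nat.cast_pow]
  congr 2
  rw [hl]
  ring

/-- Two-sided concentration of the empirical mean of `J` independent samples. -/
theorem card_deviation_le {α : Type} [Fintype α] [Nonempty α] {g : α → ℝ}
    (hg : ∀ a, |g a| ≤ 2) {J : ℕ} (hJ : 0 < J) {η : ℝ} (hη : 0 < η) (hη' : η ≤ 1) :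
    (Nat.card {ω : Fin J → α // η ≤ |(∑ j, g (ω j)) / J - avg g|} : ℝ) ≤
      2 * Real.exp (-(J * η ^ 2 / 64)) * Fintype.card (Fin J → α) := by
  classical
  have h1 := card_upper_deviation_le hg J hη hη'
  have h2 := card_upper_deviation_le (g := fun a => -g a) (by simpa using hg) J hη hη'
  have h3 : avg (fun a => -g a) = -avg g := by
    simp [avg, Finset.sum_neg_distrib, neg_div]
  have hJ' : (0 : ℝ) < J := by exact_mod_cast hJ
  rw [h3] at h2
  have h4 : Nat.card {ω : Fin J → α // η ≤ |(∑ j, g (ω j)) / J - avg g|} ≤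
      Nat.card {ω : Fin J → α // J * η ≤ ∑ j, (g (ω j) - avg g)} +
        Nat.card {ω : Fin J → α // J * η ≤ ∑ j, (-g (ω j) - -avg g)} := by
    simp only [Nat.card_eq_fintype_card, Fintype.card_subtype]
    refine (Finset.card_le_card fun ω hω => ?_).trans (Finset.card_union_le _ _)
    simp only [Finset.mem_union, Finset.mem_filter, Finset.mem_univ, true_and] at hω ⊢
    have h5 : (∑ j, (g (ω j) - avg g)) = J * ((∑ j, g (ω j)) / J - avg g) := by
      rw [Finset.sum_sub_distrib]; simp; field_simp
    have h6 : (∑ j, (-g (ω j) - -avg g)) = -∑ j, (g (ω j) - avg g) := by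
      rw [← Finset.sum_neg_distrib]; exact Finset.sum_congr rfl fun _ _ => by ring
    rw [h6, h5]
    rcases le_abs.1 hω with h | h
    · exact Or.inl (mul_le_mul_of_nonneg_left h hJ'.le)
    · right; nlinarith
  have h7 : (Nat.card {ω : Fin J → α // η ≤ |(∑ j, g (ω j)) / J - avg g|} : ℝ) ≤ _ :=
    (Nat.cast_le.2 h4).trans_eq (Nat.cast_add _ _)
  linarith

/-- Empirical means of a finite family of statistics are simultaneously accurate. -/
theorem card_all_close_ge {α ι : Type} [Fintype α] [Nonempty α] [Fintype ι] {g : ι → α → ℝ}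
    (hg : ∀ i a, |g i a| ≤ 2) {J : ℕ} (hJ : 0 < J) {η δ : ℝ} (hη : 0 < η) (hη' : η ≤ 1)
    (hδ : 2 * Fintype.card ι * Real.exp (-(J * η ^ 2 / 64)) ≤ δ) :
    1 - δ ≤ (Nat.card {ω : Fin J → α // ∀ i, |(∑ j, g i (ω j)) / J - avg (g i)| ≤ η} : ℝ) /
      Fintype.card (Fin J → α) := by
  classical
  have hc : (0 : ℝ) < Fintype.card (Fin J → α) := by exact_mod_cast Fintype.card_pos
  rw [le_div_iff₀ hc]
  have h1 : Fintype.card (Fin J → α) ≤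
      Nat.card {ω : Fin J → α // ∀ i, |(∑ j, g i (ω j)) / J - avg (g i)| ≤ η} +
        ∑ i, Nat.card {ω : Fin J → α // η ≤ |(∑ j, g i (ω j)) / J - avg (g i)|} := by
    simp only [Nat.card_eq_fintype_card, Fintype.card_subtype]
    rw [← Finset.card_univ]
    refine (Finset.card_le_card (t := _ ∪ Finset.univ.biUnion fun i => Finset.univ.filter
      fun ω : Fin J → α => η ≤ |(∑ j, g i (ω j)) / J - avg (g i)|) fun ω _ => ?_).trans
      ((Finset.card_union_le _ _).trans (Nat.add_le_add_left Finset.card_biUnion_le _))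
    simp only [Finset.mem_union, Finset.mem_filter, Finset.mem_univ, true_and, Finset.mem_biUnion]
    by_contra! h
    exact absurd h.1 (by push Not; exact fun i => (h.2 i).le)
  have h2 : (∑ i, (Nat.card {ω : Fin J → α // η ≤ |(∑ j, g i (ω j)) / J - avg (g i)|} : ℝ)) ≤
      δ * Fintype.card (Fin J → α) := by
    refine (Finset.sum_le_card_nsmul _ _ _ fun i _ => card_deviation_le (hg i) hJ hη hη').trans ?_
    rw [Finset.card_univ, nsmul_eq_mul]
    calc _ = 2 * Fintype.card ι * Real.exp (-(J * η ^ 2 / 64)) * Fintype.card (Fin J → α) := by ring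
      _ ≤ _ := by gcongr
  have h3 : (Fintype.card (Fin J → α) : ℝ) ≤
      Nat.card {ω : Fin J → α // ∀ i, |(∑ j, g i (ω j)) / J - avg (g i)| ≤ η} +
        ∑ i, (Nat.card {ω : Fin J → α // η ≤ |(∑ j, g i (ω j)) / J - avg (g i)|} : ℝ) := by
    exact_mod_cast h1
  linarith

/-! ### Marginals of the output state as overlaps -/

section Marginals

variable {n : ℕ} {d : Fin n → ℕ}

/-- The amplitude of `y` in the state obtained from `ψ` by `u₁ ⊗ ⋯ ⊗ uₙ`. -/
noncomputable def outAmp (u : (i : Fin n) → Matrix (Fin (d i)) (Fin (d i)) ℂ)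
    (ψ : BasisLabel d → ℂ) (y : BasisLabel d) : ℂ := ∑ x, (∏ j, u j (y j) (x j)) * ψ x

/-- The probability that the first `i` qudits of the output are found in the state `y₁ ⋯ yᵢ`. -/
noncomputable def marginal (u : (i : Fin n) → Matrix (Fin (d i)) (Fin (d i)) ℂ)
    (ψ : BasisLabel d → ℂ) (i : ℕ) (y : BasisLabel d) : ℝ :=
  ∑ y' : BasisLabel d, if ∀ j : Fin n, (j : ℕ) < i → y' j = y j then ‖outAmp u ψ y'‖ ^ 2 else 0

/-- The matrix entry at `(x, x')` of the tensor product which has, on the first `i` qudits, all rows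
equal to the row `yⱼ` of `uⱼ`, and is the identity on the other qudits. -/
noncomputable def rowKernel (u : (i : Fin n) → Matrix (Fin (d i)) (Fin (d i)) ℂ) (i : ℕ)
    (y x x' : BasisLabel d) : ℂ :=
  ∏ j : Fin n, if (j : ℕ) < i then u j (y j) (x' j) else if x j = x' j then 1 else 0

variable {u : (i : Fin n) → Matrix (Fin (d i)) (Fin (d i)) ℂ}

theorem sum_star_mul_of_unitary {m : ℕ} {v : Matrix (Fin m) (Fin m) ℂ}
    (hv : v ∈ Matrix.unitaryGroup (Fin m) ℂ) (b c : Fin m) :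
    ∑ a, conj (v a b) * v a c = if b = c then 1 else 0 := by
  have := congrFun (congrFun (Matrix.mem_unitaryGroup_iff'.1 hv) b) c
  simpa [Matrix.mul_apply, Matrix.star_apply, Matrix.one_apply] using this

theorem sum_row_norm_sq_of_unitary {m : ℕ} {v : Matrix (Fin m) (Fin m) ℂ}
    (hv : v ∈ Matrix.unitaryGroup (Fin m) ℂ) (a : Fin m) : ∑ b, ‖v a b‖ ^ 2 = 1 := by
  have := congrFun (congrFun (Matrix.mem_unitaryGroup_iff.1 hv) a) a
  simp only [Matrix.mul_apply, Matrix.star_apply, Matrix.one_apply, if_true] at this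
  have h : ((∑ b, ‖v a b‖ ^ 2 : ℝ) : ℂ) = 1 := by
    rw [← this]
    push_cast
    exact Finset.sum_congr rfl fun b _ => (Complex.mul_conj' _).symm
  exact_mod_cast h

theorem norm_rowKernel_le_one (hu : ∀ j, u j ∈ Matrix.unitaryGroup (Fin (d j)) ℂ) (i : ℕ)
    (y x x' : BasisLabel d) : ‖rowKernel u i y x x'‖ ≤ 1 := by
  rw [rowKernel, norm_prod]
  refine Finset.prod_le_one (fun _ _ => norm_nonneg _) fun j _ => ?_
  split_ifs
  · exact entry_norm_bound_of_unitary (hu j) _ _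
  · simp
  · simp

theorem sum_rowKernel_norm_sq (hu : ∀ j, u j ∈ Matrix.unitaryGroup (Fin (d j)) ℂ) (i : ℕ)
    (y x : BasisLabel d) : ∑ x', ‖rowKernel u i y x x'‖ ^ 2 = 1 := by
  simp only [rowKernel, norm_prod, ← Finset.prod_pow]
  rw [← Fintype.prod_sum (fun j (b : Fin (d j)) =>
    ‖if (j : ℕ) < i then u j (y j) b else if x j = b then 1 else 0‖ ^ 2)]
  refine Finset.prod_eq_one fun j _ => ?_
  split_ifs
  · exact sum_row_norm_sq_of_unitary (hu j) _
  · rw [Finset.sum_eq_single (x j)] <;> simp +contextual [eq_comm]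

/-- The marginals as sums of products of two amplitudes of `ψ` and two row kernels. The right hand
side is the overlap of a vector of unit length, on two copies of the system, with
its image under the exchange of the two copies. -/
theorem marginal_eq_sum (hu : ∀ j, u j ∈ Matrix.unitaryGroup (Fin (d j)) ℂ)
    (ψ : BasisLabel d → ℂ) (i : ℕ) (y : BasisLabel d) :
    (marginal u ψ i y : ℂ) = ∑ x, ∑ x',
      conj (ψ x * conj (rowKernel u i y x x')) * (ψ x' * conj (rowKernel u i y x' x)) := by
  -- the sum over the labels with prefix `y` factorizes; unitarity collapses the qudits not measured
  have h1 : ∀ x x', ∑ y' : BasisLabel d, (if ∀ j : Fin n, (j : ℕ) < i → y' j = y j then (1 : ℂ) else 0) *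
      (conj (∏ j, u j (y' j) (x j)) * ∏ j, u j (y' j) (x' j)) =
      rowKernel u i y x x' * conj (rowKernel u i y x' x) := by
    intro x x'
    have h2 : ∀ y' : BasisLabel d, (if ∀ j : Fin n, (j : ℕ) < i → y' j = y j then (1 : ℂ) else 0) *
        (conj (∏ j, u j (y' j) (x j)) * ∏ j, u j (y' j) (x' j)) =
        ∏ j : Fin n, ((if (j : ℕ) < i → y' j = y j then (1 : ℂ) else 0) *
          (conj (u j (y' j) (x j)) * u j (y' j) (x' j))) := by
      intro y'
      rw [Finset.prod_mul_distrib, Finset.prod_mul_distrib, map_prod, Finset.prod_ite_zero]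
      simp
    simp only [h2]
    rw [← Fintype.prod_sum (fun j (b : Fin (d j)) => (if (j : ℕ) < i → b = y j then (1 : ℂ) else 0) *
          (conj (u j b (x j)) * u j b (x' j))), rowKernel, rowKernel, map_prod,
      ← Finset.prod_mul_distrib]
    refine Finset.prod_congr rfl fun j _ => ?_
    by_cases hj : (j : ℕ) < i
    · simp only [hj, if_true, forall_const]
      rw [Finset.sum_eq_single (y j)]
      · rw [if_pos rfl]; ring
      · intro b _ hb; simp [hb]
      · simp
    · simp only [hj, if_false, false_imp_iff, if_true, one_mul]
      rw [sum_star_mul_of_unitary (hu j)]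
      by_cases h : x j = x' j
      · simp [h]
      · simp [h]
  have h3 : ∀ y', ((‖outAmp u ψ y'‖ ^ 2 : ℝ) : ℂ) = ∑ x, ∑ x', conj (ψ x) * ψ x' *
      (conj (∏ j, u j (y' j) (x j)) * ∏ j, u j (y' j) (x' j)) := by
    intro y'
    push_cast
    rw [← Complex.conj_mul', outAmp, map_sum, Finset.sum_mul_sum]
    refine Finset.sum_congr rfl fun x _ => Finset.sum_congr rfl fun x' _ => ?_
    rw [map_mul]
    ring
  have h4 : (marginal u ψ i y : ℂ) = ∑ y' : BasisLabel d,
      (if ∀ j : Fin n, (j : ℕ) < i → y' j = y j then (1 : ℂ) else 0) *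
      ∑ x, ∑ x', conj (ψ x) * ψ x' *
        (conj (∏ j, u j (y' j) (x j)) * ∏ j, u j (y' j) (x' j)) := by
    rw [marginal, Complex.ofReal_sum]
    refine Finset.sum_congr rfl fun y' _ => ?_
    split_ifs
    · rw [h3, one_mul]
    · simp
  rw [h4]
  simp only [Finset.mul_sum]
  rw [Finset.sum_comm]
  refine Finset.sum_congr rfl fun x _ => ?_
  rw [Finset.sum_comm]
  refine Finset.sum_congr rfl fun x' _ => ?_
  calc _ = conj (ψ x) * ψ x' * ∑ y' : BasisLabel d,
        (if ∀ j : Fin n, (j : ℕ) < i → y' j = y j then (1 : ℂ) else 0) *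
        (conj (∏ j, u j (y' j) (x j)) * ∏ j, u j (y' j) (x' j)) := by
        rw [Finset.mul_sum]
        exact Finset.sum_congr rfl fun _ _ => by ring
    _ = _ := by rw [h1, map_mul, Complex.conj_conj]; ring

end Marginals

/-! ### The bounded overlap estimator -/

/-- The function whose expectation with respect to the density `|f|² + |g|²` is the sum of the
products `f g`. It is bounded, however small `f` and `g` are. -/
noncomputable def ratio (f g : ℂ) : ℂ := f * g / ((‖f‖ ^ 2 + ‖g‖ ^ 2 : ℝ) : ℂ)

theorem norm_ratio_le (f g : ℂ) : ‖ratio f g‖ ≤ 1 / 2 := by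
  rw [ratio, norm_div, norm_mul, Complex.norm_real, Real.norm_of_nonneg (by positivity)]
  rcases (show 0 ≤ ‖f‖ ^ 2 + ‖g‖ ^ 2 by positivity).eq_or_lt with h | h
  · rw [← h]; norm_num
  · rw [div_le_iff₀ h]; nlinarith [sq_nonneg (‖f‖ - ‖g‖)]

theorem mul_ratio (f g : ℂ) : ((‖f‖ ^ 2 + ‖g‖ ^ 2 : ℝ) : ℂ) * ratio f g = f * g := by
  rw [ratio]
  rcases eq_or_ne (‖f‖ ^ 2 + ‖g‖ ^ 2) 0 with h | h
  · have hf : f = 0 := by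
      have : ‖f‖ ^ 2 = 0 := by nlinarith [sq_nonneg ‖f‖, sq_nonneg ‖g‖]
      simpa using this
    simp [hf]
  · exact mul_div_cancel₀ _ (by exact_mod_cast h)

theorem ratio_smul {c : ℝ} (hc : c ≠ 0) (f g : ℂ) : ratio (c * f) (c * g) = ratio f g := by
  rw [ratio, ratio, norm_mul, norm_mul, Complex.norm_real, mul_pow, mul_pow, ← mul_add]
  have : (c : ℂ) ≠ 0 := by exact_mod_cast hc
  rw [show (c : ℂ) * f * (c * g) = (c : ℂ) ^ 2 * (f * g) by ring, Real.norm_eq_abs, sq_abs,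
    Complex.ofReal_mul, Complex.ofReal_pow, mul_div_mul_left _ _ (pow_ne_zero _ this)]

theorem ratio_conj_re_symm (f g : ℂ) : (ratio (conj f) g).re = (ratio (conj g) f).re := by
  rw [← Complex.conj_re (ratio (conj g) f), ratio, ratio, map_div₀, map_mul,
    Complex.conj_conj, Complex.conj_ofReal, RCLike.norm_conj, RCLike.norm_conj,
    add_comm (‖f‖ ^ 2), mul_comm (conj f)]

/-- With respect to the density `|f|² + |g|²`, the estimator is stable under perturbation of `f` and
`g`, even where this density is small. -/
theorem mul_norm_ratio_sub_le {f g f' g' : ℂ} {τ : ℝ} (hτ : τ ≤ 1) (hf : ‖f‖ ≤ 1) (hg : ‖g‖ ≤ 1)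
    (hff : ‖f' - f‖ ≤ τ) (hgg : ‖g' - g‖ ≤ τ) :
    (‖f‖ ^ 2 + ‖g‖ ^ 2) * ‖ratio f' g' - ratio f g‖ ≤ 6 * τ := by
  have hτ0 : 0 ≤ τ := (norm_nonneg _).trans hff
  have hN : 0 ≤ ‖f‖ ^ 2 + ‖g‖ ^ 2 := by positivity
  have e : ((‖f‖ ^ 2 + ‖g‖ ^ 2 : ℝ) : ℂ) * (ratio f' g' - ratio f g) =
      (((‖f‖ ^ 2 + ‖g‖ ^ 2) - (‖f'‖ ^ 2 + ‖g'‖ ^ 2) : ℝ) : ℂ) * ratio f' g' +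
        (f' * (g' - g) + (f' - f) * g) := by
    rw [mul_sub, mul_ratio, Complex.ofReal_sub, sub_mul, mul_ratio]
    ring
  have hf' : ‖f'‖ ≤ 1 + τ := by
    have := norm_add_le f (f' - f); rw [add_sub_cancel] at this; linarith
  have hg' : ‖g'‖ ≤ 1 + τ := by
    have := norm_add_le g (g' - g); rw [add_sub_cancel] at this; linarith
  have h1 := abs_le.1 ((abs_norm_sub_norm_le f' f).trans hff)
  have h2 := abs_le.1 ((abs_norm_sub_norm_le g' g).trans hgg)
  have hd : |(‖f‖ ^ 2 + ‖g‖ ^ 2) - (‖f'‖ ^ 2 + ‖g'‖ ^ 2)| ≤ 6 * τ := by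
    have a1 := norm_nonneg f
    have a2 := norm_nonneg g
    have a3 := norm_nonneg f'
    have a4 := norm_nonneg g'
    rw [abs_le]
    constructor <;> nlinarith
  calc _ = ‖((‖f‖ ^ 2 + ‖g‖ ^ 2 : ℝ) : ℂ) * (ratio f' g' - ratio f g)‖ := by
        rw [norm_mul, Complex.norm_real, Real.norm_of_nonneg hN]
    _ ≤ |(‖f‖ ^ 2 + ‖g‖ ^ 2) - (‖f'‖ ^ 2 + ‖g'‖ ^ 2)| * ‖ratio f' g'‖ +
        (‖f'‖ * ‖g' - g‖ + ‖f' - f‖ * ‖g‖) := by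
        rw [e]
        refine (norm_add_le _ _).trans (add_le_add ?_ ((norm_add_le _ _).trans ?_))
        · rw [norm_mul, Complex.norm_real, Real.norm_eq_abs]
        · rw [norm_mul, norm_mul]
    _ ≤ 6 * τ * (1 / 2) + (2 * τ + τ * 1) := by
        gcongr
        · exact norm_ratio_le _ _
        · linarith
    _ = _ := by ring

/-- Products of factors of modulus at most `1` depend continuously on the factors. -/
theorem norm_prod_sub_prod_le {ι : Type*} (s : Finset ι) {a b : ι → ℂ} {η : ℝ} (hη : 0 ≤ η)
    (hη' : η ≤ 1) (ha : ∀ i ∈ s, ‖a i‖ ≤ 1) (hab : ∀ i ∈ s, ‖b i - a i‖ ≤ η) :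
    ‖∏ i ∈ s, b i - ∏ i ∈ s, a i‖ ≤ 2 ^ s.card * η := by
  classical
  have key : ‖∏ i ∈ s, b i - ∏ i ∈ s, a i‖ ≤ (1 + η) ^ s.card - 1 := by
    induction s using Finset.induction_on with
    | empty => simp
    | insert i s hi ih =>
      rw [Finset.prod_insert hi, Finset.prod_insert hi, Finset.card_insert_of_notMem hi, pow_succ]
      have ih' := ih (fun j hj => ha j (Finset.mem_insert_of_mem hj))
        fun j hj => hab j (Finset.mem_insert_of_mem hj)
      have hp : ‖∏ i ∈ s, a i‖ ≤ 1 := by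
        rw [norm_prod]
        exact Finset.prod_le_one (fun _ _ => norm_nonneg _)
          fun j hj => ha j (Finset.mem_insert_of_mem hj)
      have hai := ha i (Finset.mem_insert_self _ _)
      have habi := hab i (Finset.mem_insert_self _ _)
      have hbi : ‖b i‖ ≤ 1 + η := by
        have := norm_add_le (a i) (b i - a i); rw [add_sub_cancel] at this; linarith
      calc _ = ‖b i * (∏ i ∈ s, b i - ∏ i ∈ s, a i) + (b i - a i) * ∏ i ∈ s, a i‖ := by
            congr 1; ring
        _ ≤ (1 + η) * ((1 + η) ^ s.card - 1) + η * 1 := by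
            refine (norm_add_le _ _).trans ?_
            rw [norm_mul, norm_mul]
            gcongr
        _ = _ := by ring
  have h2 : ∀ k : ℕ, (1 + η) ^ k - 1 ≤ (2 ^ k - 1) * η := by
    intro k
    induction k with
    | zero => simp
    | succ k ih =>
      have : (1 : ℝ) ≤ 2 ^ k := one_le_pow₀ (by norm_num)
      calc (1 + η) ^ (k + 1) - 1 = ((1 + η) ^ k - 1) * (1 + η) + η := by ring
        _ ≤ (2 ^ k - 1) * η * (1 + η) + η := by gcongr
        _ ≤ (2 ^ k - 1) * η * (1 + 1) + η := by
          have : 0 ≤ ((2 : ℝ) ^ k - 1) * η := mul_nonneg (by linarith) hη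
          gcongr
        _ = _ := by ring
  exact key.trans ((h2 _).trans (mul_le_mul_of_nonneg_right (by linarith) hη))

/-! ### The statistics computed from one sample -/

/-- The outcome among `0, …, m - 1` that is selected by the number `R` when the outcome `c` is given
an interval of length `wt c`, for all but the last outcome, which receives the rest. -/
def pick {m : ℕ} (hm : 0 < m) (wt : Fin m → ℕ) (R : ℕ) : Fin m :=
  ⟨∑ c : Fin m, if (c : ℕ) + 1 < m ∧ ∑ b, (if b ≤ c then wt b else 0) ≤ R then 1 else 0, by
    rw [Finset.sum_boole, Nat.cast_id]
    calc _ < (Finset.univ : Finset (Fin m)).card := Finset.card_lt_card <|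
            Finset.ssubset_univ_iff.2 fun h => by
              have := h ▸ Finset.mem_univ (⟨m - 1, by omega⟩ : Fin m)
              simp only [Finset.mem_filter] at this
              omega
      _ = m := by simp⟩

theorem lt_pick_iff {m : ℕ} (hm : 0 < m) (wt : Fin m → ℕ) (R : ℕ) (c : Fin m)
    (hc : (c : ℕ) + 1 < m) :
    c < pick hm wt R ↔ ∑ b, (if b ≤ c then wt b else 0) ≤ R := by
  have hmono : ∀ c c' : Fin m, c ≤ c' →
      ∑ b, (if b ≤ c then wt b else 0) ≤ ∑ b, (if b ≤ c' then wt b else 0) := by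
    intro c c' h
    refine Finset.sum_le_sum fun b _ => ?_
    by_cases hb : b ≤ c
    · rw [if_pos hb, if_pos (hb.trans h)]
    · rw [if_neg hb]; exact Nat.zero_le _
  rw [Fin.lt_def, pick]
  simp only [Finset.sum_boole, Nat.cast_id]
  constructor
  · intro h
    by_contra h'
    refine absurd h (not_lt.2 ?_)
    refine (Finset.card_le_card (t := Finset.Iio c) fun b hb => ?_).trans (by simp)
    rw [Finset.mem_Iio]
    by_contra hb'
    exact h' ((hmono c b (not_lt.1 hb')).trans (Finset.mem_filter.1 hb).2.2)
  · intro h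
    refine lt_of_lt_of_le ?_ (Finset.card_le_card (s := Finset.Iic c) fun b hb => ?_)
    · simp
    · have hb' := Finset.mem_Iic.1 hb
      refine Finset.mem_filter.2 ⟨Finset.mem_univ _, ?_, (hmono b c hb').trans h⟩
      have := Fin.le_def.1 hb'
      omega

/-- Each outcome is picked with the right frequency, up to the deficiency of the total weight. -/
theorem card_pick {m : ℕ} (hm : 0 < m) (wt : Fin m → ℕ) (Q : ℕ) (c : Fin m) :
    |((Finset.univ.filter fun R : Fin Q => pick hm wt R = c).card : ℤ) - wt c| ≤
      |((∑ b, wt b : ℕ) : ℤ) - Q| := by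
  set A := ∑ b, (if b < c then wt b else 0) with hA
  have hAc : ∑ b, (if b ≤ c then wt b else 0) = A + wt c := by
    have : wt c = ∑ b, if b = c then wt b else 0 := by simp
    rw [hA, this, ← Finset.sum_add_distrib]
    refine Finset.sum_congr rfl fun b _ => ?_
    rcases lt_trichotomy b c with h | h | h
    · simp [h, h.le, h.ne]
    · simp [h]
    · simp [h.not_ge, h.not_gt, h.ne']
  have hle : A + wt c ≤ ∑ b, wt b := by
    rw [← hAc]
    exact Finset.sum_le_sum fun b _ => by split_ifs <;> simp
  have hlast : ¬ (c : ℕ) + 1 < m → A + wt c = ∑ b, wt b := by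
    intro h
    rw [← hAc]
    refine Finset.sum_congr rfl fun b _ => if_pos (Fin.le_def.2 ?_)
    have := b.2
    omega
  have hiff : ∀ R : ℕ, pick hm wt R = c ↔ A ≤ R ∧ ((c : ℕ) + 1 < m → R < A + wt c) := by
    intro R
    have h1 : ((c : ℕ) + 1 < m → R < A + wt c) ↔ pick hm wt R ≤ c := by
      by_cases hc : (c : ℕ) + 1 < m
      · rw [← not_lt, lt_pick_iff hm wt R c hc, hAc, not_le]; simp [hc]
      · simp only [hc, false_imp_iff, true_iff]
        rw [Fin.le_def]
        have := (pick hm wt R).2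
        omega
    have h2 : A ≤ R ↔ c ≤ pick hm wt R := by
      rcases Nat.eq_zero_or_pos (c : ℕ) with h0 | h0
      · have hA0 : A = 0 := Finset.sum_eq_zero fun b _ => if_neg (by rw [Fin.lt_def]; omega)
        simp [hA0, Fin.le_def, h0]
      · have hc := c.2
        have := lt_pick_iff hm wt R ⟨c - 1, by omega⟩ (by dsimp only; omega)
        rw [Fin.lt_def] at this
        rw [Fin.le_def, show (c : ℕ) ≤ pick hm wt R ↔ (c : ℕ) - 1 < pick hm wt R by omega]
        refine Iff.trans ?_ this.symm
        rw [hA]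
        have : ∀ b : Fin m, b < c ↔ b ≤ ⟨c - 1, by omega⟩ := fun b => by
          rw [Fin.lt_def, Fin.le_def]; dsimp only; omega
        simp only [this]
    rw [h1, h2, and_comm]
    exact le_antisymm_iff
  -- the outcome `c` is picked on the interval `[A, A + wt c)`, or `[A, Q)` if it is the last one
  have hcard : (Finset.univ.filter fun R : Fin Q => pick hm wt R = c).card =
      (if (c : ℕ) + 1 < m then min Q (A + wt c) else Q) - A := by
    simp only [hiff]
    rw [Finset.card_filter, ← Finset.sum_range (fun R =>
      if A ≤ R ∧ ((c : ℕ) + 1 < m → R < A + wt c) then 1 else 0), ← Finset.card_filter,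
      ← Nat.card_Ico]
    congr 1
    ext R
    by_cases hc : (c : ℕ) + 1 < m
    · simp [hc]; omega
    · simp [hc]; omega
  rw [hcard, Int.abs_eq_natAbs, Int.abs_eq_natAbs]
  split_ifs with h
  · omega
  · have := hlast h
    omega

/-- The data from which the simulation works: the number `P` of binary digits, the inverse `K` of the
size of the probabilities that count as large, the number `J` of samples, the approximate matrix
entries `a` (scaled by `2 ^ P`), the approximate coefficients `z` (scaled by `2 ^ (P * (n + 1))`), and
the sampler `X` of the state, with its number `bS` of coin flips. -/
structure SimData {n : ℕ} (d : Fin n → ℕ) where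
  pos : ∀ j, 0 < d j
  P : ℕ
  bS : ℕ
  K : ℕ
  J : ℕ
  a : (j : Fin n) → Fin (d j) → Fin (d j) → GaussianInt
  z : BasisLabel d → GaussianInt
  X : Fin (2 ^ bS) → BasisLabel d

/-- Real or imaginary part of a Gaussian integer. -/
def gaussPart (b : Bool) (z : GaussianInt) : ℤ := if b then z.re else z.im

/-- Real or imaginary part of a complex number. -/
def complexPart (b : Bool) (z : ℂ) : ℝ := if b then z.re else z.im

namespace SimData

variable {n : ℕ} {d : Fin n → ℕ} (S : SimData d)

/-- The factor by which statistics are multiplied before rounding to integers. It makes the rounding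
error `1 / M` small in comparison with the accuracy `1 / (4 * K)` of the estimates. -/
def M : ℕ := 32 * S.K

/-- Seeds for one sample: the numbers used to select outcomes are below `2 ^ (2 * P)`, the
denominator of the squared moduli of the approximate matrix entries. -/
abbrev Seed : Type := _root_.Seed n (2 ^ (2 * S.P)) S.bS

/-- The second label of a pair: the letters `j < i` are drawn from the rows `y j` of the matrices `a j`,
the others are those of `x`. -/
def resample (i : ℕ) (y x : BasisLabel d) (R : Fin n → ℕ) : BasisLabel d := fun j =>
  if (j : ℕ) < i then pick (S.pos j) (fun c => (S.a j (y j) c).norm.natAbs) (R j) else x j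

/-- The approximate row kernel. The factor `2 ^ P` in front gives it the same scale
`2 ^ (P * (n + 1))` as the coefficients `z`, so that `ratio` may be applied to numerators. -/
def kernel (i : ℕ) (y x x' : BasisLabel d) : GaussianInt :=
  2 ^ S.P * ∏ j : Fin n,
    if (j : ℕ) < i then S.a j (y j) (x' j) else if x j = x' j then 2 ^ S.P else 0

/-- The statistic whose expectation is `M` times the marginal probability, up to errors. If the
denominator is `0`, so is the quotient, in agreement with the value of `ratio` there. -/
def margVal (i : ℕ) (y x x' : BasisLabel d) : ℤ :=
  S.M * (2 * (star (S.z x * star (S.kernel i y x x')) * (S.z x' * star (S.kernel i y x' x))).re) /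
    ((S.z x * star (S.kernel i y x x')).norm + (S.z x' * star (S.kernel i y x' x)).norm)

/-- The contribution of one label to the statistic for an amplitude. -/
def ampHalf (b : Bool) (v w : GaussianInt) : ℤ := S.M * gaussPart b (v * w) / (v.norm + w.norm)

/-- The statistic whose expectation is `M` times the real or imaginary part of the amplitude, up to
errors: `x` is distributed according to `ψ`, and `x'` according to the row `y` of the tensor product. -/
def ampVal (b : Bool) (y x x' : BasisLabel d) : ℤ :=
  S.ampHalf b (S.kernel n y x' x) (S.z x) + S.ampHalf b (S.kernel n y x x') (S.z x')

/-- The pair of labels sampled from a seed. -/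
def samplePair (i : ℕ) (y : BasisLabel d) (s : S.Seed) : BasisLabel d × BasisLabel d :=
  (S.X s.2, S.resample i y (S.X s.2) fun j => s.1 j)

/-- Sum of the marginal statistic over all samples. -/
def margSum (ω : Fin S.J → S.Seed) (i : ℕ) (y : BasisLabel d) : ℤ :=
  ∑ k, S.margVal i y (S.samplePair i y (ω k)).1 (S.samplePair i y (ω k)).2

/-- Sum of the amplitude statistic over all samples. -/
def ampSum (ω : Fin S.J → S.Seed) (b : Bool) (y : BasisLabel d) : ℤ :=
  ∑ k, S.ampVal b y (S.samplePair n y (ω k)).1 (S.samplePair n y (ω k)).2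

/-! ### Expectations of the statistics -/

/-- The probability that `x'` is obtained by resampling from `x`. -/
noncomputable def transProb (i : ℕ) (y x x' : BasisLabel d) : ℝ :=
  ∏ j : Fin n, (∑ R : Fin (2 ^ (2 * S.P)), if (if (j : ℕ) < i then
    pick (S.pos j) (fun c => (S.a j (y j) c).norm.natAbs) R else x j) = x' j then (1 : ℝ) else 0) /
      2 ^ (2 * S.P)

/-- Expectation of a function of the sampled pair. -/
theorem avg_samplePair (i : ℕ) (y : BasisLabel d) (G : BasisLabel d → BasisLabel d → ℝ) :
    avg (fun s : S.Seed => G (S.samplePair i y s).1 (S.samplePair i y s).2) =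
      ∑ x, ∑ x', coinProb S.bS (fun r => S.X r = x) * S.transProb i y x x' * G x x' := by
  classical
  have h1 : ∀ x x', ∑ R : Fin n → Fin (2 ^ (2 * S.P)),
      (if S.resample i y x (fun j => R j) = x' then (1 : ℝ) else 0) =
      (2 ^ (2 * S.P)) ^ n * S.transProb i y x x' := by
    intro x x'
    have h2 : ∀ R : Fin n → Fin (2 ^ (2 * S.P)),
        (if S.resample i y x (fun j => R j) = x' then (1 : ℝ) else 0) =
        ∏ j : Fin n, if (if (j : ℕ) < i then
          pick (S.pos j) (fun c => (S.a j (y j) c).norm.natAbs) (R j) else x j) = x' j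
          then (1 : ℝ) else 0 := by
      intro R
      rw [Finset.prod_boole]
      congr 1
      simp [funext_iff, resample]
    simp only [h2]
    rw [← Fintype.prod_sum (fun (j : Fin n) (R : Fin (2 ^ (2 * S.P))) => if (if (j : ℕ) < i then
          pick (S.pos j) (fun c => (S.a j (y j) c).norm.natAbs) R else x j) = x' j
          then (1 : ℝ) else 0), transProb, Finset.prod_div_distrib]
    simp
    field_simp
  have h3 : ∀ x, coinProb S.bS (fun r => S.X r = x) =
      (∑ r, if S.X r = x then (1 : ℝ) else 0) / 2 ^ S.bS := by
    intro x
    rw [coinProb, Finset.sum_boole, Nat.card_eq_fintype_card, Fintype.card_subtype]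
  have h4 : ∀ s : S.Seed, G (S.samplePair i y s).1 (S.samplePair i y s).2 =
      ∑ x, ∑ x', (if S.X s.2 = x then (1 : ℝ) else 0) *
        (if S.resample i y x (fun j => s.1 j) = x' then (1 : ℝ) else 0) * G x x' := by
    intro s
    rw [Finset.sum_eq_single (S.X s.2), Finset.sum_eq_single (S.resample i y (S.X s.2) fun j => s.1 j)]
    · simp [samplePair]
    · intro b _ hb; simp [hb.symm]
    · simp
    · intro b _ hb; simp [hb.symm]
    · simp
  have h5 : ∑ s : S.Seed, G (S.samplePair i y s).1 (S.samplePair i y s).2 =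
      ∑ x, ∑ x', (∑ r, if S.X r = x then (1 : ℝ) else 0) *
        ((2 ^ (2 * S.P)) ^ n * S.transProb i y x x') * G x x' := by
    simp only [h4]
    rw [Finset.sum_comm]
    refine Finset.sum_congr rfl fun x _ => ?_
    rw [Finset.sum_comm]
    refine Finset.sum_congr rfl fun x' _ => ?_
    rw [← h1, Fintype.sum_prod_type, Finset.sum_comm, Finset.sum_mul, Finset.sum_mul]
    refine Finset.sum_congr rfl fun r _ => ?_
    rw [Finset.mul_sum, Finset.sum_mul]
  rw [avg, h5, Finset.sum_div]
  refine Finset.sum_congr rfl fun x _ => ?_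
  rw [Finset.sum_div]
  refine Finset.sum_congr rfl fun x' _ => ?_
  rw [h3]
  simp
  field_simp

end SimData

theorem abs_intCast_div_sub_le (p : ℤ) {q : ℤ} (hq : 0 ≤ q) :
    |((p / q : ℤ) : ℝ) - (p : ℝ) / q| ≤ 1 := by
  rcases hq.eq_or_lt with rfl | hq
  · simp
  · have hq' : (0 : ℝ) < q := by exact_mod_cast hq
    have h1 : (p : ℝ) = q * ((p / q : ℤ) : ℝ) + ((p % q : ℤ) : ℝ) := by
      exact_mod_cast (Int.mul_ediv_add_emod p q).symm
    have h2 : (0 : ℝ) ≤ ((p % q : ℤ) : ℝ) := by exact_mod_cast Int.emod_nonneg p hq.ne'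
    have h3 : ((p % q : ℤ) : ℝ) ≤ q := by exact_mod_cast (Int.emod_lt_of_pos p hq).le
    have h4 : ((p / q : ℤ) : ℝ) - (p : ℝ) / q = -(((p % q : ℤ) : ℝ) / q) := by
      rw [eq_neg_iff_add_eq_zero]
      field_simp
      linarith
    rw [h4, abs_neg, abs_of_nonneg (by positivity), div_le_one hq']
    exact h3

theorem gaussNorm_eq_norm_sq (z : GaussianInt) : ((z.norm : ℤ) : ℝ) = ‖(z : ℂ)‖ ^ 2 := by
  rw [GaussianInt.intCast_real_norm, Complex.normSq_eq_norm_sq]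

theorem gaussPart_eq (b : Bool) (z : GaussianInt) : (gaussPart b z : ℝ) = complexPart b z := by
  cases b <;> simp [gaussPart, complexPart]

theorem abs_complexPart_le (b : Bool) (z : ℂ) : |complexPart b z| ≤ ‖z‖ := by
  cases b
  · exact Complex.abs_im_le_norm z
  · exact Complex.abs_re_le_norm z

theorem complexPart_sub (b : Bool) (z w : ℂ) :
    complexPart b (z - w) = complexPart b z - complexPart b w := by
  cases b <;> simp [complexPart]

theorem complexPart_ofReal_mul (b : Bool) (c : ℝ) (z : ℂ) :
    complexPart b (c * z) = c * complexPart b z := by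
  cases b <;> simp [complexPart]

theorem complexPart_sum {α : Type} (b : Bool) (s : Finset α) (f : α → ℂ) :
    complexPart b (∑ x ∈ s, f x) = ∑ x ∈ s, complexPart b (f x) := by
  cases b <;> simp [complexPart]

/-- An integer quotient in terms of the bounded overlap estimator. -/
theorem abs_gauss_div_sub_le (b : Bool) {M : ℕ} (hM : 0 < M) (c : ℤ) (v w : GaussianInt) :
    |((M * (c * gaussPart b (v * w)) / (v.norm + w.norm) : ℤ) : ℝ) / M -
      c * complexPart b (ratio v w)| ≤ 1 / M := by
  have h0 : 0 ≤ v.norm + w.norm := add_nonneg (GaussianInt.norm_nonneg _) (GaussianInt.norm_nonneg _)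
  have h := abs_intCast_div_sub_le (M * (c * gaussPart b (v * w))) h0
  have hM' : (0 : ℝ) < M := by exact_mod_cast hM
  have e : complexPart b (ratio v w) = complexPart b ((v : ℂ) * w) / (‖(v : ℂ)‖ ^ 2 + ‖(w : ℂ)‖ ^ 2) := by
    rw [ratio, div_eq_inv_mul, ← Complex.ofReal_inv, complexPart_ofReal_mul, div_eq_inv_mul]
  push_cast at h
  rw [gaussPart_eq, gaussNorm_eq_norm_sq, gaussNorm_eq_norm_sq, GaussianInt.toComplex_mul] at h
  rw [e, show ∀ A B : ℝ, A / M - B = (A - M * B) / M from fun A B => by field_simp, abs_div,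
    abs_of_pos hM']
  refine div_le_div_of_nonneg_right (le_of_eq_of_le ?_ h) hM'.le
  congr 1
  ring

namespace SimData

variable {n : ℕ} {d : Fin n → ℕ} (S : SimData d)

theorem one_le_card (S : SimData d) : 1 ≤ Fintype.card (BasisLabel d) :=
  Fintype.card_pos_iff.2 ⟨fun j => ⟨0, S.pos j⟩⟩

/-- The data approximate the unitary matrices `u j` and the state `ψ` to precision `2 ^ (-P)`, and
`P` is large enough. -/
structure Accurate (u : (i : Fin n) → Matrix (Fin (d i)) (Fin (d i)) ℂ) (ψ : BasisLabel d → ℂ)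
    (D : ℕ) : Prop where
  unitary : ∀ j, u j ∈ Matrix.unitaryGroup (Fin (d j)) ℂ
  sum_norm_sq : ∑ x, ‖ψ x‖ ^ 2 = 1
  dim_le : ∀ j, d j ≤ D
  a_close : ∀ j b c, ‖u j b c - (S.a j b c : ℂ) / 2 ^ S.P‖ ≤ 1 / 2 ^ S.P
  z_close : ∀ x, ‖ψ x - (S.z x : ℂ) / 2 ^ (S.P * (n + 1))‖ ≤ 1 / 2 ^ S.P
  X_close : ∀ x, |coinProb S.bS (fun r => S.X r = x) - ‖ψ x‖ ^ 2| ≤ 1 / 2 ^ S.P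
  precision : 16 * S.K * (44 + 6 * D) * 2 ^ n * Fintype.card (BasisLabel d) ^ 2 ≤ 2 ^ S.P
  K_pos : 1 ≤ S.K

namespace Accurate

variable {S} {u : (i : Fin n) → Matrix (Fin (d i)) (Fin (d i)) ℂ} {ψ : BasisLabel d → ℂ} {D : ℕ}

theorem norm_le_one (h : S.Accurate u ψ D) (x : BasisLabel d) : ‖ψ x‖ ≤ 1 := by
  have h' := Finset.single_le_sum (f := fun x => ‖ψ x‖ ^ 2) (fun _ _ => by positivity)
    (Finset.mem_univ x)
  rw [h.sum_norm_sq] at h'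
  exact (sq_le_one_iff₀ (norm_nonneg _)).1 h'

/-- All errors together, in the form in which they enter the expectations: an error at each of the pairs
of labels, of which there are `Fintype.card (BasisLabel d) ^ 2`. -/
theorem error_le (h : S.Accurate u ψ D) :
    (44 + 6 * D : ℝ) * 2 ^ n * Fintype.card (BasisLabel d) ^ 2 * (1 / 2 ^ S.P) ≤ 1 / (16 * S.K) := by
  have hK : (0 : ℝ) < S.K := by exact_mod_cast h.K_pos
  have := h.precision
  have h1 : (16 * S.K * (44 + 6 * D) * 2 ^ n * Fintype.card (BasisLabel d) ^ 2 : ℝ) ≤ 2 ^ S.P := by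
    exact_mod_cast this
  rw [mul_one_div, div_le_div_iff₀ (by positivity) (by positivity)]
  linarith

theorem two_pow_mul_error_le (h : S.Accurate u ψ D) : (44 + 6 * D : ℝ) * (2 ^ n * (1 / 2 ^ S.P)) ≤ 1 := by
  have h1 := h.error_le
  have hK : (1 : ℝ) ≤ S.K := by exact_mod_cast h.K_pos
  have hL : (1 : ℝ) ≤ Fintype.card (BasisLabel d) := by exact_mod_cast S.one_le_card
  have h2 : 1 / (16 * (S.K : ℝ)) ≤ 1 := by
    rw [div_le_one (by positivity)]; linarith
  have h3 : (1 : ℝ) ≤ (Fintype.card (BasisLabel d) : ℝ) ^ 2 := one_le_pow₀ hL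
  calc _ = (44 + 6 * D : ℝ) * 2 ^ n * 1 * (1 / 2 ^ S.P) := by ring
    _ ≤ (44 + 6 * D : ℝ) * 2 ^ n * Fintype.card (BasisLabel d) ^ 2 * (1 / 2 ^ S.P) := by gcongr
    _ ≤ _ := h1.trans h2

theorem kernel_close (h : S.Accurate u ψ D) (i : ℕ) (y x x' : BasisLabel d) :
    ‖(S.kernel i y x x' : ℂ) / 2 ^ (S.P * (n + 1)) - rowKernel u i y x x'‖ ≤
      2 ^ n * (1 / 2 ^ S.P) := by
  have e : (S.kernel i y x x' : ℂ) / 2 ^ (S.P * (n + 1)) =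
      ∏ j : Fin n, if (j : ℕ) < i then (S.a j (y j) (x' j) : ℂ) / 2 ^ S.P
        else if x j = x' j then 1 else 0 := by
    have h1 : ∀ j : Fin n, (if (j : ℕ) < i then (S.a j (y j) (x' j) : ℂ) / 2 ^ S.P
        else if x j = x' j then 1 else 0) = (if (j : ℕ) < i then (S.a j (y j) (x' j) : ℂ)
        else if x j = x' j then 2 ^ S.P else 0) / 2 ^ S.P := by
      intro j
      split_ifs <;> simp
    simp only [h1]
    rw [Finset.prod_div_distrib, kernel]
    simp only [map_mul, map_pow, map_prod, apply_ite GaussianInt.toComplex, map_zero, map_ofNat]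
    simp only [Finset.prod_const, Finset.card_univ, Fintype.card_fin]
    rw [mul_add, pow_add, ← pow_mul, mul_one, mul_comm, mul_div_mul_right _ _ (pow_ne_zero _ two_ne_zero)]
  rw [e, rowKernel]
  have := norm_prod_sub_prod_le (Finset.univ : Finset (Fin n))
    (a := fun j => if (j : ℕ) < i then u j (y j) (x' j) else if x j = x' j then 1 else 0)
    (b := fun j => if (j : ℕ) < i then (S.a j (y j) (x' j) : ℂ) / 2 ^ S.P
        else if x j = x' j then 1 else 0) (η := 1 / 2 ^ S.P) (by positivity)
    (by rw [div_le_one (by positivity)]; exact one_le_pow₀ (by norm_num)) (fun j _ => ?_)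
    (fun j _ => ?_)
  · simpa using this
  · split_ifs
    · exact entry_norm_bound_of_unitary (h.unitary j) _ _
    · simp
    · simp
  · split_ifs
    · rw [norm_sub_rev]; exact h.a_close _ _ _
    · simp
    · simp

theorem entry_prob_close (h : S.Accurate u ψ D) (j : Fin n) (b c : Fin (d j)) :
    |((S.a j b c).norm : ℝ) / 2 ^ (2 * S.P) - ‖u j b c‖ ^ 2| ≤ 3 * (1 / 2 ^ S.P) := by
  have h1 := h.a_close j b c
  have h2 := entry_norm_bound_of_unitary (h.unitary j) b c
  have e : ((S.a j b c).norm : ℝ) / 2 ^ (2 * S.P) = ‖(S.a j b c : ℂ) / 2 ^ S.P‖ ^ 2 := by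
    rw [gaussNorm_eq_norm_sq, norm_div, div_pow, norm_pow, ← pow_mul, mul_comm S.P 2]
    simp
  rw [e]
  have h3 := abs_le.1 ((abs_norm_sub_norm_le _ _).trans h1)
  have h4 : (1 : ℝ) / 2 ^ S.P ≤ 1 := by
    rw [div_le_one (by positivity)]; exact one_le_pow₀ (by norm_num)
  set η : ℝ := 1 / 2 ^ S.P
  have h5 := norm_nonneg (u j b c)
  have h6 := norm_nonneg ((S.a j b c : ℂ) / 2 ^ S.P)
  rw [abs_le]
  constructor <;> nlinarith

theorem pick_prob_close (h : S.Accurate u ψ D) (j : Fin n) (b c : Fin (d j)) :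
    |(∑ R : Fin (2 ^ (2 * S.P)), if pick (S.pos j) (fun c => (S.a j b c).norm.natAbs) R = c
      then (1 : ℝ) else 0) / 2 ^ (2 * S.P) - ‖u j b c‖ ^ 2| ≤ (3 * (D + 1) * (1 / 2 ^ S.P) : ℝ) := by
  have h1 := card_pick (S.pos j) (fun c => (S.a j b c).norm.natAbs) (2 ^ (2 * S.P)) c
  rw [Finset.sum_boole]
  set A := (Finset.univ.filter fun R : Fin (2 ^ (2 * S.P)) =>
    pick (S.pos j) (fun c => (S.a j b c).norm.natAbs) R = c).card
  have hQ : (0 : ℝ) < 2 ^ (2 * S.P) := by positivity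
  have h2 : |(A : ℝ) - (S.a j b c).norm| ≤ |∑ c, ((S.a j b c).norm : ℝ) - 2 ^ (2 * S.P)| := by
    rw [Nat.cast_sum] at h1
    simp only [GaussianInt.abs_natCast_norm] at h1
    exact_mod_cast h1
  have h4 : |∑ c, ((S.a j b c).norm : ℝ) - 2 ^ (2 * S.P)| ≤ 2 ^ (2 * S.P) * (3 * D * (1 / 2 ^ S.P)) := by
    have h5 : ∑ c, ((S.a j b c).norm : ℝ) - 2 ^ (2 * S.P) =
        2 ^ (2 * S.P) * ∑ c, (((S.a j b c).norm : ℝ) / 2 ^ (2 * S.P) - ‖u j b c‖ ^ 2) := by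
      rw [Finset.sum_sub_distrib, sum_row_norm_sq_of_unitary (h.unitary j), ← Finset.sum_div]
      field_simp
    rw [h5, abs_mul, abs_of_pos hQ]
    gcongr
    refine (Finset.abs_sum_le_sum_abs _ _).trans
      ((Finset.sum_le_card_nsmul _ _ _ fun c _ => h.entry_prob_close j b c).trans ?_)
    rw [Finset.card_univ, Fintype.card_fin, nsmul_eq_mul]
    have : (d j : ℝ) ≤ D := by exact_mod_cast h.dim_le j
    calc (d j : ℝ) * (3 * (1 / 2 ^ S.P)) ≤ D * (3 * (1 / 2 ^ S.P)) := by gcongr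
      _ = _ := by ring
  have h6 : |(A : ℝ) / 2 ^ (2 * S.P) - (S.a j b c).norm / 2 ^ (2 * S.P)| ≤ 3 * D * (1 / 2 ^ S.P) := by
    rw [← sub_div, abs_div, abs_of_pos hQ, div_le_iff₀ hQ]
    linarith
  calc _ ≤ |(A : ℝ) / 2 ^ (2 * S.P) - (S.a j b c).norm / 2 ^ (2 * S.P)| +
        |((S.a j b c).norm : ℝ) / 2 ^ (2 * S.P) - ‖u j b c‖ ^ 2| := abs_sub_le _ _ _
    _ ≤ 3 * D * (1 / 2 ^ S.P) + 3 * (1 / 2 ^ S.P) := add_le_add h6 (h.entry_prob_close j b c)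
    _ = _ := by ring

theorem transProb_close (h : S.Accurate u ψ D) (i : ℕ) (y x x' : BasisLabel d) :
    |S.transProb i y x x' - ‖rowKernel u i y x x'‖ ^ 2| ≤
      2 ^ n * (3 * (D + 1) * (1 / 2 ^ S.P)) := by
  have hD : (3 * (D + 1) * (1 / 2 ^ S.P) : ℝ) ≤ 1 := by
    refine le_trans ?_ h.two_pow_mul_error_le
    have : (1 : ℝ) ≤ 2 ^ n := one_le_pow₀ (by norm_num)
    calc (3 * (D + 1) * (1 / 2 ^ S.P) : ℝ) ≤ (44 + 6 * D) * (1 * (1 / 2 ^ S.P)) := by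
          rw [one_mul]; gcongr; linarith [(Nat.cast_nonneg D : (0 : ℝ) ≤ D)]
      _ ≤ _ := by gcongr
  have := norm_prod_sub_prod_le (Finset.univ : Finset (Fin n))
    (a := fun j => ((‖if (j : ℕ) < i then u j (y j) (x' j) else if x j = x' j then 1 else 0‖ ^ 2 : ℝ) : ℂ))
    (b := fun j => (((∑ R : Fin (2 ^ (2 * S.P)), if (if (j : ℕ) < i then
      pick (S.pos j) (fun c => (S.a j (y j) c).norm.natAbs) R else x j) = x' j then (1 : ℝ) else 0) /
      2 ^ (2 * S.P) : ℝ) : ℂ)) (η := 3 * (D + 1) * (1 / 2 ^ S.P)) (by positivity) hD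
    (fun j _ => ?_) (fun j _ => ?_)
  · rw [← Complex.ofReal_prod, ← Complex.ofReal_prod, ← Complex.ofReal_sub, Complex.norm_real,
      Real.norm_eq_abs, Finset.card_univ, Fintype.card_fin, Finset.prod_pow, ← norm_prod] at this
    exact this
  · rw [Complex.norm_real, Real.norm_of_nonneg (by positivity)]
    refine pow_le_one₀ (norm_nonneg _) ?_
    split_ifs
    · exact entry_norm_bound_of_unitary (h.unitary j) _ _
    · simp
    · simp
  · rw [← Complex.ofReal_sub, Complex.norm_real, Real.norm_eq_abs]
    by_cases hj : (j : ℕ) < i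
    · simp only [hj, if_true]
      exact h.pick_prob_close j _ _
    · simp only [hj, if_false]
      by_cases hx : x j = x' j
      · simp [hx]; positivity
      · simp [hx]; positivity

/-- The probability of a sampled pair of labels is close to that of the ideal distribution. -/
theorem pairProb_close (h : S.Accurate u ψ D) (i : ℕ) (y x x' : BasisLabel d) :
    |coinProb S.bS (fun r => S.X r = x) * S.transProb i y x x' -
      ‖ψ x‖ ^ 2 * ‖rowKernel u i y x x'‖ ^ 2| ≤ (8 + 6 * D) * (2 ^ n * (1 / 2 ^ S.P)) / 2 := by
  have h1 := h.X_close x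
  have h2 := h.transProb_close i y x x'
  have h3 : ‖rowKernel u i y x x'‖ ^ 2 ≤ 1 :=
    pow_le_one₀ (norm_nonneg _) (norm_rowKernel_le_one h.unitary _ _ _ _)
  have h4 : coinProb S.bS (fun r => S.X r = x) ≤ 1 := by
    rw [coinProb, div_le_one (by positivity), Nat.card_eq_fintype_card]
    have := Fintype.card_subtype_le (fun r => S.X r = x)
    rw [Fintype.card_fin] at this
    exact_mod_cast this
  have h5 : 0 ≤ coinProb S.bS (fun r => S.X r = x) := by rw [coinProb]; positivity
  have h6 : (1 : ℝ) ≤ 2 ^ n := one_le_pow₀ (by norm_num)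
  set p := coinProb S.bS (fun r => S.X r = x)
  set q := ‖rowKernel u i y x x'‖ ^ 2
  calc |p * S.transProb i y x x' - ‖ψ x‖ ^ 2 * q|
      = |p * (S.transProb i y x x' - q) + (p - ‖ψ x‖ ^ 2) * q| := by congr 1; ring
    _ ≤ 1 * (2 ^ n * (3 * (D + 1) * (1 / 2 ^ S.P))) + 1 / 2 ^ S.P * 1 := by
      refine (abs_add_le _ _).trans ?_
      rw [abs_mul, abs_mul, abs_of_nonneg h5, abs_of_nonneg (show 0 ≤ q by positivity)]
      gcongr
    _ ≤ 1 * (2 ^ n * (3 * (D + 1) * (1 / 2 ^ S.P))) + (2 ^ n * (1 / 2 ^ S.P)) * 1 := by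
      gcongr
      exact le_mul_of_one_le_left (by positivity) h6
    _ = _ := by ring

theorem sum_pairProb (h : S.Accurate u ψ D) (i : ℕ) (y : BasisLabel d) :
    ∑ x, ∑ x', ‖ψ x‖ ^ 2 * ‖rowKernel u i y x x'‖ ^ 2 = 1 := by
  simp only [← Finset.mul_sum, sum_rowKernel_norm_sq h.unitary, mul_one, h.sum_norm_sq]

/-- Comparison of the expectation of a computed statistic `G` with that of an ideal one. Where the ideal
probability of a pair vanishes, `G` need not be close to `s`: only the weighted error matters. -/
theorem avg_close (h : S.Accurate u ψ D) (i : ℕ) (y : BasisLabel d) {G s : BasisLabel d → BasisLabel d → ℝ}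
    (hG : ∀ x x', |G x x'| ≤ 2)
    (hs : ∀ x x', ‖ψ x‖ ^ 2 * ‖rowKernel u i y x x'‖ ^ 2 * |G x x' - s x x'| ≤
      ‖ψ x‖ ^ 2 * ‖rowKernel u i y x x'‖ ^ 2 * (1 / (16 * S.K)) + 36 * (2 ^ n * (1 / 2 ^ S.P))) :
    |avg (fun r : S.Seed => G (S.samplePair i y r).1 (S.samplePair i y r).2) -
      ∑ x, ∑ x', ‖ψ x‖ ^ 2 * ‖rowKernel u i y x x'‖ ^ 2 * s x x'| ≤ 1 / (8 * S.K) := by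
  rw [S.avg_samplePair]
  set w : BasisLabel d → BasisLabel d → ℝ := fun x x' => ‖ψ x‖ ^ 2 * ‖rowKernel u i y x x'‖ ^ 2 with hw
  have hw0 : ∀ x x', 0 ≤ w x x' := fun x x' => by positivity
  have h1 : ∀ x x', |coinProb S.bS (fun r => S.X r = x) * S.transProb i y x x' * G x x' -
      w x x' * s x x'| ≤ w x x' * (1 / (16 * S.K)) + (44 + 6 * D) * (2 ^ n * (1 / 2 ^ S.P)) := by
    intro x x'
    have h2 := h.pairProb_close i y x x'
    calc _ = |(coinProb S.bS (fun r => S.X r = x) * S.transProb i y x x' - w x x') * G x x' +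
          w x x' * (G x x' - s x x')| := by congr 1; ring
      _ ≤ (8 + 6 * D) * (2 ^ n * (1 / 2 ^ S.P)) / 2 * 2 +
          (w x x' * (1 / (16 * S.K)) + 36 * (2 ^ n * (1 / 2 ^ S.P))) := by
        refine (abs_add_le _ _).trans (add_le_add ?_ ?_)
        · rw [abs_mul]
          exact mul_le_mul h2 (hG x x') (abs_nonneg _) (by positivity)
        · rw [abs_mul, abs_of_nonneg (hw0 x x')]
          exact hs x x'
      _ = _ := by ring
  calc _ ≤ ∑ x, ∑ x', (w x x' * (1 / (16 * S.K)) + (44 + 6 * D) * (2 ^ n * (1 / 2 ^ S.P))) := by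
        rw [← Finset.sum_sub_distrib]
        refine (Finset.abs_sum_le_sum_abs _ _).trans (Finset.sum_le_sum fun x _ => ?_)
        rw [← Finset.sum_sub_distrib]
        exact (Finset.abs_sum_le_sum_abs _ _).trans (Finset.sum_le_sum fun x' _ => h1 x x')
    _ = 1 / (16 * S.K) + (44 + 6 * D : ℝ) * 2 ^ n * Fintype.card (BasisLabel d) ^ 2 * (1 / 2 ^ S.P) := by
        simp only [Finset.sum_add_distrib, ← Finset.sum_mul, hw, h.sum_pairProb i y, one_mul]
        simp only [Finset.sum_const, Finset.card_univ, nsmul_eq_mul]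
        ring
    _ ≤ 1 / (16 * S.K) + 1 / (16 * S.K) := by gcongr; exact h.error_le
    _ = _ := by field_simp; norm_num

end Accurate

end SimData

namespace SimData

variable {n : ℕ} {d : Fin n → ℕ} (S : SimData d)

/-- All empirical means are close to the quantities that they estimate. -/
structure Good (u : (i : Fin n) → Matrix (Fin (d i)) (Fin (d i)) ℂ) (ψ : BasisLabel d → ℂ)
    (ω : Fin S.J → S.Seed) : Prop where
  marg : ∀ i ≤ n, ∀ y, |(S.margSum ω i y : ℝ) / (S.J * S.M) - marginal u ψ i y| ≤ 1 / (4 * S.K)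
  amp : ∀ b y, |(S.ampSum ω b y : ℝ) / (S.J * S.M) - complexPart b (outAmp u ψ y)| ≤ 1 / (4 * S.K)

namespace Accurate

variable {S} {u : (i : Fin n) → Matrix (Fin (d i)) (Fin (d i)) ℂ} {ψ : BasisLabel d → ℂ} {D : ℕ}

theorem M_pos (h : S.Accurate u ψ D) : 0 < S.M := by
  have := h.K_pos
  simp only [M]; omega

theorem one_div_M (h : S.Accurate u ψ D) : (1 : ℝ) / S.M = 1 / (32 * S.K) ∧ (1 : ℝ) / S.M ≤ 1 / 32 := by
  have hK : (1 : ℝ) ≤ S.K := by exact_mod_cast h.K_pos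
  have e : (S.M : ℝ) = 32 * S.K := by simp [M]
  refine ⟨by rw [e], ?_⟩
  rw [e]
  exact one_div_le_one_div_of_le (by norm_num) (by linarith)

theorem error_le_one (h : S.Accurate u ψ D) : (3 * (2 ^ n * (1 / 2 ^ S.P)) : ℝ) ≤ 1 := by
  refine le_trans ?_ h.two_pow_mul_error_le
  gcongr
  linarith [(Nat.cast_nonneg D : (0 : ℝ) ≤ D)]

theorem z_close' (h : S.Accurate u ψ D) (x : BasisLabel d) :
    ‖(S.z x : ℂ) / 2 ^ (S.P * (n + 1)) - ψ x‖ ≤ 2 ^ n * (1 / 2 ^ S.P) := by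
  rw [norm_sub_rev]
  exact (h.z_close x).trans (le_mul_of_one_le_left (by positivity) (one_le_pow₀ (by norm_num)))

/-- The computed products approximate the vector, on two copies of the system, of `marginal_eq_sum`. -/
theorem product_close (h : S.Accurate u ψ D) (i : ℕ) (y x x' : BasisLabel d) :
    ‖((S.z x * star (S.kernel i y x x') : GaussianInt) : ℂ) / 2 ^ (2 * (S.P * (n + 1))) -
      ψ x * conj (rowKernel u i y x x')‖ ≤ 3 * (2 ^ n * (1 / 2 ^ S.P)) := by
  have h1 := h.kernel_close i y x x'
  have h2 := h.z_close' x
  have h3 := h.error_le_one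
  have h4 := h.norm_le_one x
  have h5 := norm_rowKernel_le_one h.unitary i y x x'
  set τ : ℝ := 2 ^ n * (1 / 2 ^ S.P) with hτ
  set A : ℂ := (S.z x : ℂ) / 2 ^ (S.P * (n + 1))
  set V : ℂ := (S.kernel i y x x' : ℂ) / 2 ^ (S.P * (n + 1)) with hV
  have e : ((S.z x * star (S.kernel i y x x') : GaussianInt) : ℂ) / 2 ^ (2 * (S.P * (n + 1))) =
      A * conj V := by
    rw [GaussianInt.toComplex_mul, GaussianInt.toComplex_star, hV, map_div₀, map_pow,
      Complex.conj_ofNat, div_mul_div_comm, ← pow_add, two_mul]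
  have hA : ‖A‖ ≤ 1 + τ := by
    have := norm_add_le (ψ x) (A - ψ x); rw [add_sub_cancel] at this; linarith
  have hτ0 : 0 ≤ τ := by positivity
  rw [e]
  calc _ = ‖A * conj (V - rowKernel u i y x x') + (A - ψ x) * conj (rowKernel u i y x x')‖ := by
        congr 1; rw [map_sub]; ring
    _ ≤ (1 + τ) * τ + τ * 1 := by
        refine (norm_add_le _ _).trans ?_
        rw [norm_mul, norm_mul, RCLike.norm_conj, RCLike.norm_conj]
        gcongr
    _ ≤ 3 * τ := by nlinarith

theorem margVal_close (h : S.Accurate u ψ D) (i : ℕ) (y x x' : BasisLabel d) :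
    |(S.margVal i y x x' : ℝ) / S.M - 2 * (ratio
      (((star (S.z x * star (S.kernel i y x x')) : GaussianInt) : ℂ))
      (S.z x' * star (S.kernel i y x' x) : GaussianInt)).re| ≤ 1 / S.M := by
  have := abs_gauss_div_sub_le true h.M_pos 2 (star (S.z x * star (S.kernel i y x x')))
    (S.z x' * star (S.kernel i y x' x))
  simpa only [margVal, gaussPart, complexPart, if_true, Zsqrtd.norm_conj, Int.cast_ofNat] using this

theorem abs_margVal_le (h : S.Accurate u ψ D) (i : ℕ) (y x x' : BasisLabel d) :
    |(S.margVal i y x x' : ℝ) / S.M| ≤ 2 := by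
  have h1 := h.margVal_close i y x x'
  have h2 := (Complex.abs_re_le_norm _).trans (norm_ratio_le
    (((star (S.z x * star (S.kernel i y x x')) : GaussianInt) : ℂ))
      (S.z x' * star (S.kernel i y x' x) : GaussianInt))
  have h3 := h.one_div_M.2
  rw [abs_le] at *
  constructor <;> linarith

/-- The marginal statistic has the right expectation. -/
theorem avg_marg_close (h : S.Accurate u ψ D) (i : ℕ) (y : BasisLabel d) :
    |avg (fun r : S.Seed =>
      (S.margVal i y (S.samplePair i y r).1 (S.samplePair i y r).2 : ℝ) / S.M) -
      marginal u ψ i y| ≤ 1 / (8 * S.K) := by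
  set F : BasisLabel d → BasisLabel d → ℂ := fun x x' => ψ x * conj (rowKernel u i y x x') with hF
  have hF1 : ∀ x x', ‖F x x'‖ ≤ 1 := fun x x' => by
    rw [hF, norm_mul, RCLike.norm_conj]
    exact mul_le_one₀ (h.norm_le_one x) (norm_nonneg _) (norm_rowKernel_le_one h.unitary i y x x')
  have hw : ∀ x x', ‖ψ x‖ ^ 2 * ‖rowKernel u i y x x'‖ ^ 2 = ‖F x x'‖ ^ 2 := fun x x' => by
    rw [hF, norm_mul, RCLike.norm_conj, mul_pow]
  have key : ∑ x, ∑ x', ‖ψ x‖ ^ 2 * ‖rowKernel u i y x x'‖ ^ 2 *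
      (2 * (ratio (conj (F x x')) (F x' x)).re) = marginal u ψ i y := by
    -- exchanging the two labels turns one of the two densities into the other
    have h1 : ∑ x, ∑ x', ‖F x x'‖ ^ 2 * (ratio (conj (F x x')) (F x' x)).re =
        ∑ x, ∑ x', ‖F x' x‖ ^ 2 * (ratio (conj (F x x')) (F x' x)).re := by
      rw [Finset.sum_comm]
      exact Finset.sum_congr rfl fun x _ => Finset.sum_congr rfl fun x' _ => by rw [ratio_conj_re_symm]
    have h2 : (marginal u ψ i y : ℝ) = ∑ x, ∑ x', (‖F x x'‖ ^ 2 + ‖F x' x‖ ^ 2) *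
        (ratio (conj (F x x')) (F x' x)).re := by
      have := congrArg Complex.re (marginal_eq_sum h.unitary ψ i y)
      rw [Complex.ofReal_re] at this
      rw [this, Complex.re_sum]
      refine Finset.sum_congr rfl fun x _ => ?_
      rw [Complex.re_sum]
      refine Finset.sum_congr rfl fun x' _ => ?_
      rw [← Complex.re_ofReal_mul, ← RCLike.norm_conj (F x x'), mul_ratio]
    rw [h2]
    simp only [hw, add_mul, Finset.sum_add_distrib, ← h1]
    simp only [← Finset.sum_add_distrib]
    exact Finset.sum_congr rfl fun x _ => Finset.sum_congr rfl fun x' _ => by ring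
  rw [← key]
  refine h.avg_close i y (G := fun x x' => (S.margVal i y x x' : ℝ) / S.M)
    (s := fun x x' => 2 * (ratio (conj (F x x')) (F x' x)).re) (h.abs_margVal_le i y) fun x x' => ?_
  rw [hw]
  -- `ratio` is invariant under scaling, so integers may be replaced by the numbers they approximate
  have hscale : ratio (((star (S.z x * star (S.kernel i y x x')) : GaussianInt) : ℂ))
      (S.z x' * star (S.kernel i y x' x) : GaussianInt) =
      ratio (conj (((S.z x * star (S.kernel i y x x') : GaussianInt) : ℂ) / 2 ^ (2 * (S.P * (n + 1)))))
      (((S.z x' * star (S.kernel i y x' x) : GaussianInt) : ℂ) / 2 ^ (2 * (S.P * (n + 1)))) := by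
    have hc : ((2 : ℝ) ^ (2 * (S.P * (n + 1))))⁻¹ ≠ 0 := by positivity
    rw [GaussianInt.toComplex_star, ← ratio_smul hc]
    simp only [map_mul, map_inv₀, map_pow, Complex.conj_ofNat, div_eq_inv_mul, Complex.ofReal_inv,
      Complex.ofReal_pow, Complex.ofReal_ofNat]
  have h3 := mul_norm_ratio_sub_le (f := conj (F x x')) (g := F x' x)
    (f' := conj (((S.z x * star (S.kernel i y x x') : GaussianInt) : ℂ) / 2 ^ (2 * (S.P * (n + 1)))))
    (g' := ((S.z x' * star (S.kernel i y x' x) : GaussianInt) : ℂ) / 2 ^ (2 * (S.P * (n + 1))))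
    h.error_le_one (by rw [RCLike.norm_conj]; exact hF1 _ _) (hF1 _ _)
    (by rw [← map_sub, RCLike.norm_conj]; exact h.product_close i y x x')
    (h.product_close i y x' x)
  rw [← hscale, RCLike.norm_conj] at h3
  have h4 := h.margVal_close i y x x'
  set r' := ratio (((star (S.z x * star (S.kernel i y x x')) : GaussianInt) : ℂ))
      (S.z x' * star (S.kernel i y x' x) : GaussianInt)
  set r := ratio (conj (F x x')) (F x' x)
  have h5 : |2 * r'.re - 2 * r.re| ≤ 2 * ‖r' - r‖ := by
    rw [← mul_sub, abs_mul, abs_two, ← Complex.sub_re]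
    gcongr
    exact Complex.abs_re_le_norm _
  have h6 := abs_sub_le ((S.margVal i y x x' : ℝ) / S.M) (2 * r'.re) (2 * r.re)
  have h7 : (1 : ℝ) / S.M ≤ 1 / (16 * S.K) := by
    have hK : (0 : ℝ) < S.K := by exact_mod_cast h.K_pos
    rw [h.one_div_M.1]
    exact one_div_le_one_div_of_le (by positivity) (by linarith)
  have h8 : (0 : ℝ) ≤ ‖F x x'‖ ^ 2 := by positivity
  have h9 : ‖F x x'‖ ^ 2 * ‖r' - r‖ ≤ (‖F x x'‖ ^ 2 + ‖F x' x‖ ^ 2) * ‖r' - r‖ := by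
    gcongr
    exact le_add_of_nonneg_right (by positivity)
  calc _ ≤ ‖F x x'‖ ^ 2 * (1 / (16 * S.K) + 2 * ‖r' - r‖) := by
        gcongr
        linarith
    _ = ‖F x x'‖ ^ 2 * (1 / (16 * S.K)) + 2 * (‖F x x'‖ ^ 2 * ‖r' - r‖) := by ring
    _ ≤ _ := by linarith

theorem ampHalf_close (h : S.Accurate u ψ D) (b : Bool) (v w : GaussianInt) :
    |(S.ampHalf b v w : ℝ) / S.M - complexPart b (ratio v w)| ≤ 1 / S.M := by
  simpa only [ampHalf, one_mul, Int.cast_one] using abs_gauss_div_sub_le b h.M_pos 1 v w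

theorem ampHalf_perturb (h : S.Accurate u ψ D) (b : Bool) (y x x' : BasisLabel d) {q : ℝ}
    (hq : q ≤ ‖rowKernel u n y x' x‖ ^ 2 + ‖ψ x‖ ^ 2) (hq0 : 0 ≤ q) :
    q * |(S.ampHalf b (S.kernel n y x' x) (S.z x) : ℝ) / S.M -
      complexPart b (ratio (rowKernel u n y x' x) (ψ x))| ≤
      q * (1 / (32 * S.K)) + 18 * (2 ^ n * (1 / 2 ^ S.P)) := by
  have h1 := h.ampHalf_close b (S.kernel n y x' x) (S.z x)
  rw [h.one_div_M.1] at h1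
  have hc : ((2 : ℝ) ^ (S.P * (n + 1)))⁻¹ ≠ 0 := by positivity
  have hτ : (0 : ℝ) ≤ 2 ^ n * (1 / 2 ^ S.P) := by positivity
  have h2 := mul_norm_ratio_sub_le (by linarith [h.error_le_one])
    (norm_rowKernel_le_one h.unitary n y x' x) (h.norm_le_one x) (h.kernel_close n y x' x) (h.z_close' x)
  have hscale : ratio (S.kernel n y x' x : ℂ) (S.z x) =
      ratio ((S.kernel n y x' x : ℂ) / 2 ^ (S.P * (n + 1))) ((S.z x : ℂ) / 2 ^ (S.P * (n + 1))) := by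
    rw [← ratio_smul hc]
    simp only [div_eq_inv_mul, Complex.ofReal_inv, Complex.ofReal_pow, Complex.ofReal_ofNat]
  rw [← hscale] at h2
  set r' := ratio (S.kernel n y x' x : ℂ) (S.z x)
  set r := ratio (rowKernel u n y x' x) (ψ x)
  have h5 : |complexPart b r' - complexPart b r| ≤ ‖r' - r‖ := by
    rw [← complexPart_sub]; exact abs_complexPart_le _ _
  have h6 := abs_sub_le ((S.ampHalf b (S.kernel n y x' x) (S.z x) : ℝ) / S.M) (complexPart b r')
    (complexPart b r)
  calc _ ≤ q * (1 / (32 * S.K) + ‖r' - r‖) := by gcongr; linarith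
    _ = q * (1 / (32 * S.K)) + q * ‖r' - r‖ := by ring
    _ ≤ q * (1 / (32 * S.K)) + (‖rowKernel u n y x' x‖ ^ 2 + ‖ψ x‖ ^ 2) * ‖r' - r‖ := by gcongr
    _ ≤ _ := by linarith

theorem abs_ampVal_le (h : S.Accurate u ψ D) (b : Bool) (y x x' : BasisLabel d) :
    |(S.ampVal b y x x' : ℝ) / S.M| ≤ 2 := by
  have h1 := h.ampHalf_close b (S.kernel n y x' x) (S.z x)
  have h1' := h.ampHalf_close b (S.kernel n y x x') (S.z x')
  have h2 := (abs_complexPart_le b _).trans (norm_ratio_le (S.kernel n y x' x : ℂ) (S.z x))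
  have h2' := (abs_complexPart_le b _).trans (norm_ratio_le (S.kernel n y x x' : ℂ) (S.z x'))
  have h3 := h.one_div_M.2
  rw [ampVal, Int.cast_add, add_div]
  rw [abs_le] at *
  constructor <;> linarith

/-- The amplitude statistic has the right expectation. -/
theorem avg_amp_close (h : S.Accurate u ψ D) (b : Bool) (y : BasisLabel d) :
    |avg (fun r : S.Seed =>
      (S.ampVal b y (S.samplePair n y r).1 (S.samplePair n y r).2 : ℝ) / S.M) -
      complexPart b (outAmp u ψ y)| ≤ 1 / (8 * S.K) := by
  set v : BasisLabel d → ℂ := fun x => ∏ j, u j (y j) (x j) with hv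
  have hker : ∀ x x', rowKernel u n y x x' = v x' := fun x x' => by
    rw [rowKernel]
    exact Finset.prod_congr rfl fun j _ => if_pos j.2
  have hv2 : ∑ x, ‖v x‖ ^ 2 = 1 := by
    have := sum_rowKernel_norm_sq h.unitary n y fun j => ⟨0, S.pos j⟩
    simpa only [hker] using this
  have hv1 : ∀ x, ‖v x‖ ≤ 1 := fun x => by
    rw [← hker x x]; exact norm_rowKernel_le_one h.unitary _ _ _ _
  have key : ∑ x, ∑ x', ‖ψ x‖ ^ 2 * ‖rowKernel u n y x x'‖ ^ 2 *
      (complexPart b (ratio (v x) (ψ x)) + complexPart b (ratio (v x') (ψ x'))) =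
      complexPart b (outAmp u ψ y) := by
    have h1 : ∑ x, ∑ x', ‖ψ x‖ ^ 2 * ‖v x'‖ ^ 2 * complexPart b (ratio (v x) (ψ x)) =
        ∑ x, ‖ψ x‖ ^ 2 * complexPart b (ratio (v x) (ψ x)) := by
      refine Finset.sum_congr rfl fun x _ => ?_
      rw [← Finset.sum_mul, ← Finset.mul_sum, hv2, mul_one]
    have h2 : ∑ x, ∑ x', ‖ψ x‖ ^ 2 * ‖v x'‖ ^ 2 * complexPart b (ratio (v x') (ψ x')) =
        ∑ x, ‖v x‖ ^ 2 * complexPart b (ratio (v x) (ψ x)) := by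
      rw [Finset.sum_comm]
      refine Finset.sum_congr rfl fun x _ => ?_
      rw [← Finset.sum_mul, ← Finset.sum_mul, h.sum_norm_sq, one_mul]
    simp only [hker, mul_add, Finset.sum_add_distrib]
    rw [h1, h2, ← Finset.sum_add_distrib, outAmp, complexPart_sum]
    refine Finset.sum_congr rfl fun x _ => ?_
    rw [← add_mul, add_comm, ← complexPart_ofReal_mul, mul_ratio]
  rw [← key]
  refine h.avg_close n y (G := fun x x' => (S.ampVal b y x x' : ℝ) / S.M)
    (s := fun x x' => complexPart b (ratio (v x) (ψ x)) + complexPart b (ratio (v x') (ψ x')))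
    (h.abs_ampVal_le b y) fun x x' => ?_
  -- the probability of a pair is at most that of each of its labels, hence at most either density
  have h1 := h.ampHalf_perturb b y x x' (q := ‖ψ x‖ ^ 2 * ‖v x'‖ ^ 2) (by
    have : ‖v x'‖ ^ 2 ≤ 1 := pow_le_one₀ (norm_nonneg _) (hv1 _)
    have h3 : 0 ≤ ‖ψ x‖ ^ 2 := by positivity
    have h4 : 0 ≤ ‖rowKernel u n y x' x‖ ^ 2 := by positivity
    nlinarith) (by positivity)
  have h2 := h.ampHalf_perturb b y x' x (q := ‖ψ x‖ ^ 2 * ‖v x'‖ ^ 2) (by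
    have : ‖ψ x‖ ^ 2 ≤ 1 := pow_le_one₀ (norm_nonneg _) (h.norm_le_one _)
    have h3 : 0 ≤ ‖v x'‖ ^ 2 := by positivity
    have h4 : 0 ≤ ‖ψ x'‖ ^ 2 := by positivity
    rw [hker]
    nlinarith) (by positivity)
  simp only [hker] at h1 h2 ⊢
  set q := ‖ψ x‖ ^ 2 * ‖v x'‖ ^ 2
  have hq : 0 ≤ q := by positivity
  have h3 : |(S.ampVal b y x x' : ℝ) / S.M -
      (complexPart b (ratio (v x) (ψ x)) + complexPart b (ratio (v x') (ψ x')))| ≤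
      |(S.ampHalf b (S.kernel n y x' x) (S.z x) : ℝ) / S.M - complexPart b (ratio (v x) (ψ x))| +
      |(S.ampHalf b (S.kernel n y x x') (S.z x') : ℝ) / S.M - complexPart b (ratio (v x') (ψ x'))| := by
    refine le_of_eq_of_le ?_ (abs_add_le _ _)
    rw [ampVal, Int.cast_add]
    congr 1
    ring
  have hK : (0 : ℝ) < S.K := by exact_mod_cast h.K_pos
  have h5 : (1 : ℝ) / (32 * S.K) + 1 / (32 * S.K) = 1 / (16 * S.K) := by field_simp; norm_num
  calc _ ≤ _ := mul_le_mul_of_nonneg_left h3 hq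
    _ ≤ q * (1 / (32 * S.K) + 1 / (32 * S.K)) + 36 * (2 ^ n * (1 / 2 ^ S.P)) := by
      rw [mul_add]; linarith
    _ = _ := by rw [h5]

/-- With high probability all empirical means are close to the estimated quantities. -/
theorem card_good_ge (h : S.Accurate u ψ D) (hJ : 0 < S.J) {δ : ℝ}
    (hδ : 2 * ((n + 3) * Fintype.card (BasisLabel d) : ℕ) *
      Real.exp (-(S.J * (1 / (8 * S.K)) ^ 2 / 64)) ≤ δ) :
    1 - δ ≤ (Nat.card {ω : Fin S.J → S.Seed // S.Good u ψ ω} : ℝ) /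
      Fintype.card (Fin S.J → S.Seed) := by
  have : Nonempty S.Seed := ⟨(fun _ => ⟨0, by positivity⟩, ⟨0, by positivity⟩)⟩
  have hK : (1 : ℝ) ≤ S.K := by exact_mod_cast h.K_pos
  have hMne : (S.M : ℝ) ≠ 0 := by exact_mod_cast h.M_pos.ne'
  have hJne : (S.J : ℝ) ≠ 0 := by exact_mod_cast hJ.ne'
  let g : (Fin (n + 1) × BasisLabel d) ⊕ (Bool × BasisLabel d) → S.Seed → ℝ := fun k r =>
    match k with
    | .inl (i, y) => (S.margVal i y (S.samplePair i y r).1 (S.samplePair i y r).2 : ℝ) / S.M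
    | .inr (b, y) => (S.ampVal b y (S.samplePair n y r).1 (S.samplePair n y r).2 : ℝ) / S.M
  have hg : ∀ k r, |g k r| ≤ 2 := by
    rintro (⟨i, y⟩ | ⟨b, y⟩) r
    · exact h.abs_margVal_le _ _ _ _
    · exact h.abs_ampVal_le _ _ _ _
  have h1 := card_all_close_ge hg hJ (η := 1 / (8 * S.K)) (δ := δ) (by positivity)
    (by rw [div_le_one (by positivity)]; linarith) (by
      refine le_trans (le_of_eq ?_) hδ
      congr 3
      simp only [Fintype.card_sum, Fintype.card_prod, Fintype.card_fin, Fintype.card_bool]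
      ring)
  refine h1.trans (div_le_div_of_nonneg_right (Nat.cast_le.2 ?_) (by positivity))
  refine Nat.card_le_card_of_injective (fun ω => ⟨ω.1, ?_⟩) fun ω ω' hω =>
    Subtype.ext (congrArg (fun x : {ω // S.Good u ψ ω} => x.1) hω)
  have e8 : (1 : ℝ) / (8 * S.K) + 1 / (8 * S.K) = 1 / (4 * S.K) := by field_simp; norm_num
  refine ⟨fun i hi y => ?_, fun b y => ?_⟩
  · have h2 := ω.2 (.inl (⟨i, by omega⟩, y))
    have h3 := h.avg_marg_close i y
    have e : (S.margSum ω.1 i y : ℝ) / (S.J * S.M) =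
        (∑ j, g (.inl (⟨i, by omega⟩, y)) (ω.1 j)) / S.J := by
      simp only [g, margSum, Int.cast_sum, ← Finset.sum_div]
      field_simp
    rw [e, ← e8]
    exact (abs_sub_le _ _ _).trans (add_le_add h2 h3)
  · have h2 := ω.2 (.inr (b, y))
    have h3 := h.avg_amp_close b y
    have e : (S.ampSum ω.1 b y : ℝ) / (S.J * S.M) = (∑ j, g (.inr (b, y)) (ω.1 j)) / S.J := by
      simp only [g, ampSum, Int.cast_sum, ← Finset.sum_div]
      field_simp
    rw [e, ← e8]
    exact (abs_sub_le _ _ _).trans (add_le_add h2 h3)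

end Accurate

end SimData

/-! ### Exact normalization by stereographic projection -/

section Stereographic

variable {s : ℕ}

/-- The real part of the first entry, which is the coordinate of the pole. -/
def poleCoord (w : Fin s → GaussianInt) : ℤ := if h : 0 < s then (w ⟨0, h⟩).re else 0

/-- The sum of the squares of all coordinates but the one of the pole. -/
def restSq (w : Fin s → GaussianInt) : ℤ := ∑ k, (w k).norm - poleCoord w ^ 2

/-- The common denominator of the normalized vector. -/
def stereoDen (w : Fin s → GaussianInt) (R : ℕ) : ℤ := (R + |poleCoord w|) ^ 2 + restSq w

/-- The numerators of the rational unit vector that replaces `w / R`. The vector with the pole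
coordinate removed, divided by `R + |poleCoord w|`, is mapped to the unit sphere by the inverse of the
stereographic projection from the pole opposite to `w`. If `w / R` is a unit vector, it is unchanged. -/
def stereoNum (w : Fin s → GaussianInt) (R : ℕ) (k : Fin s) : ℤ × ℤ :=
  (if (k : ℕ) = 0 then
      (if 0 ≤ poleCoord w then 1 else -1) * ((R + |poleCoord w|) ^ 2 - restSq w)
    else 2 * (R + |poleCoord w|) * (w k).re,
    2 * (R + |poleCoord w|) * (w k).im)

theorem restSq_nonneg (w : Fin s → GaussianInt) : 0 ≤ restSq w := by
  rcases s with _ | s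
  · simp [restSq, poleCoord]
  · rw [restSq, Fin.sum_univ_succ, poleCoord, dif_pos (Nat.succ_pos s), Zsqrtd.norm_def]
    have : 0 ≤ ∑ k : Fin s, (w k.succ).norm := Finset.sum_nonneg fun _ _ => GaussianInt.norm_nonneg _
    have h0 : (⟨0, Nat.succ_pos s⟩ : Fin (s + 1)) = 0 := rfl
    rw [h0]
    nlinarith [sq_nonneg (w 0).im]

theorem sum_stereoNum_sq (w : Fin s → GaussianInt) (R : ℕ) (hs : 0 < s) :
    ∑ k, ((stereoNum w R k).1 ^ 2 + (stereoNum w R k).2 ^ 2) = stereoDen w R ^ 2 := by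
  obtain ⟨s, rfl⟩ : ∃ s', s = s' + 1 := ⟨s - 1, by omega⟩
  have hsq : (if 0 ≤ poleCoord w then (1 : ℤ) else -1) ^ 2 = 1 := by split_ifs <;> norm_num
  have hW : restSq w = (w 0).im ^ 2 + ∑ k : Fin s, (w k.succ).norm := by
    rw [restSq, Fin.sum_univ_succ, poleCoord, dif_pos hs, Zsqrtd.norm_def]
    have h0 : (⟨0, hs⟩ : Fin (s + 1)) = 0 := rfl
    rw [h0]
    ring
  have h1 : ∑ k : Fin s, ((stereoNum w R k.succ).1 ^ 2 + (stereoNum w R k.succ).2 ^ 2) =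
      (2 * (R + |poleCoord w|)) ^ 2 * ∑ k : Fin s, (w k.succ).norm := by
    rw [Finset.mul_sum]
    refine Finset.sum_congr rfl fun k _ => ?_
    simp only [stereoNum, Fin.val_succ, Nat.succ_ne_zero, if_false, Zsqrtd.norm_def]
    ring
  rw [Fin.sum_univ_succ, h1]
  simp only [stereoNum, Fin.val_zero, if_true, mul_pow, hsq, stereoDen]
  rw [show ∑ k : Fin s, (w k.succ).norm = restSq w - (w 0).im ^ 2 by rw [hW]; ring]
  ring

/-- The rational unit vector is about as close to `w / R` as the length of the latter is to `1`. -/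
theorem sum_stereo_sub_le (w : Fin s → GaussianInt) {R : ℕ} (hR : 0 < R) (hs : 0 < s) :
    ∑ k, ‖((stereoNum w R k).1 + (stereoNum w R k).2 * Complex.I : ℂ) / stereoDen w R -
      (w k : ℂ) / R‖ ^ 2 ≤ 2 * (√(∑ k, ‖(w k : ℂ) / R‖ ^ 2) - 1) ^ 2 := by
  obtain ⟨s, rfl⟩ : ∃ s', s = s' + 1 := ⟨s - 1, by omega⟩
  set c : ℝ := ((poleCoord w : ℤ) : ℝ) with hc
  set W : ℝ := ((restSq w : ℤ) : ℝ) with hW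
  set T : ℝ := ∑ k, ((w k).norm : ℝ) with hT
  have hW0 : 0 ≤ W := by rw [hW]; exact_mod_cast restSq_nonneg w
  have hWT : W = T - c ^ 2 := by simp [hW, hT, hc, restSq]
  have hT0 : 0 ≤ T := by nlinarith [sq_nonneg c]
  have hR' : (0 : ℝ) < R := by exact_mod_cast hR
  set q : ℝ := R + |c| with hq
  have hqpos : 0 < q := by positivity
  set den : ℝ := q ^ 2 + W with hden
  have hdpos : 0 < den := by positivity
  have hden' : ((stereoDen w R : ℤ) : ℝ) = den := by
    simp [stereoDen, hden, hq, hc, hW]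
  have hdenR : den = R ^ 2 + 2 * R * |c| + T := by
    rw [hden, hq, hWT]; nlinarith [sq_abs c]
  have hdenC : (stereoDen w R : ℂ) = (den : ℂ) := by rw [← hden']; simp
  have hqC : (((R : ℤ) + |poleCoord w| : ℤ) : ℂ) = (q : ℂ) := by
    have : (((R : ℤ) + |poleCoord w| : ℤ) : ℝ) = q := by simp [hq, hc]
    rw [← this, Complex.ofReal_intCast]
  -- the new entries differ from those of `w / R` by `l` times the entries of `w`, where the real part
  -- of the pole entry is replaced by `± q`
  set l : ℝ := (R ^ 2 - T) / (den * R) with hl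
  have hl2 : 2 * q / den - 1 / R = l := by
    rw [hl, div_sub_div _ _ hdpos.ne' hR'.ne']
    congr 1
    rw [hdenR, hq]; ring
  have hent : ∀ k : Fin s, ‖((stereoNum w R k.succ).1 + (stereoNum w R k.succ).2 * Complex.I : ℂ) /
      stereoDen w R - (w k.succ : ℂ) / R‖ ^ 2 = l ^ 2 * (w k.succ).norm := by
    intro k
    have e : ((stereoNum w R k.succ).1 + (stereoNum w R k.succ).2 * Complex.I : ℂ) /
      stereoDen w R - (w k.succ : ℂ) / R = (l : ℂ) * (w k.succ : ℂ) := by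
      rw [← hl2, hdenC]
      simp only [stereoNum, Fin.val_succ, Nat.succ_ne_zero, if_false, GaussianInt.toComplex_def,
        Int.cast_mul, Int.cast_ofNat, hqC]
      push_cast
      ring
    rw [e, norm_mul, mul_pow, ← gaussNorm_eq_norm_sq, Complex.norm_real, Real.norm_eq_abs, sq_abs]
  have h0 : (⟨0, hs⟩ : Fin (s + 1)) = 0 := rfl
  have hc0 : poleCoord w = (w 0).re := by rw [poleCoord, dif_pos hs, h0]
  have hpole : ‖((stereoNum w R 0).1 + (stereoNum w R 0).2 * Complex.I : ℂ) /
      stereoDen w R - (w 0 : ℂ) / R‖ ^ 2 = l ^ 2 * (q ^ 2 + ((w 0).im : ℝ) ^ 2) := by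
    set σ : ℝ := if 0 ≤ poleCoord w then 1 else -1 with hσ
    have hσ2 : σ ^ 2 = 1 := by rw [hσ]; split_ifs <;> norm_num
    have hσc : σ * |c| = c := by
      rw [hσ]
      split_ifs with h
      · rw [one_mul, abs_of_nonneg (by rw [hc]; exact_mod_cast h)]
      · rw [abs_of_neg (by rw [hc]; exact_mod_cast not_le.1 h)]; ring
    have e : ((stereoNum w R 0).1 + (stereoNum w R 0).2 * Complex.I : ℂ) /
      stereoDen w R - (w 0 : ℂ) / R = ((l * (σ * q) : ℝ) : ℂ) + ((l * (w 0).im : ℝ) : ℂ) * Complex.I := by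
      have e1 : l * (σ * q) = σ * (q ^ 2 - W) / den - c / R := by
        rw [← hσc, hl, div_mul_eq_mul_div, div_sub_div _ _ hdpos.ne' hR'.ne']
        congr 1
        have : q * (R ^ 2 - T) = (q ^ 2 - W) * R - den * |c| := by
          rw [hdenR, hWT, hq]; nlinarith [sq_abs c]
        linear_combination σ * this
      have e2 : l * (w 0).im = 2 * q * (w 0).im / den - (w 0).im / R := by rw [← hl2]; ring
      have e3 : (((stereoNum w R 0).1 : ℤ) : ℝ) = σ * (q ^ 2 - W) := by
        simp only [stereoNum, Fin.val_zero, if_true, hσ, hq, hW, hc]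
        push_cast
        ring_nf
      have e4 : (((stereoNum w R 0).2 : ℤ) : ℝ) = 2 * q * (w 0).im := by
        simp only [stereoNum, hq, hc]
        push_cast
        ring
      rw [e1, e2, hdenC, GaussianInt.toComplex_def, ← hc0, ← e3, ← e4]
      push_cast [hc]
      ring
    rw [e, Complex.sq_norm, Complex.normSq_add_mul_I]
    rw [mul_pow, mul_pow, mul_pow, hσ2]
    ring
  have hsum : ∑ k, ‖((stereoNum w R k).1 + (stereoNum w R k).2 * Complex.I : ℂ) / stereoDen w R -
      (w k : ℂ) / R‖ ^ 2 = l ^ 2 * den := by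
    rw [Fin.sum_univ_succ, hpole]
    simp only [hent]
    rw [← Finset.mul_sum, ← mul_add]
    congr 1
    rw [hden, hWT, hT, Fin.sum_univ_succ, hc, hc0, Zsqrtd.norm_def]
    push_cast
    ring
  have hρ : ∑ k, ‖(w k : ℂ) / R‖ ^ 2 = T / R ^ 2 := by
    rw [hT, Finset.sum_div]
    refine Finset.sum_congr rfl fun k _ => ?_
    rw [norm_div, div_pow, ← gaussNorm_eq_norm_sq, Complex.norm_natCast]
  rw [hsum, hρ, Real.sqrt_div hT0, Real.sqrt_sq hR'.le]
  set r := √T with hr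
  have hr2 : r ^ 2 = T := Real.sq_sqrt hT0
  have hr0 : 0 ≤ r := Real.sqrt_nonneg _
  rw [hl, ← hr2, div_pow, div_sub_one hR'.ne', div_pow, mul_pow, div_mul_eq_mul_div, ← mul_div_assoc,
    div_le_div_iff₀ (by positivity) (by positivity)]
  -- it remains to compare `(R + r) * |R - r|`, where `r` is the norm of `w`, with `√(2 * den) * |R - r|`
  have h1 : (R + r) ^ 2 ≤ 2 * den := by
    rw [hdenR, ← hr2]
    have : 0 ≤ (R : ℝ) * |c| := by positivity
    nlinarith [sq_nonneg ((R : ℝ) - r)]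
  calc (R ^ 2 - r ^ 2) ^ 2 * den * (R : ℝ) ^ 2
      = ((r - R) ^ 2 * den * R ^ 2) * (R + r) ^ 2 := by ring
    _ ≤ ((r - R) ^ 2 * den * R ^ 2) * (2 * den) := by gcongr
    _ = _ := by ring

end Stereographic

/-! ### Vectors given by lists of amplitudes -/

section Lists

variable {n : ℕ} {d : Fin n → ℕ}

theorem euclideanSpace_single_sub (x : BasisLabel d) (a b : ℂ) :
    (EuclideanSpace.single x (a - b) : QuditSpace d) =
      EuclideanSpace.single x a - EuclideanSpace.single x b := by
  ext y
  by_cases h : y = x <;> simp [h]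

theorem norm_sum_single_sq {s : ℕ} {f : Fin s → BasisLabel d} (hf : Function.Injective f)
    (a : Fin s → ℂ) :
    ‖∑ k, (EuclideanSpace.single (f k) (a k) : QuditSpace d)‖ ^ 2 = ∑ k, ‖a k‖ ^ 2 := by
  classical
  have h1 : ∀ x, (∑ k, (EuclideanSpace.single (f k) (a k) : QuditSpace d)) x =
      ∑ k, if x = f k then a k else 0 := fun x => by
    simp [Finset.sum_apply, Pi.single_apply]
  rw [EuclideanSpace.norm_sq_eq]
  have h2 : ∀ x, ‖(∑ k, (EuclideanSpace.single (f k) (a k) : QuditSpace d)) x‖ ^ 2 =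
      ∑ k, if x = f k then ‖a k‖ ^ 2 else 0 := by
    intro x
    rw [h1]
    by_cases hx : ∃ k, x = f k
    · obtain ⟨k, rfl⟩ := hx
      simp [hf.eq_iff]
    · push Not at hx
      simp [hx]
  simp only [h2]
  rw [Finset.sum_comm]
  simp

theorem listVector_filter (L : List (AmpEntry d)) (p : AmpEntry d → Prop) [DecidablePred p]
    (h : ∀ e ∈ L, ¬ p e → e.amp = 0) : listVector (L.filter p) = listVector L := by
  induction L with
  | nil => rfl
  | cons e L ih =>
    have ih' := ih fun e' he' => h e' (List.mem_cons_of_mem _ he')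
    by_cases hp : p e
    · rw [List.filter_cons_of_pos (by simpa using hp)]
      simp only [listVector, List.map_cons, List.sum_cons] at ih' ⊢
      rw [ih']
    · rw [List.filter_cons_of_neg (by simpa using hp), ih']
      simp [listVector, h e List.mem_cons_self hp]

/-- The entries, with the zero ones removed, of the normalized vector: the entry `k` belongs to the
label `Y k`. -/
def stereoList {s : ℕ} (Y : Fin s → BasisLabel d) (w : Fin s → GaussianInt) (R : ℕ) :
    List (AmpEntry d) :=
  ((List.finRange s).map fun k => (Y k, stereoNum w R k, stereoDen w R)).filter
    fun e => ¬ (e.2.1.1 = 0 ∧ e.2.1.2 = 0)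

theorem length_stereoList_le {s : ℕ} (Y : Fin s → BasisLabel d) (w : Fin s → GaussianInt) (R : ℕ) :
    (stereoList Y w R).length ≤ s :=
  (List.length_filter_le _ _).trans (by simp)

theorem listVector_stereoList {s : ℕ} (Y : Fin s → BasisLabel d) (w : Fin s → GaussianInt) (R : ℕ) :
    listVector (stereoList Y w R) = ∑ k, EuclideanSpace.single (Y k)
      (((stereoNum w R k).1 + (stereoNum w R k).2 * Complex.I : ℂ) / stereoDen w R) := by
  rw [stereoList, listVector_filter, listVector, List.map_map, ← List.ofFn_eq_map, List.sum_ofFn]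
  · rfl
  · intro e _ he
    simp only [not_not] at he
    simp [AmpEntry.amp, he.1, he.2]

theorem stereoDen_pos {s : ℕ} (w : Fin s → GaussianInt) {R : ℕ} (hR : 0 < R) :
    0 < stereoDen w R := by
  have := restSq_nonneg w
  have : (0 : ℤ) < R := by exact_mod_cast hR
  have := abs_nonneg (poleCoord w)
  rw [stereoDen]
  positivity

theorem listsState_stereoList {s : ℕ} {Y : Fin s → BasisLabel d} (hY : Function.Injective Y)
    (w : Fin s → GaussianInt) {R : ℕ} (hR : 0 < R) (hs : 0 < s) :
    ListsState (stereoList Y w R) := by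
  have hden := stereoDen_pos w hR
  have hdC : (stereoDen w R : ℂ) ≠ 0 := by exact_mod_cast hden.ne'
  have hdR : (stereoDen w R : ℝ) ≠ 0 := by exact_mod_cast hden.ne'
  refine ⟨?_, ?_, ?_⟩
  · refine List.Nodup.sublist (List.filter_sublist.map _) ?_
    rw [List.map_map]
    exact (List.nodup_finRange s).map hY
  · intro e he
    rw [stereoList, List.mem_filter, List.mem_map] at he
    obtain ⟨⟨k, _, rfl⟩, he⟩ := he
    rw [AmpEntry.amp]
    refine div_ne_zero (fun h0 => ?_) hdC
    have h1 := congrArg Complex.re h0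
    have h2 := congrArg Complex.im h0
    simp at h1 h2
    simp [h1, h2] at he
  · have h1 := norm_sum_single_sq hY fun k =>
      (((stereoNum w R k).1 + (stereoNum w R k).2 * Complex.I : ℂ) / stereoDen w R)
    rw [← listVector_stereoList] at h1
    have h2 : ∑ k, ‖((stereoNum w R k).1 + (stereoNum w R k).2 * Complex.I : ℂ) / stereoDen w R‖ ^ 2
        = 1 := by
      have h3 : ∀ k, ‖((stereoNum w R k).1 + (stereoNum w R k).2 * Complex.I : ℂ) / stereoDen w R‖ ^ 2 =
          (((stereoNum w R k).1 ^ 2 + (stereoNum w R k).2 ^ 2 : ℤ) : ℝ) / (stereoDen w R : ℝ) ^ 2 := by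
        intro k
        rw [norm_div, div_pow, Complex.norm_intCast, sq_abs]
        congr 1
        have := Complex.normSq_add_mul_I ((stereoNum w R k).1 : ℝ) ((stereoNum w R k).2 : ℝ)
        rw [Complex.sq_norm]
        push_cast at this ⊢
        exact this
      simp only [h3]
      rw [← Finset.sum_div, ← Int.cast_sum, sum_stereoNum_sq w R hs]
      push_cast
      exact div_self (pow_ne_zero _ hdR)
    rw [h2] at h1
    exact (pow_eq_one_iff_of_nonneg (norm_nonneg _) two_ne_zero).1 h1

/-- The rational unit vector approximates any unit vector that `w / R` approximates. -/
theorem norm_stereoList_sub_le {s : ℕ} {Y : Fin s → BasisLabel d} (hY : Function.Injective Y)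
    (w : Fin s → GaussianInt) {R : ℕ} (hR : 0 < R) (hs : 0 < s) {φ : QuditSpace d} (hφ : ‖φ‖ = 1) :
    ‖listVector (stereoList Y w R) - φ‖ ≤
      3 * ‖(∑ k, EuclideanSpace.single (Y k) ((w k : ℂ) / R)) - φ‖ := by
  set v : QuditSpace d := ∑ k, EuclideanSpace.single (Y k) ((w k : ℂ) / R) with hv
  have h1 : ‖listVector (stereoList Y w R) - v‖ ^ 2 ≤ 2 * (‖v‖ - 1) ^ 2 := by
    have h2 := sum_stereo_sub_le w hR hs
    have h3 : √(∑ k, ‖(w k : ℂ) / R‖ ^ 2) = ‖v‖ := by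
      rw [← norm_sum_single_sq hY, Real.sqrt_sq (norm_nonneg _)]
    rw [h3, ← norm_sum_single_sq hY] at h2
    rw [listVector_stereoList, hv, ← Finset.sum_sub_distrib]
    refine le_of_eq_of_le ?_ h2
    congr 2
    exact Finset.sum_congr rfl fun k _ => (euclideanSpace_single_sub _ _ _).symm
  have h4 : |‖v‖ - 1| ≤ ‖v - φ‖ := by rw [← hφ]; exact abs_norm_sub_norm_le _ _
  have h5 : ‖listVector (stereoList Y w R) - v‖ ≤ 2 * ‖v - φ‖ := by
    refine abs_le_of_sq_le_sq' ?_ (by positivity) |>.2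
    refine h1.trans ?_
    rw [← sq_abs]
    nlinarith [abs_nonneg (‖v‖ - 1), norm_nonneg (v - φ)]
  calc _ = ‖(listVector (stereoList Y w R) - v) + (v - φ)‖ := by congr 1; abel
    _ ≤ 2 * ‖v - φ‖ + ‖v - φ‖ := (norm_add_le _ _).trans (by gcongr)
    _ = _ := by ring

end Lists

/-! ### The search for the large amplitudes -/

section Trunc

variable {n : ℕ} {d : Fin n → ℕ} {u : (i : Fin n) → Matrix (Fin (d i)) (Fin (d i)) ℂ}
  {ψ : BasisLabel d → ℂ}

theorem marginal_congr {i : ℕ} {y y' : BasisLabel d} (h : ∀ j : Fin n, (j : ℕ) < i → y j = y' j) :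
    marginal u ψ i y = marginal u ψ i y' := by
  refine Finset.sum_congr rfl fun x _ => ?_
  congr 1
  exact propext (forall_congr' fun j => imp_congr_right fun hj => by rw [h j hj])

theorem norm_outAmp_sq_le_marginal (i : ℕ) (y : BasisLabel d) :
    ‖outAmp u ψ y‖ ^ 2 ≤ marginal u ψ i y := by
  have := Finset.single_le_sum (f := fun y' : BasisLabel d =>
    if ∀ j : Fin n, (j : ℕ) < i → y' j = y j then ‖outAmp u ψ y'‖ ^ 2 else 0)
    (fun _ _ => by split_ifs <;> positivity) (Finset.mem_univ y)
  simpa [marginal] using this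

/-- Unitarity: the output amplitudes are normalized. -/
theorem sum_norm_outAmp_sq (hu : ∀ j, u j ∈ Matrix.unitaryGroup (Fin (d j)) ℂ)
    (hψ : ∑ x, ‖ψ x‖ ^ 2 = 1) (y : BasisLabel d) : ∑ x, ‖outAmp u ψ x‖ ^ 2 = 1 := by
  have h := marginal_eq_sum hu ψ 0 y
  have h1 : ∀ x x', rowKernel u 0 y x x' = if x = x' then 1 else 0 := fun x x' => by
    simp only [rowKernel, Nat.not_lt_zero, if_false]
    rw [Finset.prod_ite_zero]
    simp [funext_iff]
  have h2 : marginal u ψ 0 y = 1 := by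
    have : ((∑ x, ‖ψ x‖ ^ 2 : ℝ) : ℂ) = 1 := by rw [hψ]; simp
    have h3 : (marginal u ψ 0 y : ℂ) = 1 := by
      rw [h, ← this]
      push_cast
      refine Finset.sum_congr rfl fun x _ => ?_
      rw [Finset.sum_eq_single x]
      · simp [h1, Complex.conj_mul']
      · intro x' _ hx'
        simp [h1, hx'.symm]
      · simp
    exact_mod_cast h3
  simpa [marginal] using h2

end Trunc

namespace SimData

variable {n : ℕ} {d : Fin n → ℕ} (S : SimData d)

/-- The label `0 ⋯ 0`. -/
def zeroLabel : BasisLabel d := fun j => ⟨0, S.pos j⟩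

/-- The label obtained by setting all letters from the position `i` on to `0`. -/
def trunc (i : ℕ) (y : BasisLabel d) : BasisLabel d := fun j => if (j : ℕ) < i then y j else S.zeroLabel j

/-- The estimated marginal is at least `1 / (2 * K)`. -/
def Heavy (ω : Fin S.J → S.Seed) (i : ℕ) (y : BasisLabel d) : Prop :=
  (S.J * S.M : ℤ) ≤ 2 * S.K * S.margSum ω i y

instance (ω : Fin S.J → S.Seed) (i : ℕ) : DecidablePred (S.Heavy ω i) := fun _ =>
  inferInstanceAs (Decidable (_ ≤ _))

/-- The labels, with zeros from the position `i` on, whose first `i` letters pass all tests. The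
number of labels is cut to `4 * K`, so that the running time is bounded even if estimates are wrong. -/
def cands (ω : Fin S.J → S.Seed) : ℕ → List (BasisLabel d)
  | 0 => [S.zeroLabel]
  | i + 1 => if hi : i < n then
      (((cands ω i).flatMap fun y => (List.finRange (d ⟨i, hi⟩)).map fun c =>
        Function.update y ⟨i, hi⟩ c).filter (S.Heavy ω (i + 1))).take (4 * S.K)
    else cands ω i

theorem cands_succ (ω : Fin S.J → S.Seed) {i : ℕ} (hi : i < n) : S.cands ω (i + 1) =
    (((S.cands ω i).flatMap fun y => (List.finRange (d ⟨i, hi⟩)).map fun c =>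
        Function.update y ⟨i, hi⟩ c).filter (S.Heavy ω (i + 1))).take (4 * S.K) := by
  rw [cands, dif_pos hi]

theorem length_cands_le (ω : Fin S.J → S.Seed) (hK : 1 ≤ S.K) (i : ℕ) :
    (S.cands ω i).length ≤ 4 * S.K := by
  induction i with
  | zero => simp [cands]; omega
  | succ i ih =>
    rw [cands]
    split_ifs
    · exact List.length_take_le _ _
    · exact ih

/-- Letters that have not been searched yet are `0`. -/
theorem cands_apply_eq_zero (ω : Fin S.J → S.Seed) (i : ℕ) :
    ∀ y ∈ S.cands ω i, ∀ j : Fin n, i ≤ j → y j = S.zeroLabel j := by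
  induction i with
  | zero => intro y hy j _; rw [cands, List.mem_singleton] at hy; rw [hy]
  | succ i ih =>
    intro y hy j hj
    rw [cands, dif_pos (by omega : i < n)] at hy
    obtain ⟨y', hy', hy⟩ := List.mem_flatMap.1 (List.mem_of_mem_filter (List.mem_of_mem_take hy))
    obtain ⟨c, _, rfl⟩ := List.mem_map.1 hy
    rw [Function.update_of_ne (by rw [Ne, Fin.ext_iff]; dsimp only; omega)]
    exact ih y' hy' j (by omega)

/-- Distinct labels in the search differ in the letters searched. -/
theorem nodup_extend {L : List (BasisLabel d)} (hL : L.Nodup) {i : ℕ} (hi : i < n)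
    (h0 : ∀ y ∈ L, y ⟨i, hi⟩ = S.zeroLabel ⟨i, hi⟩) :
    (L.flatMap fun y => (List.finRange (d ⟨i, hi⟩)).map fun c =>
      Function.update y ⟨i, hi⟩ c).Nodup := by
  rw [List.nodup_flatMap]
  refine ⟨fun y _ => (List.nodup_finRange _).map (Function.update_injective y _), ?_⟩
  refine (List.Pairwise.and_mem.1 hL).imp fun {y y'} ⟨hy, hy', hne⟩ => ?_
  rw [Function.onFun, List.disjoint_left]
  rintro x hx hx'
  obtain ⟨c, _, rfl⟩ := List.mem_map.1 hx
  obtain ⟨c', _, hc'⟩ := List.mem_map.1 hx'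
  refine hne (funext fun j => ?_)
  by_cases hj : j = ⟨i, hi⟩
  · rw [hj, h0 y hy, h0 y' hy']
  · have := congrFun hc' j
    rw [Function.update_of_ne hj, Function.update_of_ne hj] at this
    exact this.symm

theorem nodup_cands (ω : Fin S.J → S.Seed) (i : ℕ) : (S.cands ω i).Nodup := by
  induction i with
  | zero => simp [cands]
  | succ i ih =>
    rw [cands]
    split_ifs with hi
    · exact ((S.nodup_extend ih hi fun y hy => S.cands_apply_eq_zero ω i y hy _ le_rfl).filter _).sublist
        (List.take_sublist _ _)
    · exact ih

/-- The labels whose amplitudes are listed. -/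
def support (ω : Fin S.J → S.Seed) : List (BasisLabel d) :=
  if (S.cands ω n).length = 0 then [S.zeroLabel] else S.cands ω n

theorem length_support_pos (ω : Fin S.J → S.Seed) : 0 < (S.support ω).length := by
  rw [support]; split_ifs with h
  · simp
  · omega

theorem nodup_support (ω : Fin S.J → S.Seed) : (S.support ω).Nodup := by
  rw [support]; split_ifs
  · simp
  · exact S.nodup_cands ω n

theorem length_support_le (ω : Fin S.J → S.Seed) (hK : 1 ≤ S.K) : (S.support ω).length ≤ 4 * S.K := by
  rw [support]; split_ifs
  · simp; omega
  · exact S.length_cands_le ω hK n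

/-- The output of the simulation. -/
def output (ω : Fin S.J → S.Seed) : List (AmpEntry d) :=
  stereoList (fun k => (S.support ω).get k)
    (fun k => ⟨S.ampSum ω true ((S.support ω).get k), S.ampSum ω false ((S.support ω).get k)⟩)
    (S.J * S.M)

theorem length_output_le (ω : Fin S.J → S.Seed) (hK : 1 ≤ S.K) :
    (S.output ω).length ≤ 4 * S.K :=
  (length_stereoList_le _ _ _).trans (S.length_support_le ω hK)

theorem listsState_output (ω : Fin S.J → S.Seed) (hR : 0 < S.J * S.M) : ListsState (S.output ω) :=
  listsState_stereoList (List.nodup_iff_injective_get.1 (S.nodup_support ω)) _ hR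
    (S.length_support_pos ω)

variable {S} {u : (i : Fin n) → Matrix (Fin (d i)) (Fin (d i)) ℂ} {ψ : BasisLabel d → ℂ}
  {ω : Fin S.J → S.Seed}

theorem Good.marginal_ge_of_heavy (h : S.Good u ψ ω) (hR : 0 < S.J * S.M) (hK : 1 ≤ S.K) {i : ℕ}
    (hi : i ≤ n) {y : BasisLabel d} (hy : S.Heavy ω i y) : 1 / (4 * S.K) ≤ marginal u ψ i y := by
  have h1 := (abs_le.1 (h.marg i hi y)).2
  have hR' : (0 : ℝ) < S.J * S.M := by exact_mod_cast hR
  have hK' : (0 : ℝ) < S.K := by exact_mod_cast hK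
  have h2 : (S.J * S.M : ℝ) ≤ 2 * S.K * S.margSum ω i y := by exact_mod_cast hy
  have h3 : 1 / (2 * S.K : ℝ) ≤ (S.margSum ω i y : ℝ) / (S.J * S.M) := by
    rw [div_le_div_iff₀ (by positivity) hR']; linarith
  have h4 : (1 : ℝ) / (2 * S.K) = 1 / (4 * S.K) + 1 / (4 * S.K) := by field_simp; norm_num
  linarith

theorem Good.heavy_of_marginal_ge (h : S.Good u ψ ω) (hR : 0 < S.J * S.M) (hK : 1 ≤ S.K) {i : ℕ}
    (hi : i ≤ n) {y : BasisLabel d} (hy : 3 / (4 * S.K) ≤ marginal u ψ i y) : S.Heavy ω i y := by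
  have h1 := (abs_le.1 (h.marg i hi y)).1
  have hR' : (0 : ℝ) < S.J * S.M := by exact_mod_cast hR
  have hK' : (0 : ℝ) < S.K := by exact_mod_cast hK
  have h4 : (3 : ℝ) / (4 * S.K) = 1 / (2 * S.K) + 1 / (4 * S.K) := by field_simp; norm_num
  have h3 : 1 / (2 * S.K : ℝ) ≤ (S.margSum ω i y : ℝ) / (S.J * S.M) := by linarith
  rw [div_le_div_iff₀ (by positivity) hR'] at h3
  have h5 : (S.J * S.M : ℝ) ≤ 2 * S.K * S.margSum ω i y := by linarith
  unfold Heavy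
  exact_mod_cast h5

/-- There are few heavy labels, because the marginals sum to `1`. -/
theorem Good.length_le (h : S.Good u ψ ω) (hu : ∀ j, u j ∈ Matrix.unitaryGroup (Fin (d j)) ℂ)
    (hψ : ∑ x, ‖ψ x‖ ^ 2 = 1) (hR : 0 < S.J * S.M) (hK : 1 ≤ S.K) {i : ℕ} (hi : i ≤ n)
    {L : List (BasisLabel d)} (hL : L.Nodup) (h0 : ∀ y ∈ L, ∀ j : Fin n, i ≤ j → y j = S.zeroLabel j)
    (hh : ∀ y ∈ L, S.Heavy ω i y) : L.length ≤ 4 * S.K := by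
  classical
  have hK' : (0 : ℝ) < S.K := by exact_mod_cast hK
  have h1 : ∑ y ∈ L.toFinset, marginal u ψ i y ≤ 1 := by
    rw [← sum_norm_outAmp_sq hu hψ S.zeroLabel]
    simp only [marginal]
    rw [Finset.sum_comm]
    refine Finset.sum_le_sum fun y' _ => ?_
    rw [← Finset.sum_filter]
    -- each output label is counted in the marginal of one prefix only
    have h2 : (L.toFinset.filter fun y => ∀ j : Fin n, (j : ℕ) < i → y' j = y j) ⊆ {S.trunc i y'} := by
      intro y hy
      rw [Finset.mem_filter, List.mem_toFinset] at hy
      refine Finset.mem_singleton.2 (funext fun j => ?_)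
      rw [trunc]
      split_ifs with hj
      · exact (hy.2 j hj).symm
      · exact h0 y hy.1 j (by omega)
    refine (Finset.sum_le_sum_of_subset_of_nonneg h2 fun _ _ _ => by positivity).trans ?_
    simp
  have h3 : (L.toFinset.card : ℝ) * (1 / (4 * S.K)) ≤ 1 := by
    refine le_trans ?_ h1
    rw [← nsmul_eq_mul]
    exact Finset.card_nsmul_le_sum _ _ _ fun y hy =>
      h.marginal_ge_of_heavy hR hK hi (hh y (List.mem_toFinset.1 hy))
  rw [List.toFinset_card_of_nodup hL, mul_one_div, div_le_one (by positivity)] at h3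
  exact_mod_cast h3

/-- No label with a large amplitude is lost in the search. -/
theorem Good.trunc_mem_cands (h : S.Good u ψ ω) (hu : ∀ j, u j ∈ Matrix.unitaryGroup (Fin (d j)) ℂ)
    (hψ : ∑ x, ‖ψ x‖ ^ 2 = 1) (hR : 0 < S.J * S.M) (hK : 1 ≤ S.K) {y : BasisLabel d}
    (hy : 3 / (4 * S.K) ≤ ‖outAmp u ψ y‖ ^ 2) {i : ℕ} (hi : i ≤ n) :
    S.trunc i y ∈ S.cands ω i := by
  induction i with
  | zero => simp [cands, trunc, funext_iff]
  | succ i ih =>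
    have hi' : i < n := hi
    have ih := ih hi'.le
    rw [S.cands_succ ω hi', List.take_of_length_le]
    · have e : S.trunc (i + 1) y = Function.update (S.trunc i y) ⟨i, hi'⟩ (y ⟨i, hi'⟩) := by
        funext j
        by_cases hj : j = ⟨i, hi'⟩
        · subst hj; simp [trunc]
        · have : (j : ℕ) ≠ i := fun h => hj (Fin.ext h)
          rw [Function.update_of_ne hj, trunc, trunc]
          congr 1
          exact propext ⟨fun _ => by omega, fun _ => by omega⟩
      refine List.mem_filter.2 ⟨List.mem_flatMap.2 ⟨_, ih, ?_⟩, decide_eq_true ?_⟩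
      · rw [e]
        exact List.mem_map.2 ⟨_, List.mem_finRange _, rfl⟩
      · refine h.heavy_of_marginal_ge hR hK hi (hy.trans ?_)
        rw [marginal_congr (y' := y) fun j hj => by rw [trunc, if_pos hj]]
        exact norm_outAmp_sq_le_marginal _ _
    · refine h.length_le hu hψ hR hK hi ((S.nodup_extend (S.nodup_cands ω i) hi'
        fun y hy => S.cands_apply_eq_zero ω i y hy _ le_rfl).filter _) (fun y hy j hj => ?_)
        fun y hy => of_decide_eq_true (List.mem_filter.1 hy).2
      obtain ⟨y', hy', hy⟩ := List.mem_flatMap.1 (List.mem_of_mem_filter hy)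
      obtain ⟨c, _, rfl⟩ := List.mem_map.1 hy
      rw [Function.update_of_ne (by rw [Ne, Fin.ext_iff]; dsimp only; omega)]
      exact S.cands_apply_eq_zero ω i y' hy' j (by omega)

theorem Good.mem_support (h : S.Good u ψ ω) (hu : ∀ j, u j ∈ Matrix.unitaryGroup (Fin (d j)) ℂ)
    (hψ : ∑ x, ‖ψ x‖ ^ 2 = 1) (hR : 0 < S.J * S.M) (hK : 1 ≤ S.K) {y : BasisLabel d}
    (hy : 3 / (4 * S.K) ≤ ‖outAmp u ψ y‖ ^ 2) : y ∈ S.support ω := by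
  have h1 := h.trunc_mem_cands hu hψ hR hK hy le_rfl
  have h2 : S.trunc n y = y := funext fun j => if_pos j.2
  rw [h2] at h1
  rw [support, if_neg]
  · exact h1
  · exact (List.length_pos_of_mem h1).ne'

/-- On the event that all estimates are good, the output is close to the output state. -/
theorem Good.norm_output_sub_le (h : S.Good u ψ ω)
    (hu : ∀ j, u j ∈ Matrix.unitaryGroup (Fin (d j)) ℂ)
    (hψ : ∑ x, ‖ψ x‖ ^ 2 = 1) (hR : 0 < S.J * S.M) {t k : ℕ} (hSK : S.K = t * k) (hK : 1 ≤ S.K)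
    {ε : ℝ} (hε : 0 < ε) (hk : 1 / ε ≤ k) {φ : QuditSpace d} (hφ : ∀ y, φ y = outAmp u ψ y)
    (hs : IsApproxSparse (√ε) t φ) :
    ‖listVector (S.output ω) - φ‖ ≤ 5 * √ε := by
  classical
  obtain ⟨v, hvt, hv⟩ := hs
  have hK' : (0 : ℝ) < S.K := by exact_mod_cast hK
  have hR' : (0 : ℝ) < S.J * S.M := by exact_mod_cast hR
  have htk : 0 < t * k := by omega
  have ht : 0 < t := Nat.pos_of_mul_pos_right htk
  have hkpos : (0 : ℝ) < k := lt_of_lt_of_le (by positivity) hk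
  have hkε : 1 / (k : ℝ) ≤ ε := by
    rw [div_le_iff₀ hkpos]; rw [div_le_iff₀ hε] at hk; linarith
  have hφ1 : ‖φ‖ = 1 := by
    rw [← pow_eq_one_iff_of_nonneg (norm_nonneg _) two_ne_zero, EuclideanSpace.norm_sq_eq]
    simp only [hφ]
    exact sum_norm_outAmp_sq hu hψ S.zeroLabel
  set Y := S.support ω with hY
  have hinj : Function.Injective Y.get := List.nodup_iff_injective_get.1 (S.nodup_support ω)
  set w : Fin Y.length → GaussianInt := fun k => ⟨S.ampSum ω true (Y.get k), S.ampSum ω false (Y.get k)⟩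
    with hw
  have h1 := norm_stereoList_sub_le hinj w hR (S.length_support_pos ω) hφ1
  refine (show ‖listVector (S.output ω) - φ‖ ≤ _ from h1).trans ?_
  set V : QuditSpace d := ∑ k, EuclideanSpace.single (Y.get k) ((w k : ℂ) / (S.J * S.M : ℕ)) with hV
  -- the part of `φ` supported on `Y`
  set φY : QuditSpace d := ∑ k, EuclideanSpace.single (Y.get k) (φ (Y.get k)) with hφY
  have hφYx : ∀ x, φY x = if x ∈ Y then φ x else 0 := by
    intro x
    have e1 : φY x = ∑ k, if x = Y.get k then φ (Y.get k) else 0 := by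
      simp [hφY, Finset.sum_apply, Pi.single_apply]
    rw [e1]
    split_ifs with hx
    · obtain ⟨k, rfl⟩ := List.mem_iff_get.1 hx
      rw [Finset.sum_eq_single k (fun k' _ hk' => if_neg fun h => hk' (hinj h.symm))
        (fun h => absurd (Finset.mem_univ k) h), if_pos rfl]
    · refine Finset.sum_eq_zero fun k _ => if_neg ?_
      rintro rfl
      exact hx (List.get_mem _ _)
  have hA : ‖V - φY‖ ^ 2 ≤ ε / 2 := by
    have e : V - φY = ∑ k, EuclideanSpace.single (Y.get k)
        ((w k : ℂ) / (S.J * S.M : ℕ) - φ (Y.get k)) := by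
      rw [hV, hφY, ← Finset.sum_sub_distrib]
      exact Finset.sum_congr rfl fun k _ => (euclideanSpace_single_sub _ _ _).symm
    rw [e, norm_sum_single_sq hinj]
    have hb : ∀ k, ‖(w k : ℂ) / (S.J * S.M : ℕ) - φ (Y.get k)‖ ^ 2 ≤ 2 * (1 / (4 * S.K)) ^ 2 := by
      intro k
      rw [hφ]
      have a1 := h.amp true (Y.get k)
      have a2 := h.amp false (Y.get k)
      have e : (w k : ℂ) / (S.J * S.M : ℕ) - outAmp u ψ (Y.get k) =
          (((S.ampSum ω true (Y.get k) : ℝ) / (S.J * S.M) - (outAmp u ψ (Y.get k)).re : ℝ) : ℂ) +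
          (((S.ampSum ω false (Y.get k) : ℝ) / (S.J * S.M) - (outAmp u ψ (Y.get k)).im : ℝ) : ℂ) *
            Complex.I := by
        conv_lhs => rw [← Complex.re_add_im (outAmp u ψ (Y.get k))]
        rw [GaussianInt.toComplex_def]
        push_cast [hw]
        ring
      rw [e, Complex.sq_norm, Complex.normSq_add_mul_I]
      have b1 := sq_le_sq' (abs_le.1 a1).1 (abs_le.1 a1).2
      have b2 := sq_le_sq' (abs_le.1 a2).1 (abs_le.1 a2).2
      simp only [complexPart] at b1 b2
      simp only [if_true, if_false, Bool.false_eq_true] at b1 b2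
      linarith
    refine (Finset.sum_le_card_nsmul _ _ _ fun k _ => hb k).trans ?_
    rw [Finset.card_univ, Fintype.card_fin, nsmul_eq_mul]
    have hlen : (Y.length : ℝ) ≤ 4 * S.K := by exact_mod_cast S.length_support_le ω hK
    have hKk : (k : ℝ) ≤ S.K := by
      rw [hSK]; exact_mod_cast Nat.le_mul_of_pos_left k ht
    calc (Y.length : ℝ) * (2 * (1 / (4 * S.K)) ^ 2) ≤ (4 * S.K) * (2 * (1 / (4 * S.K)) ^ 2) := by gcongr
      _ = 1 / (S.K : ℝ) / 2 := by field_simp; norm_num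
      _ ≤ 1 / (k : ℝ) / 2 := by gcongr
      _ ≤ ε / 2 := by gcongr
  have hB : ‖φY - φ‖ ^ 2 ≤ 7 / 4 * ε := by
    rw [EuclideanSpace.norm_sq_eq]
    -- outside `Y`, either `v` vanishes, or the amplitude is small because the search missed it
    have hpt : ∀ x,
        ‖(φY - φ) x‖ ^ 2 ≤ ‖(φ - v) x‖ ^ 2 + if v x ≠ 0 then 3 / (4 * (S.K : ℝ)) else 0 := by
      intro x
      rw [PiLp.sub_apply, PiLp.sub_apply, hφYx]
      by_cases hx : x ∈ Y
      · rw [if_pos hx, sub_self, norm_zero, zero_pow two_ne_zero]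
        have : 0 ≤ if v x ≠ 0 then 3 / (4 * (S.K : ℝ)) else 0 := by split_ifs <;> positivity
        exact add_nonneg (sq_nonneg _) this
      · rw [if_neg hx, zero_sub, norm_neg]
        by_cases hvx : v x = 0
        · simp [hvx]
        · rw [if_pos hvx]
          have h5 : ‖φ x‖ ^ 2 < 3 / (4 * S.K) := by
            by_contra h6
            rw [not_lt, hφ] at h6
            exact hx (h.mem_support hu hψ hR hK h6)
          have : 0 ≤ ‖φ x - v x‖ ^ 2 := by positivity
          linarith
    refine (Finset.sum_le_sum fun x _ => hpt x).trans ?_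
    rw [Finset.sum_add_distrib, ← EuclideanSpace.norm_sq_eq, ← Finset.sum_filter, Finset.sum_const,
      nsmul_eq_mul]
    have h6 : ‖φ - v‖ ^ 2 ≤ ε := by
      calc ‖φ - v‖ ^ 2 ≤ √ε ^ 2 := by gcongr
        _ = ε := Real.sq_sqrt hε.le
    have h7 : ((Finset.univ.filter fun x => v x ≠ 0).card : ℝ) ≤ t := by
      rw [Nat.card_eq_fintype_card, Fintype.card_subtype] at hvt
      exact_mod_cast hvt
    have h8 : (t : ℝ) * (3 / (4 * S.K)) = 3 / 4 * (1 / k) := by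
      rw [hSK]; push_cast
      have : (t : ℝ) ≠ 0 := by exact_mod_cast ht.ne'
      field_simp
    have h9 : ((Finset.univ.filter fun x => v x ≠ 0).card : ℝ) * (3 / (4 * S.K)) ≤
        t * (3 / (4 * S.K)) := by gcongr
    linarith
  have hε2 : √ε ^ 2 = ε := Real.sq_sqrt hε.le
  have hsε := Real.sqrt_pos.2 hε
  -- `V - φY` and `φY - φ` have disjoint supports
  have hpyth : ‖V - φ‖ ^ 2 ≤ (3 / 2 * √ε) ^ 2 := by
    have hVx : ∀ x, x ∉ Y → V x = 0 := by
      intro x hx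
      have e1 : V x = ∑ k, if x = Y.get k then ((w k : ℂ) / (S.J * S.M : ℕ)) else 0 := by
        simp [hV, Finset.sum_apply, Pi.single_apply]
      rw [e1]
      refine Finset.sum_eq_zero fun k _ => if_neg ?_
      rintro rfl
      exact hx (List.get_mem _ _)
    have e2 : ‖V - φ‖ ^ 2 = ‖V - φY‖ ^ 2 + ‖φY - φ‖ ^ 2 := by
      simp only [EuclideanSpace.norm_sq_eq, ← Finset.sum_add_distrib]
      refine Finset.sum_congr rfl fun x _ => ?_
      simp only [PiLp.sub_apply, hφYx]
      by_cases hx : x ∈ Y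
      · simp [hx]
      · simp [hx, hVx x hx]
    rw [e2, mul_pow, hε2]
    linarith
  have := abs_le_of_sq_le_sq' hpyth (by positivity)
  linarith [this.2]

end SimData

/-! ### The statistics are computable in polynomial time -/

theorem Datum.size_nat_le (k : ℕ) : (Datum.nat k).size ≤ 1 + k := by
  simpa [Datum.nat, Datum.size] using natSize_le_self k

theorem Datum.size_ofFn_le {n B : ℕ} {f : Fin n → Datum} (hf : ∀ i, (f i).size ≤ B) :
    (Datum.ofFn f).size ≤ 1 + n * (1 + B) := by
  rw [Datum.ofFn, Datum.size_ofList, List.map_ofFn, List.sum_ofFn]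
  exact Nat.add_le_add_left ((Finset.sum_le_card_nsmul _ _ (1 + B) fun i _ =>
    Nat.add_le_add_left (hf i) 1).trans (by simp)) _

theorem size_labelDatum_le {n D : ℕ} {d : Fin n → ℕ} (hd : ∀ j, d j ≤ D) (y : BasisLabel d) :
    (labelDatum y).size ≤ 1 + n * (2 + D) := by
  rw [show 2 + D = 1 + (1 + D) by ring]
  exact Datum.size_ofFn_le fun j =>
    (Datum.size_nat_le _).trans (Nat.add_le_add_left ((y j).2.le.trans (hd j)) 1)

namespace Feas

variable {Ω : Type} {N : Ω → ℕ} {e : Ω → Datum}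

theorem intNeg {a : Ω → ℤ} (h : Feas N e fun ω => .int (a ω)) : Feas N e fun ω => .int (- a ω) :=
  ((h.lit 0).sub h).congr fun ω => by rw [zero_sub]

theorem intIte {c : Ω → Prop} [∀ ω, Decidable (c ω)] {a b : Ω → ℤ} (hc : Feas N e fun ω => ind (c ω))
    (ha : Feas N e fun ω => .int (a ω)) (hb : Feas N e fun ω => .int (b ω)) :
    Feas N e fun ω => .int (if c ω then a ω else b ω) :=
  (hc.ite ha hb).congr fun ω => by rw [apply_ite Datum.int]

theorem natIte {c : Ω → Prop} [∀ ω, Decidable (c ω)] {a b : Ω → ℕ} (hc : Feas N e fun ω => ind (c ω))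
    (ha : Feas N e fun ω => .nat (a ω)) (hb : Feas N e fun ω => .nat (b ω)) :
    Feas N e fun ω => .nat (if c ω then a ω else b ω) :=
  (hc.ite ha hb).congr fun ω => by rw [apply_ite Datum.nat]

theorem intAbs {a : Ω → ℤ} (h : Feas N e fun ω => .int (a ω)) : Feas N e fun ω => .int |a ω| :=
  (((h.lit 0).le h).intIte h h.intNeg).congr fun ω => by
    split_ifs with h'
    · rw [abs_of_nonneg h']
    · rw [abs_of_neg (not_le.1 h')]

theorem natSum {K : Ω → ℕ} {f : (ω : Ω) → Fin (K ω) → ℕ} (hK : Feas N e fun ω => .nat (K ω))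
    (hKb : PolyBdd N K)
    (hf : Feas (fun q : (ω : Ω) × Fin (K ω) => N q.1) (fun q => .pair (e q.1) (.nat q.2))
      fun q => .nat (f q.1 q.2)) : Feas N e fun ω => .nat (∑ i, f ω i) :=
  (sum (f := fun ω i => (f ω i : ℤ)) hK hKb hf).congr fun ω => by simp [Datum.nat]

theorem pick {m : Ω → ℕ} (hm : ∀ ω, 0 < m ω) {wt : (ω : Ω) → Fin (m ω) → ℕ} {R : Ω → ℕ}
    (hK : Feas N e fun ω => .nat (m ω)) (hKb : PolyBdd N m)
    (hw : Feas (fun q : (ω : Ω) × Fin (m ω) => N q.1) (fun q => .pair (e q.1) (.nat q.2))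
      fun q => .nat (wt q.1 q.2)) (hR : Feas N e fun ω => .nat (R ω)) :
    Feas N e fun ω => .nat (pick (hm ω) (wt ω) (R ω)) := by
  have ho := outer hK.bdd_left hKb
  have hi := index hK.bdd_left hKb
  have hK' := hK.lift Sigma.fst ho
  refine natSum hK hKb (f := fun ω c => if (c : ℕ) + 1 < m ω ∧
    ∑ b, (if b ≤ c then wt ω b else 0) ≤ R ω then 1 else 0)
    (natIte (((hi.natAdd (hi.natLit 1)).natLt hK').and ?_) (hi.natLit 1) (hi.natLit 0))
  refine natLe (natSum (Ω := (ω : Ω) × Fin (m ω)) (K := fun q => m q.1)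
    (f := fun q b => if b ≤ q.2 then wt q.1 b else 0) hK' (hKb.reindex Sigma.fst) ?_)
    (hR.lift Sigma.fst ho)
  have ho' := outer hi.bdd_left (hKb.reindex Sigma.fst)
  have hi' := index hi.bdd_left (hKb.reindex (Ω' := (ω : Ω) × Fin (m ω)) Sigma.fst)
  exact natIte (hi'.natLe (hi.lift Sigma.fst ho'))
    (hw.lift (Ω' := (q : (ω : Ω) × Fin (m ω)) × Fin (m q.1)) (fun q => ⟨q.1.1, q.2⟩)
      ((ho.lift Sigma.fst ho').pair hi')) (hi'.natLit 0)

section Labels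

variable {n : Ω → ℕ} {d : (ω : Ω) → Fin (n ω) → ℕ} {y : (ω : Ω) → BasisLabel (d ω)}
  {j : (ω : Ω) → Fin (n ω)}

theorem labelGet (hy : Feas N e fun ω => labelDatum (y ω)) (hj : Feas N e fun ω => .nat (j ω)) :
    Feas N e fun ω => .nat (y ω (j ω)) :=
  getFn (g := fun ω i => .nat (y ω i)) hy hj

theorem labelUpdate {c : (ω : Ω) → Fin (d ω (j ω))} (hnb : PolyBdd N n)
    (hy : Feas N e fun ω => labelDatum (y ω))
    (hj : Feas N e fun ω => .nat (j ω)) (hc : Feas N e fun ω => .nat (c ω)) :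
    Feas N e fun ω => labelDatum (Function.update (y ω) (j ω) (c ω)) := by
  have ho := outer hy.bdd_left hnb
  have hi := index hy.bdd_left hnb
  refine ofFn (lengthFn hy) hnb ((natIte (hi.natEq (hj.lift Sigma.fst ho)) (hc.lift Sigma.fst ho)
    (labelGet (j := fun q : (ω : Ω) × Fin (n ω) => q.2) (hy.lift Sigma.fst ho) hi)).congr
      fun q => ?_)
  obtain ⟨ω, i⟩ := q
  dsimp only
  split_ifs with h
  · obtain rfl : i = j ω := Fin.ext h
    rw [Function.update_self]
  · rw [Function.update_of_ne fun h' => h (congrArg _ h')]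

end Labels

end Feas

namespace SimData

variable {Ω : Type} {N : Ω → ℕ} {e : Ω → Datum} {n : Ω → ℕ} {d : (ω : Ω) → Fin (n ω) → ℕ}

/-- All parts of the data of the simulations, and the seeds, are computable from `e` in polynomial time;
functions such as `z` and `X` from `e` and their arguments. -/
structure Computable (N : Ω → ℕ) (e : Ω → Datum) (S : (ω : Ω) → SimData (d ω))
    (R : (ω : Ω) → Fin (S ω).J → (S ω).Seed) : Prop where
  dims : Feas N e fun ω => .ofFn fun i => .nat (d ω i)
  dim_le : ∃ D, ∀ ω i, d ω i ≤ D
  n_bdd : PolyBdd N n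
  K_pos : ∀ ω, 1 ≤ (S ω).K
  P : Feas N e fun ω => .nat (S ω).P
  P_bdd : PolyBdd N fun ω => (S ω).P
  K : Feas N e fun ω => .nat (S ω).K
  K_bdd : PolyBdd N fun ω => (S ω).K
  J : Feas N e fun ω => .nat (S ω).J
  J_bdd : PolyBdd N fun ω => (S ω).J
  a : Feas N e fun ω => .ofFn fun i => .ofFn fun j => .ofFn fun k => gaussDatum ((S ω).a i j k)
  z : Feas (fun q : (ω : Ω) × BasisLabel (d ω) => N q.1) (fun q => .pair (e q.1) (labelDatum q.2))
    fun q => gaussDatum ((S q.1).z q.2)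
  X : Feas (fun q : (ω : Ω) × Fin (S ω).J => N q.1) (fun q => .pair (e q.1) (.nat q.2))
    fun q => labelDatum ((S q.1).X (R q.1 q.2).2)
  seed : Feas (fun q : (q : (ω : Ω) × Fin (S ω).J) × Fin (n q.1) => N q.1.1)
    (fun q => .pair (.pair (e q.1.1) (.nat q.1.2)) (.nat q.2))
    fun q => .nat ((R q.1.1 q.1.2).1 q.2)

namespace Computable

variable {S : (ω : Ω) → SimData (d ω)} {R : (ω : Ω) → Fin (S ω).J → (S ω).Seed}
  {i : Ω → ℕ} {x x' y : (ω : Ω) → BasisLabel (d ω)}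

theorem lift {Ω' : Type} {e' : Ω' → Datum} (h : Computable N e S R) (π : Ω' → Ω)
    (h' : Feas (fun q => N (π q)) e' fun q => e (π q)) :
    Computable (fun q => N (π q)) e' (fun q => S (π q)) fun q => R (π q) where
  dims := h.dims.lift π h'
  dim_le := h.dim_le.imp fun _ hD q => hD (π q)
  n_bdd := h.n_bdd.reindex π
  K_pos q := h.K_pos _
  P := h.P.lift π h'
  P_bdd := h.P_bdd.reindex π
  K := h.K.lift π h'
  K_bdd := h.K_bdd.reindex π
  J := h.J.lift π h'
  J_bdd := h.J_bdd.reindex π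
  a := h.a.lift π h'
  z := h.z.lift (Ω' := (q : Ω') × BasisLabel (d (π q))) (fun q => ⟨π q.1, q.2⟩) <| by
    obtain ⟨D, hD⟩ := h.dim_le
    have hI := Feas.id (N := fun q : (q : Ω') × BasisLabel (d (π q)) => N (π q.1))
      (Feas.bdd_pair (h'.bdd_left.reindex Sigma.fst) ((((PolyBdd.const _ 1).add
        ((h.n_bdd.mul (.const _ (2 + D))).reindex fun q : (q : Ω') × BasisLabel (d (π q)) => π q.1))).mono
          fun q => size_labelDatum_le (hD _) q.2))
    exact (h'.lift Sigma.fst hI.fst).pair hI.snd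
  X := h.X.lift (Ω' := (q : Ω') × Fin (S (π q)).J) (fun q => ⟨π q.1, q.2⟩)
    ((h'.lift Sigma.fst (Feas.outer h'.bdd_left (h.J_bdd.reindex π))).pair
      (Feas.index h'.bdd_left (h.J_bdd.reindex π)))
  seed := by
    have ho := Feas.outer h'.bdd_left (h.J_bdd.reindex π)
    have hi := Feas.index h'.bdd_left (h.J_bdd.reindex π)
    have hnb := h.n_bdd.reindex fun q : (q : Ω') × Fin (S (π q)).J => π q.1
    have ho' := Feas.outer hi.bdd_left hnb
    have hi' := Feas.index hi.bdd_left hnb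
    exact h.seed.lift (Ω' := (q : (q : Ω') × Fin (S (π q)).J) × Fin (n (π q.1)))
      (fun q => ⟨⟨π q.1.1, q.1.2⟩, q.2⟩)
      ((((h'.lift Sigma.fst ho).pair hi).lift Sigma.fst ho').pair hi')

theorem numQudits (h : Computable N e S R) : Feas N e fun ω => .nat (n ω) := h.dims.lengthFn

theorem M (h : Computable N e S R) : Feas N e fun ω => .nat (S ω).M := (h.K.natLit 32).natMul h.K

theorem dim (h : Computable N e S R) {j : (ω : Ω) → Fin (n ω)} (hj : Feas N e fun ω => .nat (j ω)) :
    Feas N e fun ω => .nat (d ω (j ω)) := h.dims.getFn hj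

theorem dim_bdd (h : Computable N e S R) (j : (ω : Ω) → Fin (n ω)) : PolyBdd N fun ω => d ω (j ω) := by
  obtain ⟨D, hD⟩ := h.dim_le
  exact (PolyBdd.const N D).mono fun ω => hD ω _

theorem entry (h : Computable N e S R) {j : (ω : Ω) → Fin (n ω)} {b c : (ω : Ω) → Fin (d ω (j ω))}
    (hj : Feas N e fun ω => .nat (j ω)) (hb : Feas N e fun ω => .nat (b ω))
    (hc : Feas N e fun ω => .nat (c ω)) :
    Feas N e fun ω => gaussDatum ((S ω).a (j ω) (b ω) (c ω)) :=
  ((h.a.getFn hj).getFn hb).getFn hc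

theorem coefficient (h : Computable N e S R) (hx : Feas N e fun ω => labelDatum (x ω)) :
    Feas N e fun ω => gaussDatum ((S ω).z (x ω)) :=
  h.z.lift (fun ω => ⟨ω, x ω⟩) ((Feas.id hx.bdd_left).pair hx)

theorem resample (h : Computable N e S R) {r : (ω : Ω) → Fin (n ω) → ℕ}
    (hi : Feas N e fun ω => .nat (i ω))
    (hy : Feas N e fun ω => labelDatum (y ω)) (hx : Feas N e fun ω => labelDatum (x ω))
    (hr : Feas (fun q : (ω : Ω) × Fin (n ω) => N q.1) (fun q => .pair (e q.1) (.nat q.2))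
      fun q => .nat (r q.1 q.2)) :
    Feas N e fun ω => labelDatum ((S ω).resample (i ω) (y ω) (x ω) (r ω)) := by
  have ho := Feas.outer hi.bdd_left h.n_bdd
  have hj := Feas.index hi.bdd_left h.n_bdd
  have h' := h.lift Sigma.fst ho
  refine Feas.ofFn h.numQudits h.n_bdd ((Feas.natIte (hj.natLt (hi.lift Sigma.fst ho))
    (Feas.pick (m := fun q : (ω : Ω) × Fin (n ω) => d q.1 q.2) (fun q => (S q.1).pos q.2)
      (h'.dim hj) (h'.dim_bdd _)
      (wt := fun q c => ((S q.1).a q.2 (y q.1 q.2) c).norm.natAbs) ?_ hr)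
    (Feas.labelGet (j := fun q : (ω : Ω) × Fin (n ω) => q.2) (hx.lift Sigma.fst ho) hj)).congr
      fun q => ?_)
  · have ho' := Feas.outer hj.bdd_left (h'.dim_bdd fun q => q.2)
    have hc := Feas.index hj.bdd_left (h'.dim_bdd fun q => q.2)
    refine ((h'.lift Sigma.fst ho').entry
      (j := fun q : (q : (ω : Ω) × Fin (n ω)) × Fin (d q.1 q.2) => q.1.2)
      (b := fun q : (q : (ω : Ω) × Fin (n ω)) × Fin (d q.1 q.2) => y q.1.1 q.1.2)
      (c := fun q => q.2) (hj.lift Sigma.fst ho')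
      ((Feas.labelGet (j := fun q : (ω : Ω) × Fin (n ω) => q.2) (hy.lift Sigma.fst ho) hj).lift
        Sigma.fst ho') hc).gaussNorm.congr fun q => ?_
    rw [Datum.nat, Int.natAbs_of_nonneg (GaussianInt.norm_nonneg _)]
  · rw [SimData.resample]
    split_ifs <;> rfl

theorem kernel (h : Computable N e S R) (hi : Feas N e fun ω => .nat (i ω))
    (hy : Feas N e fun ω => labelDatum (y ω)) (hx : Feas N e fun ω => labelDatum (x ω))
    (hx' : Feas N e fun ω => labelDatum (x' ω)) :
    Feas N e fun ω => gaussDatum ((S ω).kernel (i ω) (y ω) (x ω) (x' ω)) := by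
  have ho := Feas.outer hi.bdd_left h.n_bdd
  have hj := Feas.index hi.bdd_left h.n_bdd
  have h' := h.lift Sigma.fst ho
  have hpow : Feas N e fun ω => gaussDatum (2 ^ (S ω).P) :=
    (((h.P.natLit 2).natPow h.P h.P_bdd).pair (h.P.lit 0)).congr fun ω => by
      rw [show (2 : GaussianInt) ^ (S ω).P = ((2 ^ (S ω).P : ℕ) : GaussianInt) by push_cast; rfl]
      simp only [gaussDatum, intPairDatum, Datum.nat, Zsqrtd.re_natCast, Zsqrtd.im_natCast]
  have hget : ∀ {x : (ω : Ω) → BasisLabel (d ω)}, (Feas N e fun ω => labelDatum (x ω)) →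
      Feas (fun q : (ω : Ω) × Fin (n ω) => N q.1) (fun q => .pair (e q.1) (.nat q.2))
        fun q => .nat (x q.1 q.2) := fun hx =>
    Feas.labelGet (j := fun q : (ω : Ω) × Fin (n ω) => q.2) (hx.lift Sigma.fst ho) hj
  refine hpow.gaussMul (Feas.gaussProd h.numQudits h.n_bdd
    (((hj.natLt (hi.lift Sigma.fst ho)).ite
      (h'.entry (j := fun q => q.2) (b := fun q => y q.1 q.2) (c := fun q => x' q.1 q.2) hj (hget hy)
        (hget hx'))
      (((hget hx).natEq (hget hx')).ite (hpow.lift Sigma.fst ho) ((hj.lit 0).pair (hj.lit 0)))).congr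
      fun q => ?_))
  split_ifs with h1 h2 h3 h3
  · rfl
  · rfl
  · exact absurd (Fin.ext h2) h3
  · exact absurd (congrArg _ h3) h2
  · rfl

theorem margVal (h : Computable N e S R) (hi : Feas N e fun ω => .nat (i ω))
    (hy : Feas N e fun ω => labelDatum (y ω)) (hx : Feas N e fun ω => labelDatum (x ω))
    (hx' : Feas N e fun ω => labelDatum (x' ω)) :
    Feas N e fun ω => .int ((S ω).margVal (i ω) (y ω) (x ω) (x' ω)) := by
  have h1 := (h.coefficient hx).gaussMul (h.kernel hi hy hx hx').gaussStar
  have h2 := (h.coefficient hx').gaussMul (h.kernel hi hy hx' hx).gaussStar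
  exact ((h.M.mul ((hi.lit 2).mul (h1.gaussStar.gaussMul h2).gaussRe)).div
    (h1.gaussNorm.add h2.gaussNorm)).congr fun ω => by rw [SimData.margVal]

theorem ampHalf (h : Computable N e S R) {v w : Ω → GaussianInt} (b : Bool)
    (hv : Feas N e fun ω => gaussDatum (v ω)) (hw : Feas N e fun ω => gaussDatum (w ω)) :
    Feas N e fun ω => .int ((S ω).ampHalf b (v ω) (w ω)) := by
  cases b
  · exact (h.M.mul (hv.gaussMul hw).gaussIm).div (hv.gaussNorm.add hw.gaussNorm)
  · exact (h.M.mul (hv.gaussMul hw).gaussRe).div (hv.gaussNorm.add hw.gaussNorm)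

theorem ampVal (h : Computable N e S R) (b : Bool)
    (hy : Feas N e fun ω => labelDatum (y ω)) (hx : Feas N e fun ω => labelDatum (x ω))
    (hx' : Feas N e fun ω => labelDatum (x' ω)) :
    Feas N e fun ω => .int ((S ω).ampVal b (y ω) (x ω) (x' ω)) :=
  (h.ampHalf b (h.kernel h.numQudits hy hx' hx) (h.coefficient hx)).add
    (h.ampHalf b (h.kernel h.numQudits hy hx hx') (h.coefficient hx'))

theorem samplePair_fst (h : Computable N e S R) {k : (ω : Ω) → Fin (S ω).J}
    (hk : Feas N e fun ω => .nat (k ω)) (i : Ω → ℕ) (y : (ω : Ω) → BasisLabel (d ω)) :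
    Feas N e fun ω => labelDatum ((S ω).samplePair (i ω) (y ω) (R ω (k ω))).1 :=
  h.X.lift (fun ω => ⟨ω, k ω⟩) ((Feas.id hk.bdd_left).pair hk)

theorem samplePair_snd (h : Computable N e S R) {k : (ω : Ω) → Fin (S ω).J}
    (hk : Feas N e fun ω => .nat (k ω)) (hi : Feas N e fun ω => .nat (i ω))
    (hy : Feas N e fun ω => labelDatum (y ω)) :
    Feas N e fun ω => labelDatum ((S ω).samplePair (i ω) (y ω) (R ω (k ω))).2 := by
  have ho := Feas.outer hi.bdd_left h.n_bdd
  have hj := Feas.index hi.bdd_left h.n_bdd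
  exact h.resample (r := fun ω j => (R ω (k ω)).1 j) hi hy (h.samplePair_fst hk i y)
    (h.seed.lift (Ω' := (ω : Ω) × Fin (n ω)) (fun q => ⟨⟨q.1, k q.1⟩, q.2⟩)
      ((ho.pair (hk.lift Sigma.fst ho)).pair hj))

theorem margSum (h : Computable N e S R) (hi : Feas N e fun ω => .nat (i ω))
    (hy : Feas N e fun ω => labelDatum (y ω)) :
    Feas N e fun ω => .int ((S ω).margSum (R ω) (i ω) (y ω)) := by
  have ho := Feas.outer hi.bdd_left h.J_bdd
  have hk := Feas.index hi.bdd_left h.J_bdd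
  have h' := h.lift Sigma.fst ho
  exact Feas.sum h.J h.J_bdd (h'.margVal (hi.lift Sigma.fst ho) (hy.lift Sigma.fst ho)
    (h'.samplePair_fst (k := fun q => q.2) hk _ _)
    (h'.samplePair_snd (k := fun q => q.2) hk (hi.lift Sigma.fst ho) (hy.lift Sigma.fst ho)))

theorem ampSum (h : Computable N e S R) (b : Bool) (hy : Feas N e fun ω => labelDatum (y ω)) :
    Feas N e fun ω => .int ((S ω).ampSum (R ω) b (y ω)) := by
  have ho := Feas.outer hy.bdd_left h.J_bdd
  have hk := Feas.index hy.bdd_left h.J_bdd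
  have h' := h.lift Sigma.fst ho
  exact Feas.sum h.J h.J_bdd (h'.ampVal b (hy.lift Sigma.fst ho)
    (h'.samplePair_fst (k := fun q => q.2) hk _ _)
    (h'.samplePair_snd (k := fun q => q.2) hk (h.numQudits.lift Sigma.fst ho) (hy.lift Sigma.fst ho)))

theorem heavy (h : Computable N e S R) (hi : Feas N e fun ω => .nat (i ω))
    (hy : Feas N e fun ω => labelDatum (y ω)) :
    Feas N e fun ω => ind ((S ω).Heavy (R ω) (i ω) (y ω)) :=
  (h.J.mul h.M).le (((h.K.lit 2).mul h.K).mul (h.margSum hi hy))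

end Computable

end SimData

/-! ### The search and the output are computable in polynomial time -/

namespace Feas

variable {Ω : Type} {N : Ω → ℕ} {e : Ω → Datum} {s : Ω → ℕ} {w : (ω : Ω) → Fin (s ω) → GaussianInt}
  {R : Ω → ℕ}

theorem poleCoord (hs : ∀ ω, 0 < s ω)
    (hw : Feas (fun q : (ω : Ω) × Fin (s ω) => N q.1) (fun q => .pair (e q.1) (.nat q.2))
      fun q => gaussDatum (w q.1 q.2)) {x : Ω → Datum} (he : Feas N e x) :
    Feas N e fun ω => .int (poleCoord (w ω)) :=
  (hw.lift (fun ω => ⟨ω, ⟨0, hs ω⟩⟩) ((Feas.id he.bdd_left).pair (he.lit 0))).gaussRe.congr fun ω => by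
    rw [_root_.poleCoord, dif_pos (hs ω)]

theorem restSq (hs : ∀ ω, 0 < s ω) (hK : Feas N e fun ω => .nat (s ω)) (hKb : PolyBdd N s)
    (hw : Feas (fun q : (ω : Ω) × Fin (s ω) => N q.1) (fun q => .pair (e q.1) (.nat q.2))
      fun q => gaussDatum (w q.1 q.2)) : Feas N e fun ω => .int (restSq (w ω)) := by
  have hp := poleCoord hs hw hK
  exact ((sum hK hKb hw.gaussNorm).sub (hp.mul hp)).congr fun ω => by rw [_root_.restSq, sq]

theorem stereoDen (hs : ∀ ω, 0 < s ω) (hK : Feas N e fun ω => .nat (s ω)) (hKb : PolyBdd N s)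
    (hw : Feas (fun q : (ω : Ω) × Fin (s ω) => N q.1) (fun q => .pair (e q.1) (.nat q.2))
      fun q => gaussDatum (w q.1 q.2)) (hR : Feas N e fun ω => .nat (R ω)) :
    Feas N e fun ω => .int (stereoDen (w ω) (R ω)) := by
  have hp := hR.add (poleCoord hs hw hK).intAbs
  exact ((hp.mul hp).add (restSq hs hK hKb hw)).congr fun ω => by rw [_root_.stereoDen, sq]

theorem stereoNum (hs : ∀ ω, 0 < s ω) (hK : Feas N e fun ω => .nat (s ω)) (hKb : PolyBdd N s)
    (hw : Feas (fun q : (ω : Ω) × Fin (s ω) => N q.1) (fun q => .pair (e q.1) (.nat q.2))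
      fun q => gaussDatum (w q.1 q.2)) (hR : Feas N e fun ω => .nat (R ω)) :
    Feas (fun q : (ω : Ω) × Fin (s ω) => N q.1) (fun q => .pair (e q.1) (.nat q.2))
      fun q => intPairDatum (stereoNum (w q.1) (R q.1) q.2) := by
  have ho := outer hK.bdd_left hKb
  have hi := index hK.bdd_left hKb
  have hp := (poleCoord hs hw hK).lift Sigma.fst ho
  have hq := (hR.add (poleCoord hs hw hK).intAbs).lift Sigma.fst ho
  have hr := (restSq hs hK hKb hw).lift Sigma.fst ho
  have h2 := (hq.lit 2).mul hq
  exact ((((hi.natEq (hi.natLit 0)).intIte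
    ((((hi.lit 0).le hp).intIte (hi.lit 1) (hi.lit (-1))).mul ((hq.mul hq).sub hr))
    (h2.mul hw.gaussRe))).pair (h2.mul hw.gaussIm)).congr fun q => by
      rw [_root_.stereoNum, sq]; rfl

theorem stereoList {n : Ω → ℕ} {d : (ω : Ω) → Fin (n ω) → ℕ}
    {Y : (ω : Ω) → Fin (s ω) → BasisLabel (d ω)}
    (hs : ∀ ω, 0 < s ω) (hK : Feas N e fun ω => .nat (s ω)) (hKb : PolyBdd N s)
    (hY : Feas (fun q : (ω : Ω) × Fin (s ω) => N q.1) (fun q => .pair (e q.1) (.nat q.2))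
      fun q => labelDatum (Y q.1 q.2))
    (hw : Feas (fun q : (ω : Ω) × Fin (s ω) => N q.1) (fun q => .pair (e q.1) (.nat q.2))
      fun q => gaussDatum (w q.1 q.2)) (hR : Feas N e fun ω => .nat (R ω)) :
    Feas N e fun ω => ampListDatum (stereoList (Y ω) (w ω) (R ω)) := by
  have ho := outer hK.bdd_left hKb
  have h1 := hY.pair ((stereoNum hs hK hKb hw hR).pair ((stereoDen hs hK hKb hw hR).lift Sigma.fst ho))
  have h2 : Feas N e fun ω => .ofList (((List.finRange (s ω)).map fun k =>
      (Y ω k, _root_.stereoNum (w ω) (R ω) k, _root_.stereoDen (w ω) (R ω))).map fun e : AmpEntry (d ω) =>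
        .pair (labelDatum e.1) (.pair (intPairDatum e.2.1) (.int e.2.2))) :=
    (ofFn hK hKb h1).congr fun ω => by
      rw [Datum.ofFn, List.ofFn_eq_map, List.map_map, Function.comp_def]
  have h3 := h2.item
  exact filterEnc (c := fun ω (e : AmpEntry (d ω)) => ¬ (e.2.1.1 = 0 ∧ e.2.1.2 = 0)) h2
    ((h3.snd.fst.fst.eq (h3.lit 0)).and (h3.snd.fst.snd.eq (h3.lit 0))).not

end Feas

namespace SimData.Computable

variable {Ω : Type} {N : Ω → ℕ} {e : Ω → Datum} {n : Ω → ℕ} {d : (ω : Ω) → Fin (n ω) → ℕ}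
  {S : (ω : Ω) → SimData (d ω)} {R : (ω : Ω) → Fin (S ω).J → (S ω).Seed}

theorem zeroLabel (h : Computable N e S R) : Feas N e fun ω => labelDatum (S ω).zeroLabel :=
  Feas.ofFn h.numQudits h.n_bdd ((Feas.index h.numQudits.bdd_left h.n_bdd).natLit 0)

theorem cands_bdd (h : Computable N e S R) (i : Ω → ℕ) :
    PolyBdd N fun ω => (Datum.ofList (((S ω).cands (R ω) (i ω)).map labelDatum)).size := by
  obtain ⟨D, hD⟩ := h.dim_le
  refine ((PolyBdd.const N 1).add (((PolyBdd.const N 4).mul h.K_bdd).mul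
    ((PolyBdd.const N 2).add (h.n_bdd.mul (.const N (2 + D)))))).mono fun ω => ?_
  rw [Datum.size_ofList, List.map_map]
  refine Nat.add_le_add_left ((List.sum_le_card_nsmul _ (2 + n ω * (2 + D)) fun m hm => ?_).trans ?_) _
  · obtain ⟨y, _, rfl⟩ := List.mem_map.1 hm
    have := size_labelDatum_le (hD ω) y
    simp only [Function.comp_apply]
    omega
  · rw [List.length_map, smul_eq_mul]
    exact Nat.mul_le_mul_right _ ((S ω).length_cands_le (R ω) (h.K_pos ω) _)

theorem extend (h : Computable N e S R) {i : (ω : Ω) → Fin (n ω)} {L : (ω : Ω) → List (BasisLabel (d ω))}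
    (hi : Feas N e fun ω => .nat (i ω)) (hL : Feas N e fun ω => .ofList ((L ω).map labelDatum)) :
    Feas N e fun ω => .ofList (((((L ω).flatMap fun y => (List.finRange (d ω (i ω))).map fun c =>
        Function.update y (i ω) c).filter ((S ω).Heavy (R ω) (i ω + 1))).take (4 * (S ω).K)).map
          labelDatum) := by
  have hitem := hL.item
  have ho := Feas.outer hi.bdd_left hL.bdd_lengthEnc
  have hi' := hi.lift Sigma.fst ho
  have h' := h.lift Sigma.fst ho
  have ho' := Feas.outer ho.bdd_left (h'.dim_bdd fun q => i q.1)
  have hc := Feas.index ho.bdd_left (h'.dim_bdd fun q => i q.1)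
  have h1 : Feas N e fun ω => .ofList (((L ω).flatMap fun y =>
      (List.finRange (d ω (i ω))).map fun c => Function.update y (i ω) c).map labelDatum) := by
    refine Feas.flatMapEnc (enc' := fun ω => labelDatum) hL ((Feas.ofFn
      (g := fun q c => labelDatum (Function.update ((L q.1).get q.2) (i q.1) c)) (h'.dim hi')
      (h'.dim_bdd _) (Feas.labelUpdate (c := fun q => q.2) (h'.n_bdd.reindex _)
        (hitem.lift Sigma.fst ho') (hi'.lift Sigma.fst ho') hc)).congr fun q => ?_)
    rw [Datum.ofFn, List.ofFn_eq_map, List.map_map]; rfl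
  have ho2 := Feas.outer hi.bdd_left h1.bdd_lengthEnc
  have hi2 := hi.lift Sigma.fst ho2
  exact Feas.takeEnc (Feas.filterEnc h1
    ((h.lift Sigma.fst ho2).heavy (hi2.natAdd (hi2.natLit 1)) h1.item)) ((h.K.natLit 4).natMul h.K)

theorem cands (h : Computable N e S R) :
    Feas N e fun ω => .ofList (((S ω).cands (R ω) (n ω)).map labelDatum) := by
  refine Feas.iterate (s := fun ω i => .ofList (((S ω).cands (R ω) i).map labelDatum))
    h.numQudits h.n_bdd (h.zeroLabel.cons h.zeroLabel.nil) ?_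
  have hI := Feas.id (Feas.bdd_pair (h.numQudits.bdd_left.reindex Sigma.fst)
    (Feas.bdd_pair (Feas.bdd_loopIndex h.n_bdd)
      ((h.lift (Ω' := (ω : Ω) × Fin (n ω)) Sigma.fst
        (Feas.outer h.numQudits.bdd_left h.n_bdd)).cands_bdd fun q => q.2)))
  exact ((h.lift Sigma.fst hI.fst).extend (i := fun q => q.2) hI.snd.fst hI.snd.snd).congr fun q => by
    rw [cands_succ _ _ q.2.2]

theorem support (h : Computable N e S R) :
    Feas N e fun ω => .ofList (((S ω).support (R ω)).map labelDatum) :=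
  ((h.cands.lengthEnc.natEq (h.K.natLit 0)).ite (h.zeroLabel.cons h.zeroLabel.nil) h.cands).congr
    fun ω => by
      rw [SimData.support]
      split_ifs <;> rfl

theorem output (h : Computable N e S R) :
    Feas N e fun ω => ampListDatum ((S ω).output (R ω)) := by
  have hS := h.support
  have ho := Feas.outer h.K.bdd_left hS.bdd_lengthEnc
  have h' := h.lift Sigma.fst ho
  exact Feas.stereoList (fun ω => (S ω).length_support_pos (R ω)) hS.lengthEnc hS.bdd_lengthEnc hS.item
    ((h'.ampSum true hS.item).pair (h'.ampSum false hS.item)) (h.J.natMul h.M)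

end SimData.Computable

/-! ### The input of the simulation -/

theorem Datum.size_nat_le_of_lt {k m : ℕ} (h : k < 2 ^ m) : (Datum.nat k).size ≤ 1 + m := by
  simpa [Datum.nat, Datum.size] using Nat.size_le.2 h

theorem Datum.size_int_le_of_lt {z : ℤ} {m : ℕ} (h : z.natAbs < 2 ^ m) : (Datum.int z).size ≤ 1 + m :=
  Nat.add_le_add_left (Nat.size_le.2 h) 1

theorem seedEquiv_fst (n q bS : ℕ) (c : Fin (q ^ n * 2 ^ bS)) (i : Fin n) :
    ((seedEquiv n q bS c).1 i : ℕ) = c / 2 ^ bS / q ^ (i : ℕ) % q := by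
  simp [seedEquiv]

theorem seedEquiv_snd (n q bS : ℕ) (c : Fin (q ^ n * 2 ^ bS)) :
    ((seedEquiv n q bS c).2 : ℕ) = c % 2 ^ bS := by
  simp [seedEquiv]

/-- The digit of index `j`, in base `q ^ n * 2 ^ bS`, of the coin flips `r`. The seed of the sample `j`
is encoded in this digit. -/
def seedDigit (n q bS J r j : ℕ) : ℕ :=
  r % (q ^ n * 2 ^ bS) ^ J / (q ^ n * 2 ^ bS) ^ j % (q ^ n * 2 ^ bS)

theorem seeds_fst (n q bS J : ℕ) (hq : 0 < q) (r : ℕ) (j : Fin J) (i : Fin n) :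
    ((seeds n q bS J hq r j).1 i : ℕ) = seedDigit n q bS J r j / 2 ^ bS / q ^ (i : ℕ) % q := by
  rw [seeds, seedEquiv_fst, seedDigit]; simp

theorem seeds_snd (n q bS J : ℕ) (hq : 0 < q) (r : ℕ) (j : Fin J) :
    ((seeds n q bS J hq r j).2 : ℕ) = seedDigit n q bS J r j % 2 ^ bS := by
  rw [seeds, seedEquiv_snd, seedDigit]; simp

theorem Feas.seedDigit {Ω : Type} {N : Ω → ℕ} {e : Ω → Datum} {n q bS J r j : Ω → ℕ}
    (hn : Feas N e fun ω => .nat (n ω)) (hnb : PolyBdd N n) (hq : Feas N e fun ω => .nat (q ω))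
    (hbS : Feas N e fun ω => .nat (bS ω)) (hbSb : PolyBdd N bS)
    (hJ : Feas N e fun ω => .nat (J ω)) (hJb : PolyBdd N J) (hr : Feas N e fun ω => .nat (r ω))
    (hj : Feas N e fun ω => .nat (j ω)) (hjb : PolyBdd N j) :
    Feas N e fun ω => .nat (seedDigit (n ω) (q ω) (bS ω) (J ω) (r ω) (j ω)) := by
  have hβ := (hq.natPow hn hnb).natMul ((hq.natLit 2).natPow hbS hbSb)
  exact ((hr.natMod (hβ.natPow hJ hJb)).natDiv (hβ.natPow hj hjb)).natMod hβ

/-- The parameters of a simulation: the instance `w`, the numbers `t`, `k = ⌈1/ε⌉`,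
`l = ⌈log₂ (1/δ)⌉`, and the matrix entries `a` to `polyBound p N` binary digits, with the bounds that
make the input polynomially long. -/
structure SimParams {ι : Type} {n : ι → ℕ} (d : (w : ι) → Fin (n w) → ℕ) (p : ℕ) where
  w : ι
  t : ℕ
  k : ℕ
  l : ℕ
  a : (i : Fin (n w)) → Fin (d w i) → Fin (d w i) → ℤ × ℤ
  pos : ∀ j, 0 < d w j
  one_le : 1 ≤ t * k
  a_lt : ∀ i x y, (a i x y).1.natAbs < 2 ^ (polyBound p (n w + t + k + l) + 2) ∧
    (a i x y).2.natAbs < 2 ^ (polyBound p (n w + t + k + l) + 2)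

namespace SimParams

variable {ι : Type} {n : ι → ℕ} {d : (w : ι) → Fin (n w) → ℕ} {p : ℕ}

/-- The size parameter. -/
def size (I : SimParams d p) : ℕ := n I.w + I.t + I.k + I.l

/-- The precision at which the states are queried and sampled. -/
def prec (I : SimParams d p) : ℕ := polyBound p I.size * (n I.w + 1)

/-- The data from which the simulation works, with all precisions and the number of samples. The failure
probability of a single estimate at accuracy `1 / (8 * K)` is `2 * exp (-(J / (4096 * K ^ 2)))`, which
has to compensate for the number of labels, below `2 ^ (D * n)`. -/
def simData {b₀ : ℕ} (D : ℕ)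
    (X : (w : ι) → (m : ℕ) → Fin (2 ^ polyBound b₀ (n w + m)) → BasisLabel (d w))
    (z : (w : ι) → ℕ → BasisLabel (d w) → ℤ × ℤ) (I : SimParams d p) : SimData (d I.w) where
  pos := I.pos
  P := polyBound p I.size
  bS := polyBound b₀ (n I.w + I.prec)
  K := I.t * I.k
  J := 4096 * (I.t * I.k) ^ 2 * (I.l + 3 + n I.w * (D + 1))
  a := fun i x y => ⟨(I.a i x y).1, (I.a i x y).2⟩
  z := fun x => ⟨(z I.w I.prec x).1, (z I.w I.prec x).2⟩
  X := X I.w I.prec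

/-- The input of the program. -/
def datum (code : ι → Datum) (I : SimParams d p) (r : ℕ) : Datum :=
  .pair (instanceDatum (code I.w) (d I.w))
    (.pair (.ofList [.nat I.t, .nat I.k, .nat I.l]) (.pair (matricesDatum I.a) (.nat r)))

/-- Parameters together with coin flips. -/
abbrev WithCoins (d : (w : ι) → Fin (n w) → ℕ) (p b : ℕ) : Type :=
  (I : SimParams d p) × Fin (2 ^ polyBound b I.size)

variable {code : ι → Datum} {κ b b₀ D : ℕ}

theorem bdd_datum (hd : ∀ w i, d w i ≤ D) (hκ : ∀ w, (code w).size ≤ polyBound κ (n w)) :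
    PolyBdd (fun q : WithCoins d p b => q.1.size) fun q => (q.1.datum code q.2).size := by
  have hn : PolyBdd (fun q : WithCoins d p b => q.1.size) fun q => n q.1.w :=
    (PolyBdd.self _).mono fun q => by simp only [size]; omega
  have hP := (PolyBdd.self fun q : WithCoins d p b => q.1.size).polyBound p
  have h1 : PolyBdd (fun q : WithCoins d p b => q.1.size)
      fun q => (instanceDatum (code q.1.w) (d q.1.w)).size :=
    Feas.bdd_pair ((hn.polyBound κ).mono fun q => hκ _)
      (((PolyBdd.const _ 1).add (hn.mul (.const _ (1 + (1 + D))))).mono fun q =>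
        Datum.size_ofFn_le fun i => (Datum.size_nat_le _).trans (Nat.add_le_add_left (hd _ _) 1))
  have h2 : PolyBdd (fun q : WithCoins d p b => q.1.size) fun q =>
      (Datum.ofList [.nat q.1.t, .nat q.1.k, .nat q.1.l]).size :=
    ((PolyBdd.const _ 7).add ((PolyBdd.const _ 3).mul (.self _))).mono fun q => by
      have := Datum.size_nat_le q.1.t
      have := Datum.size_nat_le q.1.k
      have := Datum.size_nat_le q.1.l
      simp only [Datum.size_ofList, List.map_cons, List.map_nil, List.sum_cons, List.sum_nil, size]
      omega
  have h3 : PolyBdd (fun q : WithCoins d p b => q.1.size) fun q => (matricesDatum q.1.a).size := by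
    refine ((PolyBdd.const _ 1).add (hn.mul ((PolyBdd.const _ 1).add ((PolyBdd.const _ 1).add
      ((PolyBdd.const _ D).mul ((PolyBdd.const _ 1).add ((PolyBdd.const _ 1).add
      ((PolyBdd.const _ D).mul ((PolyBdd.const _ 1).add
        ((PolyBdd.const _ 7).add ((PolyBdd.const _ 2).mul hP))))))))))).mono fun q => ?_
    refine Datum.size_ofFn_le fun i => (Datum.size_ofFn_le (B := 1 + D * (1 + (7 + 2 *
      polyBound p q.1.size))) fun x => (Datum.size_ofFn_le (B := 7 + 2 * polyBound p q.1.size)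
        fun y => ?_).trans ?_).trans ?_
    · have h := q.1.a_lt i x y
      have h1 := Datum.size_int_le_of_lt h.1
      have h2 := Datum.size_int_le_of_lt h.2
      rw [intPairDatum, Datum.size, size]
      omega
    · exact Nat.add_le_add_left (Nat.mul_le_mul_right _ (hd _ _)) _
    · exact Nat.add_le_add_left (Nat.mul_le_mul_right _ (hd _ _)) _
  have h4 : PolyBdd (fun q : WithCoins d p b => q.1.size) fun q => (Datum.nat q.2).size :=
    ((PolyBdd.const _ 1).add ((PolyBdd.self _).polyBound b)).mono fun q =>
      Datum.size_nat_le_of_lt q.2.2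
  exact Feas.bdd_pair h1 (Feas.bdd_pair h2 (Feas.bdd_pair h3 h4))

/-- From programs that sample and query the states, all data of the simulation are obtained in
polynomial time. -/
theorem computable_simData (hd : ∀ w i, d w i ≤ D) (hκ : ∀ w, (code w).size ≤ polyBound κ (n w))
    {X : (w : ι) → (m : ℕ) → Fin (2 ^ polyBound b₀ (n w + m)) → BasisLabel (d w)}
    {z : (w : ι) → ℕ → BasisLabel (d w) → ℤ × ℤ}
    (hX : Feas (fun q : (q : ι × ℕ) × Fin (2 ^ polyBound b₀ (n q.1 + q.2)) => n q.1.1 + q.1.2)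
      (fun q => .pair (instanceDatum (code q.1.1) (d q.1.1)) (.pair (.nat q.1.2) (.nat q.2)))
      fun q => labelDatum (X q.1.1 q.1.2 q.2))
    (hz : Feas (fun q : (q : ι × ℕ) × BasisLabel (d q.1) => n q.1.1 + q.1.2)
      (fun q => .pair (instanceDatum (code q.1.1) (d q.1.1)) (.pair (.nat q.1.2) (labelDatum q.2)))
      fun q => intPairDatum (z q.1.1 q.1.2 q.2)) :
    SimData.Computable (fun q : WithCoins d p b => q.1.size) (fun q => q.1.datum code q.2)
      (fun q => q.1.simData D X z) fun q => seeds _ _ _ _ (by positivity) q.2 := by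
  have hI := Feas.id (bdd_datum (p := p) (b := b) hd hκ)
  have hinst := hI.fst
  have hdims := hinst.snd
  have ht := hI.snd.fst.fst
  have hk := hI.snd.fst.snd.fst
  have hl := hI.snd.fst.snd.snd.fst
  have ha := hI.snd.snd.fst
  have hr := hI.snd.snd.snd
  have hn := hdims.lengthFn
  have hN : Feas (fun q : WithCoins d p b => q.1.size) (fun q => q.1.datum code q.2)
    fun q => .nat q.1.size := ((hn.natAdd ht).natAdd hk).natAdd hl
  have hNb := PolyBdd.self fun q : WithCoins d p b => q.1.size
  have hnb : PolyBdd (fun q : WithCoins d p b => q.1.size) fun q => n q.1.w :=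
    hNb.mono fun q => by simp only [size]; omega
  have htb : PolyBdd (fun q : WithCoins d p b => q.1.size) fun q => q.1.t :=
    hNb.mono fun q => by simp only [size]; omega
  have hkb : PolyBdd (fun q : WithCoins d p b => q.1.size) fun q => q.1.k :=
    hNb.mono fun q => by simp only [size]; omega
  have hlb : PolyBdd (fun q : WithCoins d p b => q.1.size) fun q => q.1.l :=
    hNb.mono fun q => by simp only [size]; omega
  have hm := (hN.natPolyBound p).natMul (hn.natAdd (hn.natLit 1))
  have hmb := (hNb.polyBound p).mul (hnb.add (.const _ 1))
  have hbS := (hn.natAdd hm).natPolyBound b₀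
  have hbSb := (hnb.add hmb).polyBound b₀
  have hK := ht.natMul hk
  have hKb := htb.mul hkb
  have hJ := ((hn.natLit 4096).natMul (hK.natConstPow 2)).natMul
    ((hl.natAdd (hn.natLit 3)).natAdd (hn.natMul (hn.natLit (D + 1))))
  have hJb := ((PolyBdd.const _ 4096).mul (hKb.pow 2)).mul
    ((hlb.add (.const _ 3)).add (hnb.mul (.const _ (D + 1))))
  have hq := (hn.natLit 2).natPow ((hn.natLit 2).natMul (hN.natPolyBound p))
    ((PolyBdd.const _ 2).mul (hNb.polyBound p))
  have ho := Feas.outer hI.bdd hJb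
  have hi := Feas.index hI.bdd hJb
  have hibd := hJb.reindex (Ω' := (q : WithCoins d p b) ×
    Fin (4096 * (q.1.t * q.1.k) ^ 2 * (q.1.l + 3 + n q.1.w * (D + 1)))) Sigma.fst
  have hdigit := Feas.seedDigit (hn.lift Sigma.fst ho) (hnb.reindex Sigma.fst) (hq.lift Sigma.fst ho)
    (hbS.lift Sigma.fst ho) (hbSb.reindex Sigma.fst) (hJ.lift Sigma.fst ho) (hJb.reindex Sigma.fst)
    (hr.lift Sigma.fst ho) hi (hibd.mono fun q => q.2.2.le)
  exact {
    dims := hdims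
    dim_le := ⟨D, fun q => hd _⟩
    n_bdd := hnb
    K_pos := fun q => q.1.one_le
    P := hN.natPolyBound p
    P_bdd := hNb.polyBound p
    K := hK
    K_bdd := hKb
    J := hJ
    J_bdd := hJb
    a := ha
    z := by
      have hE := Feas.id (N := fun q : (q : WithCoins d p b) × BasisLabel (d q.1.w) => q.1.1.size)
        (Feas.bdd_pair (hI.bdd.reindex Sigma.fst) (((PolyBdd.const _ 1).add ((hnb.mul
          (.const _ (2 + D))).reindex fun q : (q : WithCoins d p b) × BasisLabel (d q.1.w) => q.1)).mono
            fun q => size_labelDatum_le (hd _) q.2))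
      exact ((hz.reindex (Ω' := (q : WithCoins d p b) × BasisLabel (d q.1.w))
        fun q => ⟨(q.1.1.w, q.1.1.prec), q.2⟩).mono ((hnb.add hmb).reindex Sigma.fst)).comp
          ((hinst.lift Sigma.fst hE.fst).pair ((hm.lift Sigma.fst hE.fst).pair hE.snd))
    X := by
      refine ((hX.reindex (Ω' := (q : WithCoins d p b) × Fin (q.1.simData D X z).J)
        fun q => ⟨(q.1.1.w, q.1.1.prec), (seeds _ _ _ _ (by positivity) q.1.2 q.2).2⟩).mono
          ((hnb.add hmb).reindex Sigma.fst)).comp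
            ((hinst.lift Sigma.fst ho).pair ((hm.lift Sigma.fst ho).pair
              ((hdigit.natMod (((hn.natLit 2).natPow hbS hbSb).lift Sigma.fst ho)).congr fun q => ?_)))
      rw [seeds_snd]
      rfl
    seed := by
      have ho' := Feas.outer hi.bdd_left (hnb.reindex Sigma.fst)
      have hi' := Feas.index hi.bdd_left (hnb.reindex Sigma.fst)
      have hq' := (hq.lift Sigma.fst ho).lift Sigma.fst ho'
      refine ((((hdigit.lift Sigma.fst ho').natDiv ((((hn.natLit 2).natPow hbS hbSb).lift Sigma.fst
        ho).lift Sigma.fst ho')).natDiv (hq'.natPow hi' ?_)).natMod hq').congr fun q => ?_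
      · exact ((hnb.reindex Sigma.fst).reindex Sigma.fst).mono fun q => q.2.2.le
      · rw [seeds_fst]
        rfl }

end SimParams

/-! ### Choice of the parameters -/

theorem norm_toEuclideanLin_unitary {m : Type} [Fintype m] [DecidableEq m]
    (U : Matrix.unitaryGroup m ℂ) (v : EuclideanSpace ℂ m) :
    ‖Matrix.toEuclideanLin U.1 v‖ = ‖v‖ := by
  have h1 : Matrix.toEuclideanLin U.1.conjTranspose (Matrix.toEuclideanLin U.1 v) = v := by
    have h2 : U.1.conjTranspose * U.1 = 1 := Matrix.mem_unitaryGroup_iff'.1 U.2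
    ext i
    simp [Matrix.toLpLin_apply, Matrix.mulVec_mulVec, h2]
  rw [← sq_eq_sq₀ (norm_nonneg _) (norm_nonneg _)]
  have h3 : inner ℂ (Matrix.toEuclideanLin U.1 v) (Matrix.toEuclideanLin U.1 v) = inner ℂ v v := by
    rw [← LinearMap.adjoint_inner_left, ← Matrix.toEuclideanLin_conjTranspose_eq_adjoint, h1]
  rw [inner_self_eq_norm_sq_to_K, inner_self_eq_norm_sq_to_K] at h3
  exact_mod_cast h3

theorem toEuclideanLin_tensorProductMatrix_apply {n : ℕ} {d : Fin n → ℕ}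
    (u : (i : Fin n) → Matrix (Fin (d i)) (Fin (d i)) ℂ) (ψ : QuditSpace d) (y : BasisLabel d) :
    Matrix.toEuclideanLin (tensorProductMatrix u) ψ y = outAmp u ψ y := by
  simp [Matrix.toLpLin_apply, Matrix.mulVec, dotProduct, tensorProductMatrix, outAmp]

theorem card_basisLabel_le {n D : ℕ} {d : Fin n → ℕ} (hd : ∀ i, d i ≤ D) :
    Fintype.card (BasisLabel d) ≤ 2 ^ (D * n) := by
  rw [Fintype.card_pi]
  simp only [Fintype.card_fin]
  calc ∏ i, d i ≤ ∏ _i : Fin n, 2 ^ D :=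
        Finset.prod_le_prod' fun i _ => (hd i).trans Nat.lt_two_pow_self.le
    _ = _ := by simp [pow_mul]

/-- With this number of binary digits, the precision required in `SimData.Accurate` is reached. -/
theorem precision_le {n t k l D : ℕ} {d : Fin n → ℕ} (hd : ∀ i, d i ≤ D) :
    16 * (t * k) * (44 + 6 * D) * 2 ^ n * Fintype.card (BasisLabel d) ^ 2 ≤
      2 ^ polyBound (11 + 3 * D) (n + t + k + l) := by
  have h1 : t * k ≤ 2 ^ (t + k) := by
    rw [pow_add]; exact Nat.mul_le_mul Nat.lt_two_pow_self.le Nat.lt_two_pow_self.le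
  have h2 : 44 + 6 * D ≤ 2 ^ (6 + D) := by
    have h3 : D < 2 ^ D := Nat.lt_two_pow_self
    rw [pow_add]
    omega
  have h3 : Fintype.card (BasisLabel d) ^ 2 ≤ (2 ^ (D * n)) ^ 2 :=
    Nat.pow_le_pow_left (card_basisLabel_le hd) 2
  calc _ ≤ 2 ^ 4 * 2 ^ (t + k) * 2 ^ (6 + D) * 2 ^ n * (2 ^ (D * n)) ^ 2 := by gcongr; norm_num
    _ = 2 ^ (4 + (t + k) + (6 + D) + n + D * n * 2) := by simp only [pow_add, pow_mul]
    _ ≤ _ := Nat.pow_le_pow_right (by norm_num) ?_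
  have h4 : (n + t + k + l + 1) ^ 1 ≤ (n + t + k + l + 1) ^ (11 + 3 * D) :=
    Nat.pow_le_pow_right (by omega) (by omega)
  calc _ ≤ (11 + 3 * D) * (n + t + k + l + 1) ^ 1 := by
        nlinarith [Nat.zero_le (D * n), Nat.zero_le (D * (t + k + l))]
    _ ≤ _ := Nat.mul_le_mul_left _ h4

/-- The number of samples in `SimParams.simData` suffices for the union bound in
`SimData.Accurate.card_good_ge`. -/
theorem failure_le {n l K D : ℕ} {d : Fin n → ℕ} (hd : ∀ i, d i ≤ D) (hK : 1 ≤ K) :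
    2 * ((n + 3) * Fintype.card (BasisLabel d) : ℕ) *
      Real.exp (-(((4096 * K ^ 2 * (l + 3 + n * (D + 1)) : ℕ) : ℝ) * (1 / (8 * K)) ^ 2 / 64)) ≤
        1 / 2 ^ l := by
  have hK' : (K : ℝ) ≠ 0 := by positivity
  have h1 : ((4096 * K ^ 2 * (l + 3 + n * (D + 1)) : ℕ) : ℝ) * (1 / (8 * K)) ^ 2 / 64 =
      ((l + 3 + n * (D + 1) : ℕ) : ℝ) := by
    push_cast; field_simp; norm_num
  have h2 : Real.exp (-((l + 3 + n * (D + 1) : ℕ) : ℝ)) ≤ 1 / 2 ^ (l + 3 + n * (D + 1)) := by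
    rw [Real.exp_neg, ← one_div, ← Real.exp_one_pow]
    have : (2 : ℝ) ≤ Real.exp 1 := by linarith [Real.exp_one_gt_d9]
    gcongr
  have h3 : 2 * ((n + 3) * Fintype.card (BasisLabel d)) ≤ 2 ^ (n + 3) * 2 ^ (D * n) := by
    rw [← mul_assoc]
    refine Nat.mul_le_mul ?_ (card_basisLabel_le hd)
    have : n < 2 ^ n := Nat.lt_two_pow_self
    rw [pow_add]; omega
  have h3' : 2 * (((n + 3) * Fintype.card (BasisLabel d) : ℕ) : ℝ) ≤ 2 ^ (n + 3) * 2 ^ (D * n) := by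
    exact_mod_cast h3
  rw [h1]
  calc _ ≤ (2 ^ (n + 3) * 2 ^ (D * n)) * (1 / 2 ^ (l + 3 + n * (D + 1)) : ℝ) := by gcongr
    _ = _ := by
      rw [show l + 3 + n * (D + 1) = l + ((n + 3) + D * n) by ring, pow_add _ l, ← pow_add]
      field_simp

/-- The running time is polynomial in `1 / ε` and `log (1 / δ)`. -/
theorem polyBound_ceil_le (c n t : ℕ) {ε δ : ℝ} (hε : 0 < ε) (hδ : 0 < δ) (hδ' : δ < 1) :
    (polyBound c (n + t + ⌈1 / ε⌉₊ + ⌈Real.logb 2 (1 / δ)⌉₊) : ℝ) ≤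
      (c * 3 ^ c : ℕ) * (n + t + 1 / ε + Real.log (1 / δ) + 1) ^ (c * 3 ^ c) := by
  have h0 : 0 < Real.log (1 / δ) := Real.log_pos ((one_lt_div hδ).2 hδ')
  have h1 := (Nat.ceil_lt_add_one (show 0 ≤ 1 / ε by positivity)).le
  have h2 : 0 ≤ Real.logb 2 (1 / δ) := div_nonneg h0.le (Real.log_nonneg (by norm_num))
  have h3 := (Nat.ceil_lt_add_one h2).le
  have h4 : Real.logb 2 (1 / δ) ≤ 2 * Real.log (1 / δ) := by
    rw [Real.logb, div_le_iff₀ (Real.log_pos (by norm_num))]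
    nlinarith [Real.log_two_gt_d9]
  have hε' : 0 < 1 / ε := by positivity
  set B : ℝ := n + t + 1 / ε + Real.log (1 / δ) + 1 with hB
  have hB1 : 1 ≤ B := by rw [hB]; linarith [Nat.cast_nonneg (α := ℝ) n, Nat.cast_nonneg (α := ℝ) t]
  have h5 : (n + t + ⌈1 / ε⌉₊ + ⌈Real.logb 2 (1 / δ)⌉₊ + 1 : ℝ) ≤ 3 * B := by
    rw [hB]; linarith [Nat.cast_nonneg (α := ℝ) n, Nat.cast_nonneg (α := ℝ) t]
  calc (polyBound c (n + t + ⌈1 / ε⌉₊ + ⌈Real.logb 2 (1 / δ)⌉₊) : ℝ)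
      = c * (n + t + ⌈1 / ε⌉₊ + ⌈Real.logb 2 (1 / δ)⌉₊ + 1 : ℝ) ^ c := by simp [polyBound]
    _ ≤ c * (3 * B) ^ c := by gcongr
    _ = (c * 3 ^ c : ℕ) * B ^ c := by push_cast; rw [mul_pow, mul_assoc]
    _ ≤ _ := by
      gcongr
      exact Nat.le_mul_of_pos_right _ (by positivity)

/-- A unit vector is not approximately `0`-sparse. -/
theorem sparsity_pos {n : ℕ} {d : Fin n → ℕ} {t : ℕ} {ε : ℝ} {φ : QuditSpace d} (hε : ε ≤ 1 / 6)
    (hφ : ‖φ‖ = 1) (h : IsApproxSparse (√ε) t φ) : 1 ≤ t := by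
  obtain ⟨v, hv, hv'⟩ := h
  by_contra ht
  have : IsEmpty {x // v x ≠ 0} := by
    rw [← Finite.card_eq_zero_iff]; omega
  have hv0 : v = 0 := by
    ext x
    by_contra hx
    exact this.false ⟨x, hx⟩
  rw [hv0, sub_zero, hφ, Real.one_le_sqrt] at hv'
  linarith

/-- Approximate entries of a unitary matrix are small integers. -/
theorem natAbs_lt_of_dyadic_close {v : ℂ} (hv : ‖v‖ ≤ 1) {P : ℕ} {z : ℤ × ℤ}
    (h : ‖v - dyadic P z‖ ≤ 1 / 2 ^ P) : z.1.natAbs < 2 ^ (P + 2) ∧ z.2.natAbs < 2 ^ (P + 2) := by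
  have hP : (1 : ℝ) ≤ 2 ^ P := one_le_pow₀ (by norm_num)
  have h1 : ‖(z.1 + z.2 * Complex.I : ℂ)‖ ≤ 2 ^ P + 1 := by
    have h2 : ‖dyadic P z‖ ≤ 1 + 1 / 2 ^ P := by
      have := norm_sub_norm_le (dyadic P z) v
      rw [norm_sub_rev] at h
      linarith
    rw [dyadic, norm_div, norm_pow, Complex.norm_ofNat, div_le_iff₀ (by positivity)] at h2
    refine h2.trans_eq ?_
    field_simp
  have h3 := (Complex.abs_re_le_norm _).trans h1
  have h4 := (Complex.abs_im_le_norm _).trans h1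
  have h5 : ∀ m : ℤ, |(m : ℝ)| ≤ 2 ^ P + 1 → m.natAbs < 2 ^ (P + 2) := by
    intro m hm
    have h6 : ((m.natAbs : ℕ) : ℝ) ≤ ((2 ^ P + 1 : ℕ) : ℝ) := by
      rw [Nat.cast_natAbs]; push_cast; exact hm
    have h7 : m.natAbs ≤ 2 ^ P + 1 := by exact_mod_cast h6
    have h8 : 1 ≤ 2 ^ P := Nat.one_le_two_pow
    rw [pow_add]; omega
  simp at h3 h4
  exact ⟨h5 _ h3, h5 _ h4⟩

theorem dyadic_eq (m : ℕ) (z : ℤ × ℤ) :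
    dyadic m z = ((⟨z.1, z.2⟩ : GaussianInt) : ℂ) / 2 ^ m := by
  rw [dyadic, GaussianInt.toComplex_def]

/-- Instances `w : ι` have a classical description `code w` of length polynomial in the number
`n w` of qudits. The tensor product unitary `u₁ ⊗ ⋯ ⊗ uₙ` is arbitrary; the algorithm receives its
factors with polynomially many binary digits, together with `t`, `⌈1/ε⌉` and `⌈log₂ (1/δ)⌉`. -/
theorem mainTheorem4 :
    ∃ C : ℝ, 0 < C ∧
      ∀ (ι : Type) (n : ι → ℕ) (d : (w : ι) → Fin (n w) → ℕ) (D : ℕ) (code : ι → Datum) (κ : ℕ)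
        (ψin : (w : ι) → QuditSpace (d w))
        (U₁ : (w : ι) → Matrix.unitaryGroup (BasisLabel (d w)) ℂ),
        (∀ w i, d w i ≤ D) →
        (∀ w, (code w).size ≤ polyBound κ (n w)) →
        (∀ w, ‖ψin w‖ = 1) →
        IsCT d code (fun w => Matrix.toEuclideanLin (U₁ w).1 (ψin w)) →
        ∃ (A : Prog) (p b c : ℕ),
          ∀ (w : ι) (u : (i : Fin (n w)) → Matrix.unitaryGroup (Fin (d w i)) ℂ)
            (t : ℕ) (ε δ : ℝ) (ψout : QuditSpace (d w)),
            0 < ε → ε ≤ 1 / 6 → 0 < δ → δ < 1 →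
            ψout = Matrix.toEuclideanLin (tensorProductMatrix fun i => (u i).1)
              (Matrix.toEuclideanLin (U₁ w).1 (ψin w)) →
            IsApproxSparse (√ε) t ψout →
            ∀ (k l N : ℕ), k = ⌈1 / ε⌉₊ → l = ⌈Real.logb 2 (1 / δ)⌉₊ → N = n w + t + k + l →
            ∀ a : (i : Fin (n w)) → Fin (d w i) → Fin (d w i) → ℤ × ℤ,
              (∀ i x y, ‖(u i).1 x y - dyadic (polyBound p N) (a i x y)‖
                ≤ 1 / 2 ^ polyBound p N) →
              ∃ out : Fin (2 ^ polyBound b N) → List (AmpEntry (d w)),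
                (∀ r : Fin (2 ^ polyBound b N),
                  (∃ T : ℕ,
                    Runs A
                      (.pair (instanceDatum (code w) (d w))
                        (.pair (.ofList [.nat t, .nat k, .nat l])
                          (.pair (matricesDatum a) (.nat r))))
                      (ampListDatum (out r)) T ∧
                    (T : ℝ) ≤ c * (n w + t + 1 / ε + Real.log (1 / δ) + 1) ^ c) ∧
                  ListsState (out r) ∧
                  ((out r).length : ℝ) ≤ C * (t / ε)) ∧
                1 - δ ≤ coinProb (polyBound b N)
                  (fun r => ‖listVector (out r) - ψout‖ ≤ C * √ε) := by

  refine ⟨5, by norm_num, fun ι n d D code κ ψin U₁ hd hκ hψin hCT => ?_⟩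
  obtain ⟨⟨Sam, b₀, c₀, hS⟩, Q, c₁, hQ⟩ := hCT
  choose X hX hX' using hS
  choose z hz hz' using hQ
  set p := 11 + 3 * D with hp
  -- the number of coin flips: all seeds are read off the string of outcomes
  obtain ⟨b, hb⟩ : PolyBdd (fun I : SimParams d p => I.size) fun I =>
      (I.simData D X z).J * (2 * (I.simData D X z).P * n I.w + (I.simData D X z).bS) := by
    have hN := PolyBdd.self fun I : SimParams d p => I.size
    have hn : PolyBdd (fun I : SimParams d p => I.size) fun I => n I.w :=
      hN.mono fun I => by simp only [SimParams.size]; omega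
    have ht : PolyBdd (fun I : SimParams d p => I.size) fun I => I.t :=
      hN.mono fun I => by simp only [SimParams.size]; omega
    have hk : PolyBdd (fun I : SimParams d p => I.size) fun I => I.k :=
      hN.mono fun I => by simp only [SimParams.size]; omega
    have hl : PolyBdd (fun I : SimParams d p => I.size) fun I => I.l :=
      hN.mono fun I => by simp only [SimParams.size]; omega
    exact ((((PolyBdd.const _ 4096).mul ((ht.mul hk).pow 2)).mul ((hl.add (.const _ 3)).add
      (hn.mul (.const _ (D + 1)))))).mul ((((PolyBdd.const _ 2).mul (hN.polyBound p)).mul hn).add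
        ((hn.add ((hN.polyBound p).mul (hn.add (.const _ 1)))).polyBound b₀))
  obtain ⟨A, c, hA⟩ := (SimParams.computable_simData (p := p) (b := b) hd hκ (X := X) (z := z)
    ⟨Sam, c₀, fun q => hX q.1.1 q.1.2 q.2⟩ ⟨Q, c₁, fun q => hz' q.1.1 q.1.2 q.2⟩).output
  refine ⟨A, p, b, c * 3 ^ c, fun w u t ε δ φ hε hε' hδ hδ' hφ hsparse k l N hk hl hN a ha => ?_⟩
  set ψ : QuditSpace (d w) := Matrix.toEuclideanLin (U₁ w).1 (ψin w) with hψ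
  have hψ1 : ‖ψ‖ = 1 := (norm_toEuclideanLin_unitary _ _).trans (hψin w)
  have hψs : ∑ x, ‖ψ x‖ ^ 2 = 1 := by rw [← EuclideanSpace.norm_sq_eq, hψ1, one_pow]
  have hφx : ∀ y, φ y = outAmp (fun i => (u i).1) ψ y := fun y => by
    rw [hφ]; exact toEuclideanLin_tensorProductMatrix_apply _ _ _
  -- a qudit of dimension `0` is impossible, because `ψ` is a unit vector
  have hpos : ∀ j, 0 < d w j := by
    intro j
    by_contra h0
    have : IsEmpty (BasisLabel (d w)) := ⟨fun x => by have := (x j).2; omega⟩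
    simp at hψs
  have hφ1 : ‖φ‖ = 1 := by
    have h1 := sum_norm_outAmp_sq (fun i => (u i).2) hψs fun j => ⟨0, hpos j⟩
    simp only [← hφx] at h1
    rw [← EuclideanSpace.norm_sq_eq] at h1
    exact (pow_eq_one_iff_of_nonneg (norm_nonneg φ) two_ne_zero).1 h1
  have ht := sparsity_pos hε' hφ1 hsparse
  -- this makes `⌈1/ε⌉ ≤ 7/6 * (1/ε)`, so that at most `5 * (t / ε)` amplitudes are listed
  have hk6 : 6 ≤ 1 / ε := by rw [le_div_iff₀ hε]; linarith
  have hkε : 1 / ε ≤ k := hk ▸ Nat.le_ceil _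
  have hkε' : (k : ℝ) ≤ 1 / ε + 1 := hk ▸ (Nat.ceil_lt_add_one (by positivity)).le
  have hk1 : 1 ≤ k := by
    have : (1 : ℝ) ≤ k := by linarith
    exact_mod_cast this
  have htk : 1 ≤ t * k := Nat.mul_pos ht hk1
  subst hN
  let I : SimParams d p :=
    { w := w, t := t, k := k, l := l, a := a, pos := hpos, one_le := htk
      a_lt := fun i x y => natAbs_lt_of_dyadic_close (entry_norm_bound_of_unitary (u i).2 x y)
        (ha i x y) }
  set S := I.simData D X z with hSdef
  have hprec : polyBound p I.size ≤ I.prec := Nat.le_mul_of_pos_right _ (by omega)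
  have hprec' : (1 : ℝ) / 2 ^ I.prec ≤ 1 / 2 ^ polyBound p I.size := by
    gcongr
    norm_num
  have hacc : S.Accurate (fun i => (u i).1) ψ D :=
    { unitary := fun i => (u i).2
      sum_norm_sq := hψs
      dim_le := hd w
      a_close := fun j x y => (congrArg (fun v => ‖(u j).1 x y - v‖) (dyadic_eq _ _)).symm.trans_le
        (ha j x y)
      z_close := fun x => (congrArg (fun v => ‖ψ x - v‖) (dyadic_eq _ _)).symm.trans_le
        ((hz w I.prec x).trans hprec')
      X_close := fun x => ((Finset.single_le_sum (fun _ _ => abs_nonneg _) (Finset.mem_univ x)).trans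
        (hX' w I.prec)).trans hprec'
      precision := precision_le (hd w)
      K_pos := htk }
  have hJ : 0 < S.J := Nat.mul_pos (Nat.mul_pos (by norm_num) (pow_pos htk 2)) (by omega)
  have hR : 0 < S.J * S.M := Nat.mul_pos hJ (Nat.mul_pos (by norm_num) htk)
  have hδl : 1 / 2 ^ l ≤ δ := by
    have h1 : Real.logb 2 (1 / δ) ≤ l := hl ▸ Nat.le_ceil _
    rw [Real.logb_le_iff_le_rpow (by norm_num) (by positivity), Real.rpow_natCast] at h1
    rwa [one_div_le (by positivity) hδ]
  have hgood := hacc.card_good_ge hJ ((failure_le (hd w) htk).trans hδl)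
  rw [← coinProb_seeds (P := 2 * S.P) (hb I) (S.Good (fun i => (u i).1) ψ)] at hgood
  refine ⟨fun r => S.output (seeds _ _ _ _ (by positivity) r), fun r => ⟨?_, ?_, ?_⟩, ?_⟩
  · obtain ⟨T, hT, hrun⟩ := hA ⟨I, r⟩
    refine ⟨T, hrun, (Nat.cast_le.2 hT).trans ?_⟩
    have := polyBound_ceil_le c (n w) t hε hδ hδ'
    rw [← hk, ← hl] at this
    exact this
  · exact S.listsState_output _ hR
  · have h1 : ((S.output (seeds _ _ _ _ (by positivity) r)).length : ℝ) ≤ 4 * (t * k) := by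
      exact_mod_cast S.length_output_le (seeds _ _ _ _ (by positivity) r) htk
    refine h1.trans ?_
    rw [div_eq_mul_one_div]
    have ht' : (0 : ℝ) ≤ t := Nat.cast_nonneg t
    nlinarith
  · refine hgood.trans (div_le_div_of_nonneg_right (Nat.cast_le.2 ?_) (by positivity))
    exact Nat.card_mono (Set.toFinite _) fun r hr =>
      SimData.Good.norm_output_sub_le hr (fun i => (u i).2) hψs hR rfl htk hε hkε hφx hsparse
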